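/- Let $k\ge 1$ and $m\ge n\ge k+1$ be integers and let $\lambda_s,\lambda_e>0$. **Network.** A source serves $m$ receiver nodes, of which a set $\mathcal S$ of $s\le n$ nodes are subscribers. Source updates (versions) occur at the jump times $\tau_1,\tau_2,\dots$ of a Poisson process $N_0(t)$ of rate $\lambda_s$, version $\ell$ being generated at $\tau_\ell$ ($\tau_0=0$; version $0$ is the initial information, known to every node). For every ordered pair of distinct receivers $i\neq j$, the edge $i\to j$ is activated at the jump times of a Poisson process of rate $\lambda_e/(m-1)$ (scalable homogeneous network). At $\tau_\ell$ the source encodes version $\ell$ into $n$ distinct keys, any $k+1$ of which suffice to decrypt it, and instantly sends one distinct key to each node of $\mathcal K^\ell=\mathcal S\cup\mathcal M^\ell$, where $\mathcal M^\ell$ is a uniformly random set of $n-s$ nonsubscribers. All the Poisson processes and all the sets $\mathcal M^\ell$ are mutually independent. **Memoryless scheme.** Whenever the edge $i\to j$ is activated at a time $u$ with $N_0(u)=\ell$, node $i$ sends to node $j$ the key of version $\ell$ that it received from the source if $i\in\mathcal K^{\ell}$, and nothing otherwise. Keys obtained from other receivers are never forwarded. Node $j$ can decrypt version $\ell$ as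 soon as it has obtained $k+1$ distinct keys of version $\ell$, counting its own key if $j\in\mathcal K^\ell$. Let $\bar N_j^k(t)$ be the latest version that node $j$ can decrypt at time $t$. The $k$-keys version age of node $j$ is $\bar A_j(k,t)=N_0(t)-\bar N_j^k(t)$, and its time average is $$\bar\Delta_j(k)=\lim_{T\to\infty}\frac1T\int_0^T\bar A_j(k,t)\,dt .$$ **Notation.** $X_{(r:N)}$ is the $r$-th smallest of $N$ independent exponential random variables with mean $(m-1)/\lambda_e$, and $U$ is an exponential random variable with mean $1/\lambda_s$ independent of them. Put $E_0=\{X_{(k:n-1)}\le U\}$ and $E_1=\{X_{(k+1:n)}\le U\}$. **Theorem.** If $j$ is a nonsubscriber node, then with probability $1$ the limit $\bar\Delta_j(k)$ exists and $$\bar\Delta_j(k)=\frac{\alpha_0\,\mathbb E[\min(X_{(k:n-1)},U)]+\alpha_1\,\mathbb E[\min(X_{(k+1:n)},U)]}{\alpha_0\Pr(E_0)\,\mathbb E[U]+\alpha_1\Pr(E_1)\,\mathbb E[U]},\qquad \alpha_0=\frac{n-s}{m-s},\quad \alpha_1=1-\alpha_0 .$$ If $j$ is a subscriber node, then with probability $1$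 the limit $\bar\Delta_j(k)$ exists and $$\bar\Delta_j(k)=\frac{\mathbb E[\min(X_{(k:n-1)},U)]}{\Pr(E_0)\,\mathbb E[U]} .$$ -/

import Mathlib

open MeasureTheory ProbabilityTheory Filter Topology Set
open scoped NNReal

/-- The Poisson counters of a scalable homogeneous network on `m` receiver nodes `Fin m`: the counter
of the updates at the source, and one activation counter for each directed edge `i → j` between two
distinct receivers (the network is fully connected). -/
inductive Counter (m : ℕ) : Type
  | source : Counter m
  | edge (i j : Fin m) (h : i ≠ j) : Counter m

/-- `N` is a Poisson counter with rate `r` on `(Ω, P)`: it starts at `0`, its paths are nondecreasing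
and right-continuous, and its increments are independent, with `N t - N s` Poisson distributed with
mean `r * (t - s)`. -/
structure IsPoissonCounter {Ω : Type*} [MeasurableSpace Ω] (P : Measure Ω)
    (N : ℝ≥0 → Ω → ℕ) (r : ℝ≥0) : Prop where
  measurable : ∀ t, Measurable (N t)
  zero : ∀ ω, N 0 ω = 0
  mono : ∀ ω, Monotone fun t => N t ω
  rightContinuous : ∀ ω t, ContinuousWithinAt (fun u => N u ω) (Set.Ici t) t
  indepIncrements : HasIndepIncrements N P
  increment_law : ∀ s t, s ≤ t →
    HasLaw (fun ω => N t ω - N s ω) (poissonMeasure (r * (t - s))) P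

/-- The activation rate of each edge of a scalable homogeneous network on `m` nodes with gossip rate
`lamE`, that is `lamE / (m - 1)`. -/
noncomputable def edgeRate (m : ℕ) (lamE : ℝ≥0) : ℝ≥0 := lamE / ((m - 1 : ℕ) : ℝ≥0)

/-- The rate of each counter. -/
noncomputable def counterRate {m : ℕ} (lamS lamE : ℝ≥0) : Counter m → ℝ≥0
  | .source => lamS
  | .edge _ _ _ => edgeRate m lamE

/-- The random inputs of a scalable homogeneous network with set of subscribers `S`, in which `n` keys
are generated for each version. The counters `C` are independent Poisson counters. The set `M ℓ` of
nonsubscribers that are sent a key of version `ℓ` by the source is uniform among all sets of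
`n - |S|` nonsubscribers, independently for each version and independently of the counters. -/
structure IsHomogeneousNetwork {Ω : Type*} [MeasurableSpace Ω] (P : Measure Ω) {m : ℕ}
    (n : ℕ) (lamS lamE : ℝ≥0) (S : Finset (Fin m))
    (C : Counter m → ℝ≥0 → Ω → ℕ) (M : ℕ → Ω → Finset (Fin m)) : Prop where
  poisson : ∀ c, IsPoissonCounter P (C c) (counterRate lamS lamE c)
  counters_indep : iIndepFun (fun c ω t => C c t ω) P
  selection_measurable : ∀ ℓ, Measurable (M ℓ)
  selection_law : ∀ ℓ, HasLaw (M ℓ)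
    (uniformOn (↑(Finset.powersetCard (n - S.card) Sᶜ) : Set (Finset (Fin m)))) P
  selection_indep : iIndepFun M P
  selection_indep_counters : IndepFun (fun ω ℓ => M ℓ ω) (fun ω c t => C c t ω) P

/-- The counter with path `f` is activated at time `u`, that is, it jumps at time `u`. -/
def IsActivation (f : ℝ≥0 → ℕ) (u : ℝ≥0) : Prop := 0 < u ∧ ∀ v < u, f v < f u

/-- The keys of version `ℓ` that node `j` has obtained up to time `t` under the memoryless scheme, for
the counter paths `c`, where `K ℓ` is the set of nodes that receive a key of version `ℓ` from the
source. These receive pairwise distinct keys, and the key sent to node `i` is denoted by `i`.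
Node `j` obtains its own key, if any, when version `ℓ` is generated. At each activation time `u` of an
edge `i → j`, node `i` sends only the key that it got from the source for the version `c .source u`
prevailing at the source, and nothing if it was sent no key for that version. -/
def keysObtained {m : ℕ} (c : Counter m → ℝ≥0 → ℕ) (K : ℕ → Finset (Fin m)) (j : Fin m)
    (ℓ : ℕ) (t : ℝ≥0) : Set (Fin m) :=
  {i | i ∈ K ℓ ∧ ((i = j ∧ ℓ ≤ c .source t) ∨
    ∃ h : i ≠ j, ∃ u ≤ t, IsActivation (c (.edge i j h)) u ∧ c .source u = ℓ)}

/-- The latest version that node `j` can decrypt at time `t` under the memoryless scheme, where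
`k + 1` distinct keys of a version are needed to decrypt it; version `0` is the initial information
and known to all nodes. -/
noncomputable def latestDecrypted {m : ℕ} (k : ℕ) (c : Counter m → ℝ≥0 → ℕ)
    (K : ℕ → Finset (Fin m)) (j : Fin m) (t : ℝ≥0) : ℕ :=
  sSup {ℓ | ℓ ≤ c .source t ∧ (ℓ = 0 ∨ k + 1 ≤ (keysObtained c K j ℓ t).ncard)}

/-- The `k`-keys version age of node `j` at time `t` under the memoryless scheme. -/
noncomputable def versionAge {m : ℕ} (k : ℕ) (c : Counter m → ℝ≥0 → ℕ)
    (K : ℕ → Finset (Fin m)) (j : Fin m) (t : ℝ≥0) : ℝ :=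
  (c .source t : ℝ) - (latestDecrypted k c K j t : ℝ)

/-- The path `f` has time average `a`: it is integrable on bounded time intervals and
`(1 / T) ∫₀ᵀ f(t) dt → a` as `T → ∞`. -/
def HasTimeAverage (f : ℝ≥0 → ℝ) (a : ℝ) : Prop :=
  (∀ T : ℝ, IntervalIntegrable (fun t : ℝ => f t.toNNReal) volume 0 T) ∧
    Tendsto (fun T : ℝ => (1 / T) * ∫ t in (0 : ℝ)..T, f t.toNNReal) atTop (𝓝 a)

/-- The `k`-th order statistic (`k`-th smallest value, `1 ≤ k ≤ N`) of `x₁, …, x_N`: the least `t` such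
that at least `k` of the values are at most `t`. -/
noncomputable def orderStat {N : ℕ} (k : ℕ) (x : Fin N → ℝ) : ℝ :=
  sInf {t : ℝ | k ≤ {i | x i ≤ t}.ncard}

/-- The joint law of `((X₁, …, X_N), U)`, all independent, where the `Xᵢ` are exponential with rate `r`
and `U` is exponential with rate `lamS`. -/
noncomputable def expLaw (N : ℕ) (r lamS : ℝ≥0) : Measure ((Fin N → ℝ) × ℝ) :=
  (Measure.pi fun _ : Fin N => expMeasure (r : ℝ)).prod (expMeasure (lamS : ℝ))

/-- `𝔼[min(X_(k:N), U)]`. -/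
noncomputable def expectedMin (k N : ℕ) (r lamS : ℝ≥0) : ℝ :=
  ∫ p, min (orderStat k p.1) p.2 ∂expLaw N r lamS

/-- `Pr(X_(k:N) ≤ U)`. -/
noncomputable def probDecrypt (k N : ℕ) (r lamS : ℝ≥0) : ℝ :=
  (expLaw N r lamS).real {p | orderStat k p.1 ≤ p.2}

/-- `𝔼[U]`, the mean time between two consecutive source updates. -/
noncomputable def meanCycle (lamS : ℝ≥0) : ℝ := ∫ u, u ∂expMeasure (lamS : ℝ)

/-! Fix a receiver j and cut time into the cycles between consecutive source updates, cycle l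
starting at τ_l. Keys are never forwarded and only the prevailing version is sent, so j obtains a
foreign key of version l exactly when a direct edge from a holder is activated during cycle l. Hence
j decrypts version l if and only if the r-th smallest waiting time of the edges from K^l \ {j},
measured from τ_l, is less than the length U_l of the cycle; here r = k if j holds a key of its own
and r = k + 1 otherwise (`le_ncard_keysObtained_iff`). In cycle l the age is therefore a constant
Y_l until this delay and 0 afterwards, where Y_l counts the cycles since the last success
(`versionAge_eq`), and the area under the age is Y_l W_l with W_l = min(delay, U_l).

By the strong Markov property at τ_l (`measure_inter_waitingTimes`), the waiting times of cycle l
are independent exponential variables, independent of the past. Together with the selection of that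
cycle they have a law that does not depend on l and are independent of everything before
(`map_cycleData`, `indep_cycleData_past`). Since Y_l is known at τ_l and bounded in L², a martingale
strong law (`ae_tendsto_average_mul_zero`) permits replacing W_l and the success indicator, inside
sums weighted by Y_l, by their means w and p. The recursion Y_{l+1} = 1 + Y_l (1 - 1_{D_l})
telescopes and gives Y the average 1/p, so Y_l W_l has the average w/p
(`ae_tendsto_average_runLength_mul`). The cycle lengths average to E[U], and monotone interpolation
between cycle starts yields the time average w / (p E[U]) (`tendsto_div_of_tendsto_div_cycles`).

Finally w and p are means over the selection (`integral_selection`): with an own key, n - 1 edges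
supply the k missing keys; without one, n edges supply k + 1. A nonsubscriber has its own key with
probability (n - s)/(m - s), a subscriber always. -/

/-- **Kronecker's lemma** for the weights `1 / (l + 1)`. -/
theorem tendsto_average_zero_of_tendsto_sum_div {x : ℕ → ℝ} {c : ℝ}
    (h : Tendsto (fun L : ℕ => ∑ l ∈ Finset.range L, x l / ((l : ℝ) + 1)) atTop (𝓝 c)) :
    Tendsto (fun L : ℕ => (L : ℝ)⁻¹ * ∑ l ∈ Finset.range L, x l) atTop (𝓝 0) := by
  set b : ℕ → ℝ := fun L => ∑ l ∈ Finset.range L, x l / ((l : ℝ) + 1) with hb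
  -- Abel summation: the average of `x` is `b L` minus the Cesàro mean of `b`, and both tend to `c`.
  have key : ∀ L : ℕ, ∑ l ∈ Finset.range L, x l = L * b L - ∑ l ∈ Finset.range L, b l := by
    intro L
    induction L with
    | zero => simp
    | succ L ih =>
      have hL : ((L : ℝ) + 1) ≠ 0 := by positivity
      have hbs : b (L + 1) = b L + x L / ((L : ℝ) + 1) := by simp [hb, Finset.sum_range_succ]
      rw [Finset.sum_range_succ, Finset.sum_range_succ, ih, hbs]
      push_cast
      field_simp
      ring
  have h2 := h.sub h.cesaro
  rw [sub_self] at h2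
  refine h2.congr' ?_
  filter_upwards [eventually_gt_atTop 0] with L hL
  have hL' : (L : ℝ) ≠ 0 := by positivity
  rw [key]
  field_simp

/-! ### Strong laws for martingale differences with predictable weights. -/

section Martingale

variable {Ω : Type*} {m0 : MeasurableSpace Ω} {P : Measure Ω}

theorem indepFun_of_measurable_of_indep {m : MeasurableSpace Ω} {f Z : Ω → ℝ}
    (hf : Measurable[m] f) (h : Indep (MeasurableSpace.comap Z inferInstance) m P) :
    IndepFun f Z P :=
  (indep_of_indep_of_le_right h hf.comap_le).symm

variable [IsProbabilityMeasure P]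

/-- **Strong law of large numbers** for a sum of independent centred square integrable variables
with predictable square integrable weights. -/
theorem ae_tendsto_average_mul_zero (𝓖 : Filtration ℕ m0) {H Z : ℕ → Ω → ℝ} {a b : ℝ}
    (hH : ∀ l, Measurable[𝓖 l] (H l)) (hZ : ∀ l, Measurable[𝓖 (l + 1)] (Z l))
    (hind : ∀ l, Indep (MeasurableSpace.comap (Z l) inferInstance) (𝓖 l) P)
    (hH2 : ∀ l, MemLp (H l) 2 P) (hZ2 : ∀ l, MemLp (Z l) 2 P)
    (hZ0 : ∀ l, ∫ ω, Z l ω ∂P = 0) (ha : ∀ l, ∫ ω, H l ω ^ 2 ∂P ≤ a)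
    (hb : ∀ l, ∫ ω, Z l ω ^ 2 ∂P ≤ b) :
    ∀ᵐ ω ∂P, Tendsto (fun L : ℕ => (L : ℝ)⁻¹ * ∑ l ∈ Finset.range L, H l ω * Z l ω) atTop (𝓝 0) := by
  have hZm : ∀ l, Measurable (Z l) := fun l => (hZ l).mono (𝓖.le _) le_rfl
  have hHm : ∀ l, Measurable (H l) := fun l => (hH l).mono (𝓖.le _) le_rfl
  -- The factor 1/(l + 1) makes the variances summable, so that the partial sums form an L²-bounded
  -- martingale; Kronecker's lemma removes it at the end.
  set X : ℕ → Ω → ℝ := fun l ω => H l ω * Z l ω / ((l : ℝ) + 1) with hX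
  set M : ℕ → Ω → ℝ := fun L ω => ∑ l ∈ Finset.range L, X l ω with hM
  have hXm : ∀ l, Measurable[𝓖 (l + 1)] (X l) := fun l =>
    (((hH l).mono (𝓖.mono (Nat.le_succ l)) le_rfl).mul (hZ l)).div_const _
  have hMm : ∀ L, Measurable[𝓖 L] (M L) := fun L =>
    Finset.measurable_fun_sum _ fun l hl =>
      (hXm l).mono (𝓖.mono (Finset.mem_range.1 hl)) le_rfl
  have hHZ : ∀ l, IndepFun (H l) (Z l) P := fun l => indepFun_of_measurable_of_indep (hH l) (hind l)
  have hXsq : ∀ l, (fun ω => X l ω ^ 2) =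
      fun ω => (H l ω ^ 2 * Z l ω ^ 2) * (1 / ((l : ℝ) + 1) ^ 2) := by
    intro l; funext ω; simp only [hX]; field_simp
  have hHZsq : ∀ l, IndepFun (fun ω => H l ω ^ 2) (fun ω => Z l ω ^ 2) P := fun l =>
    (hHZ l).comp (φ := fun x : ℝ => x ^ 2) (ψ := fun x : ℝ => x ^ 2) (by fun_prop) (by fun_prop)
  have hX2 : ∀ l, MemLp (X l) 2 P := by
    intro l
    rw [memLp_two_iff_integrable_sq ((hXm l).mono (𝓖.le _) le_rfl).aestronglyMeasurable, hXsq]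
    exact ((hHZsq l).integrable_mul (hH2 l).integrable_sq (hZ2 l).integrable_sq).mul_const _
  have ha0 : 0 ≤ a := (integral_nonneg fun ω => sq_nonneg (H 0 ω)).trans (ha 0)
  have hXb : ∀ l : ℕ, ∫ ω, X l ω ^ 2 ∂P ≤ a * b * (1 / ((l : ℝ) + 1) ^ 2) := by
    intro l
    rw [hXsq, integral_mul_const]
    refine mul_le_mul_of_nonneg_right ?_ (by positivity)
    rw [(hHZsq l).integral_fun_mul_eq_mul_integral (hH2 l).integrable_sq.aestronglyMeasurable
      (hZ2 l).integrable_sq.aestronglyMeasurable]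
    exact mul_le_mul (ha l) (hb l) (integral_nonneg fun ω => sq_nonneg _) ha0
  have hM2 : ∀ L, MemLp (M L) 2 P := fun L => memLp_finsetSum _ fun l _ => hX2 l
  -- Used twice: with an indicator for the martingale property, and with `M l` for the orthogonality
  -- that makes the variances add up. No integrability of `f` is needed, since the product formula
  -- for independent functions holds without it.
  have horth : ∀ l (f : Ω → ℝ), Measurable[𝓖 l] f → ∫ ω, f ω * X l ω ∂P = 0 := by
    intro l f hf
    have h1 : (fun ω => f ω * X l ω) = fun ω => (f ω * H l ω / ((l : ℝ) + 1)) * Z l ω := by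
      funext ω; simp only [hX]; ring
    have hm : Measurable[𝓖 l] fun ω => f ω * H l ω / ((l : ℝ) + 1) := (hf.mul (hH l)).div_const _
    rw [h1, (indepFun_of_measurable_of_indep hm (hind l)).integral_fun_mul_eq_mul_integral
      (hm.mono (𝓖.le _) le_rfl).aestronglyMeasurable (hZm l).aestronglyMeasurable, hZ0, mul_zero]
  have hmart : Martingale M 𝓖 P := by
    refine martingale_of_setIntegral_eq_succ (fun L => (hMm L).stronglyMeasurable)
      (fun L => (hM2 L).integrable one_le_two) fun L s hs => ?_
    have hs' := 𝓖.le _ _ hs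
    have h1 : M (L + 1) = fun ω => M L ω + X L ω := by
      funext ω; simp [hM, Finset.sum_range_succ]
    rw [h1, integral_add ((hM2 L).integrable one_le_two).integrableOn
      ((hX2 L).integrable one_le_two).integrableOn]
    have h2 : ∫ ω in s, X L ω ∂P = 0 := by
      rw [← integral_indicator hs', ← horth L (s.indicator fun _ => 1)
        (measurable_const.indicator hs)]
      congr 1
      funext ω
      by_cases h : ω ∈ s <;> simp [h]
    rw [h2, add_zero]
  have hMb : ∀ L, ∫ ω, M L ω ^ 2 ∂P ≤ ∑ l ∈ Finset.range L, a * b * (1 / ((l : ℝ) + 1) ^ 2) := by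
    intro L
    induction L with
    | zero => simp [hM]
    | succ L ih =>
      have h1 : (fun ω => M (L + 1) ω ^ 2) =
          fun ω => M L ω ^ 2 + 2 * (M L ω * X L ω) + X L ω ^ 2 := by
        funext ω; simp only [hM, Finset.sum_range_succ]; ring
      have hMX : Integrable (fun ω => M L ω * X L ω) P := (hM2 L).integrable_mul (hX2 L)
      have hadd : Integrable (fun ω => M L ω ^ 2 + 2 * (M L ω * X L ω)) P :=
        (hM2 L).integrable_sq.add (hMX.const_mul 2)
      rw [h1, integral_add hadd (hX2 L).integrable_sq,
        integral_add (hM2 L).integrable_sq (hMX.const_mul 2), integral_const_mul,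
        horth L _ (hMm L), Finset.sum_range_succ]
      linarith [hXb L]
  have hsum : Summable fun l : ℕ => a * b * (1 / ((l : ℝ) + 1) ^ 2) := by
    refine Summable.mul_left _ ?_
    have := (summable_nat_add_iff 1).2 (Real.summable_one_div_nat_pow.2 one_lt_two)
    simpa using this
  -- The convergence theorem asks for a bound in L¹, which follows from |x| ≤ 1 + x².
  obtain ⟨R, hR⟩ : ∃ R : ℝ≥0, ∀ L, eLpNorm (M L) 1 P ≤ R := by
    set T := ∑' l : ℕ, a * b * (1 / ((l : ℝ) + 1) ^ 2)
    refine ⟨(1 + T).toNNReal, fun L => ?_⟩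
    rw [eLpNorm_one_eq_lintegral_enorm, ← ofReal_integral_norm_eq_lintegral_enorm
      ((hM2 L).integrable one_le_two)]
    refine ENNReal.ofReal_le_ofReal ?_
    have hb0 : 0 ≤ b := (integral_nonneg fun ω => sq_nonneg (Z 0 ω)).trans (hb 0)
    calc ∫ ω, ‖M L ω‖ ∂P ≤ ∫ ω, 1 + M L ω ^ 2 ∂P := by
          refine integral_mono ((hM2 L).integrable one_le_two).norm
            ((integrable_const _).add (hM2 L).integrable_sq) fun ω => ?_
          simp only [Real.norm_eq_abs]
          nlinarith [sq_nonneg (|M L ω| - 1), sq_abs (M L ω), abs_nonneg (M L ω)]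
      _ ≤ 1 + T := by
          rw [integral_add (integrable_const _) (hM2 L).integrable_sq]
          simp only [integral_const, probReal_univ, smul_eq_mul, mul_one]
          gcongr
          exact (hMb L).trans (hsum.sum_le_tsum _ fun l _ => by positivity)
  filter_upwards [hmart.submartingale.exists_ae_tendsto_of_bdd hR] with ω hω
  obtain ⟨c, hc⟩ := hω
  exact tendsto_average_zero_of_tendsto_sum_div hc

/-- Strong law of large numbers for square integrable variables that are independent of the past. -/
theorem ae_tendsto_average_of_indep_past (𝓖 : Filtration ℕ m0) {Z : ℕ → Ω → ℝ} {z b : ℝ}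
    (hZ : ∀ l, Measurable[𝓖 (l + 1)] (Z l))
    (hind : ∀ l, Indep (MeasurableSpace.comap (Z l) inferInstance) (𝓖 l) P)
    (hZ2 : ∀ l, MemLp (Z l) 2 P) (hz : ∀ l, ∫ ω, Z l ω ∂P = z) (hb : ∀ l, ∫ ω, Z l ω ^ 2 ∂P ≤ b)
    {H : ℕ → Ω → ℝ} {a : ℝ} (hH : ∀ l, Measurable[𝓖 l] (H l)) (hH2 : ∀ l, MemLp (H l) 2 P)
    (ha : ∀ l, ∫ ω, H l ω ^ 2 ∂P ≤ a) :
    ∀ᵐ ω ∂P, Tendsto (fun L : ℕ => (L : ℝ)⁻¹ * ∑ l ∈ Finset.range L, H l ω * (Z l ω - z))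
      atTop (𝓝 0) := by
  refine ae_tendsto_average_mul_zero 𝓖 (Z := fun l ω => Z l ω - z) (b := b) hH
    (fun l => (hZ l).sub_const z) (fun l => ?_) hH2 (fun l => (hZ2 l).sub (memLp_const z)) ?_ ha ?_
  · refine indep_of_indep_of_le_left (hind l) ?_
    rw [← measurable_iff_comap_le]
    exact (measurable_id.sub_const z).comp (comap_measurable (Z l))
  · intro l
    rw [integral_sub ((hZ2 l).integrable one_le_two) (integrable_const _), hz]
    simp
  · intro l
    have h1 : (fun ω => (Z l ω - z) ^ 2) = fun ω => Z l ω ^ 2 - (2 * z * Z l ω - z ^ 2) := by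
      funext ω; ring
    have hsub : Integrable (fun ω => 2 * z * Z l ω - z ^ 2) P :=
      (((hZ2 l).integrable one_le_two).const_mul _).sub (integrable_const _)
    rw [h1, integral_sub (hZ2 l).integrable_sq hsub,
      integral_sub (((hZ2 l).integrable one_le_two).const_mul _) (integrable_const _),
      integral_const_mul, hz]
    simp only [integral_const, probReal_univ, smul_eq_mul, one_mul]
    nlinarith [hb l, sq_nonneg z]

end Martingale

/-- If `E[Y_L²]` is bounded, then `Y_L / L → 0` almost surely. -/
theorem ae_tendsto_div_zero_of_integral_sq_le {Ω : Type*} {m0 : MeasurableSpace Ω} {P : Measure Ω}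
    {Y : ℕ → Ω → ℝ} {a : ℝ} (hY2 : ∀ l, MemLp (Y l) 2 P) (ha : ∀ l, ∫ ω, Y l ω ^ 2 ∂P ≤ a) :
    ∀ᵐ ω ∂P, Tendsto (fun L : ℕ => (L : ℝ)⁻¹ * Y L ω) atTop (𝓝 0) := by
  have hint : ∀ l : ℕ, Integrable (fun ω => ((l : ℝ)⁻¹ * Y l ω) ^ 2) P := by
    intro l
    simpa only [mul_pow] using (hY2 l).integrable_sq.const_mul _
  -- The sum of Y_l² / l² has finite expectation, hence is finite almost surely and its terms tend
  -- to 0. The term l = 0 vanishes because the inverse of 0 is 0.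
  have h1 : ∫⁻ ω, ∑' l : ℕ, ENNReal.ofReal (((l : ℝ)⁻¹ * Y l ω) ^ 2) ∂P ≠ ⊤ := by
    rw [lintegral_tsum fun l => (hint l).aestronglyMeasurable.aemeasurable.ennreal_ofReal]
    have hs : Summable fun l : ℕ => a * (1 / (l : ℝ) ^ 2) :=
      (Real.summable_one_div_nat_pow.2 one_lt_two).mul_left a
    refine ne_top_of_le_ne_top hs.tsum_ofReal_ne_top (ENNReal.tsum_le_tsum fun l => ?_)
    rw [← ofReal_integral_eq_lintegral_ofReal (hint l) (Eventually.of_forall fun ω => sq_nonneg _)]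
    refine ENNReal.ofReal_le_ofReal ?_
    simp only [mul_pow]
    rw [integral_const_mul, mul_comm, one_div, inv_pow]
    exact mul_le_mul_of_nonneg_right (ha l) (by positivity)
  have h2 := ae_lt_top' (AEMeasurable.tsum fun l =>
    (hint l).aestronglyMeasurable.aemeasurable.ennreal_ofReal) h1
  filter_upwards [h2] with ω hω
  have h3 := ENNReal.tendsto_atTop_zero_of_tsum_ne_top hω.ne
  have h4 : Tendsto (fun l : ℕ => ((l : ℝ)⁻¹ * Y l ω) ^ 2) atTop (𝓝 0) := by
    have := (ENNReal.tendsto_toReal ENNReal.zero_ne_top).comp h3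
    refine this.congr fun l => ?_
    simp only [Function.comp_apply]
    rw [ENNReal.toReal_ofReal (sq_nonneg _)]
  exact squeeze_zero_norm (a := fun l : ℕ => Real.sqrt (((l : ℝ)⁻¹ * Y l ω) ^ 2))
    (fun l => by rw [Real.sqrt_sq_eq_abs, Real.norm_eq_abs]) (by simpa using h4.sqrt)

/-! ### Trials since the last success, and the renewal reward theorem. -/

/-- The number of trials since the last success, for the success events `D`: it starts at `0`, and
becomes `1` after a success and increases by `1` after a failure. -/
noncomputable def runLength {Ω : Type*} (D : ℕ → Set Ω) : ℕ → Ω → ℝ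
  | 0, _ => 0
  | l + 1, ω => 1 + runLength D l ω * (1 - (D l).indicator 1 ω)

section RunLength

variable {Ω : Type*} {D : ℕ → Set Ω}

theorem runLength_nonneg (l : ℕ) (ω : Ω) : 0 ≤ runLength D l ω := by
  induction l with
  | zero => exact le_rfl
  | succ l ih =>
    by_cases h : ω ∈ D l <;> (simp [runLength, h]; try linarith)

theorem runLength_le (l : ℕ) (ω : Ω) : runLength D l ω ≤ l := by
  induction l with
  | zero => simp [runLength]
  | succ l ih =>
    by_cases h : ω ∈ D l <;> (simp [runLength, h]; try linarith)

variable {m0 : MeasurableSpace Ω} {P : Measure Ω}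

theorem measurable_indicator_one_of_measurableSet {m : MeasurableSpace Ω} {s : Set Ω}
    (hs : MeasurableSet[m] s) : Measurable[m] (s.indicator (1 : Ω → ℝ)) :=
  measurable_one.indicator hs

theorem measurable_runLength (𝓖 : Filtration ℕ m0) (hD : ∀ l, MeasurableSet[𝓖 (l + 1)] (D l))
    (l : ℕ) : Measurable[𝓖 l] (runLength D l) := by
  induction l with
  | zero => exact measurable_const
  | succ l ih =>
    exact ((ih.mono (𝓖.mono (Nat.le_succ l)) le_rfl).mul
      ((measurable_const (a := (1 : ℝ))).sub (measurable_indicator_one_of_measurableSet (hD l)))).const_add 1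

variable [IsProbabilityMeasure P]

theorem memLp_runLength (𝓖 : Filtration ℕ m0) (hD : ∀ l, MeasurableSet[𝓖 (l + 1)] (D l)) (l : ℕ) :
    MemLp (runLength D l) 2 P :=
  MemLp.of_bound ((measurable_runLength 𝓖 hD l).mono (𝓖.le _) le_rfl).aestronglyMeasurable l
    (Eventually.of_forall fun ω => by
      rw [Real.norm_eq_abs, abs_of_nonneg (runLength_nonneg l ω)]; exact runLength_le l ω)

/-- The failure indicator of trial l is independent of Y_l, so the moments obey E[Y_{l+1}] = 1 + (1
- p) E[Y_l] and E[Y_{l+1}²] = 1 + (1 - p)(2 E[Y_l] + E[Y_l²]). The bound 1/p is the fixed point of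
the first recursion. Inserting 1/p and 2/p² into the second gives 2/p² - 1, so 2/p² is preserved. -/
theorem integral_runLength_sq_le (𝓖 : Filtration ℕ m0) (hD : ∀ l, MeasurableSet[𝓖 (l + 1)] (D l))
    (hind : ∀ l, Indep (MeasurableSpace.comap ((D l).indicator (1 : Ω → ℝ)) inferInstance) (𝓖 l) P)
    {p : ℝ} (hp : 0 < p) (hDp : ∀ l, P.real (D l) = p) (l : ℕ) :
    ∫ ω, runLength D l ω ^ 2 ∂P ≤ 2 / p ^ 2 := by
  have hp1 : p ≤ 1 := hDp 0 ▸ measureReal_le_one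
  have hL2 := memLp_runLength (P := P) 𝓖 hD
  have hDm : ∀ l, MeasurableSet (D l) := fun l => 𝓖.le _ _ (hD l)
  have hJ : ∀ l, Integrable (fun ω => 1 - (D l).indicator (1 : Ω → ℝ) ω) P := fun l =>
    (integrable_const 1).sub ((integrable_const (1 : ℝ)).indicator (hDm l))
  have hJi : ∀ l, ∫ ω, 1 - (D l).indicator (1 : Ω → ℝ) ω ∂P = 1 - p := by
    intro l
    have h1 : Integrable ((D l).indicator (1 : Ω → ℝ)) P :=
      (integrable_const (1 : ℝ)).indicator (hDm l)
    rw [integral_sub (integrable_const _) h1,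
      integral_indicator_one (hDm l), hDp]
    simp
  have hmul : ∀ l (f : Ω → ℝ), Measurable[𝓖 l] f → Integrable f P →
      Integrable (fun ω => f ω * (1 - (D l).indicator (1 : Ω → ℝ) ω)) P ∧
      ∫ ω, f ω * (1 - (D l).indicator (1 : Ω → ℝ) ω) ∂P = (∫ ω, f ω ∂P) * (1 - p) := by
    intro l f hf hfi
    have h := (indepFun_of_measurable_of_indep hf (hind l)).comp (φ := id)
      (ψ := fun x : ℝ => 1 - x) measurable_id (by fun_prop)
    refine ⟨h.integrable_mul hfi (hJ l), ?_⟩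
    rw [← hJi l]
    exact h.integral_fun_mul_eq_mul_integral hfi.aestronglyMeasurable (hJ l).aestronglyMeasurable
  have hmY := measurable_runLength 𝓖 hD
  have hmean : ∀ l, ∫ ω, runLength D l ω ∂P ≤ 1 / p := by
    intro l
    induction l with
    | zero => simp [runLength, hp.le]
    | succ l ih =>
      obtain ⟨h1, h2⟩ := hmul l _ (hmY l) ((hL2 l).integrable one_le_two)
      simp only [runLength]
      rw [integral_add (integrable_const _) h1, h2]
      simp only [integral_const, probReal_univ, smul_eq_mul, mul_one]
      calc _ ≤ 1 + 1 / p * (1 - p) := by gcongr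
        _ = 1 / p := by field_simp; ring
  induction l with
  | zero => simp [runLength]; positivity
  | succ l ih =>
    obtain ⟨h1, h2⟩ := hmul l _ (hmY l) ((hL2 l).integrable one_le_two)
    obtain ⟨h3, h4⟩ := hmul l _ ((hmY l).pow_const 2) (hL2 l).integrable_sq
    have hsq : (fun ω => runLength D (l + 1) ω ^ 2) = fun ω =>
        1 + (2 * (runLength D l ω * (1 - (D l).indicator (1 : Ω → ℝ) ω)) +
          runLength D l ω ^ 2 * (1 - (D l).indicator (1 : Ω → ℝ) ω)) := by
      funext ω
      by_cases h : ω ∈ D l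
      · simp [runLength, h]
      · simp [runLength, h]; ring
    have h5 : Integrable (fun ω => 2 * (runLength D l ω * (1 - (D l).indicator (1 : Ω → ℝ) ω)) +
        runLength D l ω ^ 2 * (1 - (D l).indicator (1 : Ω → ℝ) ω)) P := (h1.const_mul 2).add h3
    rw [hsq, integral_add (integrable_const _) h5, integral_add (h1.const_mul 2) h3,
      integral_const_mul, h2, h4]
    simp only [integral_const, probReal_univ, smul_eq_mul, mul_one]
    have hm := hmean l
    calc _ ≤ 1 + (2 * (1 / p * (1 - p)) + 2 / p ^ 2 * (1 - p)) := by
          gcongr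
      _ = 2 / p ^ 2 - 1 := by field_simp; ring
      _ ≤ 2 / p ^ 2 := by linarith

/-- **Renewal reward theorem**: if each trial is a success with probability `p` and has the mean
reward `w`, independently of the past, then the rewards weighted with the number of trials since the
last success have the average `w / p`. -/
theorem ae_tendsto_average_runLength_mul (𝓖 : Filtration ℕ m0)
    (hD : ∀ l, MeasurableSet[𝓖 (l + 1)] (D l))
    (hind : ∀ l, Indep (MeasurableSpace.comap ((D l).indicator (1 : Ω → ℝ)) inferInstance) (𝓖 l) P)
    {p : ℝ} (hp : 0 < p) (hDp : ∀ l, P.real (D l) = p) {W : ℕ → Ω → ℝ} {w b : ℝ}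
    (hW : ∀ l, Measurable[𝓖 (l + 1)] (W l))
    (hWind : ∀ l, Indep (MeasurableSpace.comap (W l) inferInstance) (𝓖 l) P)
    (hW2 : ∀ l, MemLp (W l) 2 P) (hw : ∀ l, ∫ ω, W l ω ∂P = w) (hb : ∀ l, ∫ ω, W l ω ^ 2 ∂P ≤ b) :
    ∀ᵐ ω ∂P, Tendsto (fun L : ℕ => (L : ℝ)⁻¹ * ∑ l ∈ Finset.range L, runLength D l ω * W l ω)
      atTop (𝓝 (w / p)) := by
  have hY := measurable_runLength 𝓖 hD
  have hY2 := memLp_runLength (P := P) 𝓖 hD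
  have hYb := integral_runLength_sq_le 𝓖 hD hind hp hDp
  have hDm : ∀ l, MeasurableSet (D l) := fun l => 𝓖.le _ _ (hD l)
  have e1 := ae_tendsto_average_of_indep_past 𝓖 hW hWind hW2 hw hb hY hY2 hYb
  have e2 := ae_tendsto_average_of_indep_past 𝓖 (Z := fun l => (D l).indicator (1 : Ω → ℝ))
    (z := p) (b := p) (fun l => measurable_indicator_one_of_measurableSet (hD l)) hind
    (fun l => (memLp_const (1 : ℝ)).indicator (hDm l))
    (fun l => by rw [integral_indicator_one (hDm l), hDp])
    (fun l => by
      have : (fun ω => (D l).indicator (1 : Ω → ℝ) ω ^ 2) = (D l).indicator (1 : Ω → ℝ) := by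
        funext ω; by_cases h : ω ∈ D l <;> simp [h]
      rw [this, integral_indicator_one (hDm l), hDp])
    hY hY2 hYb
  filter_upwards [e1, e2, ae_tendsto_div_zero_of_integral_sq_le hY2 hYb] with ω h1 h2 h3
  -- Telescoping of Y_{l+1} - Y_l = 1 - Y_l 1_{D_l}. After division by L, the boundary term and the
  -- centred sum both vanish in the limit, leaving 1/p as the average of Y.
  have key : ∀ L : ℕ, p * ∑ l ∈ Finset.range L, runLength D l ω = L - runLength D L ω -
      ∑ l ∈ Finset.range L, runLength D l ω * ((D l).indicator (1 : Ω → ℝ) ω - p) := by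
    intro L
    induction L with
    | zero => simp [runLength]
    | succ L ih =>
      rw [Finset.sum_range_succ, Finset.sum_range_succ, mul_add, ih]
      simp only [runLength]
      push_cast
      ring
  have h4 : Tendsto (fun L : ℕ => (L : ℝ)⁻¹ * ∑ l ∈ Finset.range L, runLength D l ω) atTop
      (𝓝 (1 / p)) := by
    have h5 : Tendsto (fun L : ℕ => (1 - (L : ℝ)⁻¹ * runLength D L ω - (L : ℝ)⁻¹ *
        ∑ l ∈ Finset.range L, runLength D l ω * ((D l).indicator (1 : Ω → ℝ) ω - p)) / p)
        atTop (𝓝 (1 / p)) := by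
      simpa using ((h3.const_sub 1).sub h2).div_const p
    refine h5.congr' ?_
    filter_upwards [eventually_gt_atTop 0] with L hL
    have hL' : (L : ℝ) ≠ 0 := by positivity
    have := key L
    field_simp
    linarith
  have h6 := h1.add (h4.const_mul w)
  rw [zero_add, mul_one_div] at h6
  refine h6.congr fun L => ?_
  simp only [mul_sub, Finset.sum_sub_distrib, ← Finset.sum_mul]
  ring

end RunLength

/-! ### Path properties of Poisson counters. -/

section Poisson

variable {Ω : Type*} {m0 : MeasurableSpace Ω} {P : Measure Ω} {N : ℝ≥0 → Ω → ℕ} {r : ℝ≥0}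

/-- The increments of a Poisson counter after time `d` are independent of its path up to `d`. -/
theorem IsPoissonCounter.indepFun_past (hN : IsPoissonCounter P N r) (d x : ℝ≥0) :
    IndepFun (fun ω (s : Iic d) => N s ω) (fun ω => N (d + x) ω - N d ω) P := by
  have hP : IsProbabilityMeasure P :=
    (hN.indepIncrements 0 (fun _ => 0) fun _ _ _ => le_rfl).isProbabilityMeasure
  refine IndepFun.process_indepFun (fun s => hN.measurable s)
    ((hN.measurable _).sub (hN.measurable _)) fun I => ?_
  classical
  -- Adding 0 lets each value be recovered as a sum of increments from `N 0 = 0`; adding `d` makes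
  -- the increment from `d` to `d + x` the next one in the list.
  set J : Finset ℝ≥0 := insert 0 (insert d (I.image Subtype.val)) with hJ
  have hJd : ∀ s ∈ J, s ≤ d := by
    intro s hs
    simp only [hJ, Finset.mem_insert, Finset.mem_image] at hs
    rcases hs with rfl | rfl | ⟨s, -, rfl⟩
    exacts [zero_le, le_rfl, s.2]
  have hJ0 : 0 < J.card := Finset.card_pos.2 ⟨0, by simp [hJ]⟩
  set e := J.orderEmbOfFin rfl with he
  -- The points of `J` in increasing order, then `d + x` forever.
  set t : ℕ → ℝ≥0 := fun i => if h : i < J.card then e ⟨i, h⟩ else d + x with ht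
  have htm : Monotone t := by
    intro a b hab
    simp only [ht]
    split_ifs with ha hb hb
    · exact e.monotone (by simpa using hab)
    · exact (hJd _ (J.orderEmbOfFin_mem rfl _)).trans le_self_add
    · omega
    · exact le_rfl
  have ht0 : t 0 = 0 := by
    simp only [ht, hJ0, dite_true]
    obtain ⟨i, hi⟩ : (0 : ℝ≥0) ∈ Set.range e := by
      rw [he, Finset.range_orderEmbOfFin]; simp [hJ]
    exact le_antisymm (hi ▸ e.monotone (Fin.mk_le_of_le_val (Nat.zero_le _))) zero_le
  have htd : t (J.card - 1) = d := by
    have h1 : J.card - 1 < J.card := by omega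
    simp only [ht, h1, dite_true]
    obtain ⟨i, hi⟩ : d ∈ Set.range e := by
      rw [he, Finset.range_orderEmbOfFin]; simp [hJ]
    refine le_antisymm (hJd _ (J.orderEmbOfFin_mem rfl _)) (hi ▸ e.monotone ?_)
    rw [Fin.le_def]
    have := i.2
    simp only
    omega
  have htc : t (J.card - 1 + 1) = d + x := by
    simp only [ht]
    rw [dif_neg (by omega)]
  set Z : ℕ → Ω → ℕ := fun i ω => N (t (i + 1)) ω - N (t i) ω with hZ
  have hZi : iIndepFun Z P := hN.indepIncrements.nat htm
  have hZm : ∀ i, Measurable (Z i) := fun i => (hN.measurable _).sub (hN.measurable _)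
  have htel : ∀ i ω, N (t i) ω = ∑ a ∈ Finset.range i, Z a ω := by
    intro i ω
    induction i with
    | zero => simp [ht0, hN.zero]
    | succ i ih =>
      rw [Finset.sum_range_succ, ← ih]
      exact (Nat.add_sub_cancel' (hN.mono ω (htm (Nat.le_succ i)))).symm
  have hind := hZi.indepFun_finset (Finset.range (J.card - 1)) {J.card - 1}
    (by simp) hZm
  have hidx : ∀ s : I, ∃ i ≤ J.card - 1, t i = s := by
    intro s
    obtain ⟨i, hi⟩ : (s : ℝ≥0) ∈ Set.range e := by
      rw [he, Finset.range_orderEmbOfFin]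
      simp only [hJ, Finset.coe_insert, Finset.coe_image, Set.mem_insert_iff, Set.mem_image]
      exact Or.inr (Or.inr ⟨s, s.2, rfl⟩)
    refine ⟨i, by omega, ?_⟩
    simp only [ht, i.2, dite_true, Fin.eta, hi]
  choose idx hidx1 hidx2 using hidx
  have hφ : Measurable fun (z : (Finset.range (J.card - 1)) → ℕ) (s : I) =>
      ∑ a : Finset.range (J.card - 1), if (a : ℕ) < idx s then z a else 0 := by
    refine measurable_pi_lambda _ fun s => Finset.measurable_fun_sum _ fun a _ => ?_
    split_ifs
    · exact measurable_pi_apply _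
    · exact measurable_const
  have hψ : Measurable fun z : ({J.card - 1} : Finset ℕ) → ℕ => z ⟨J.card - 1, by simp⟩ :=
    measurable_pi_apply _
  convert hind.comp hφ hψ using 1
  · funext ω s
    simp only [Function.comp_apply]
    rw [← hidx2 s, htel, Finset.sum_coe_sort (Finset.range (J.card - 1))
      (fun a => if a < idx s then Z a ω else 0), ← Finset.sum_filter]
    congr 1
    ext a
    have := hidx1 s
    simp only [Finset.mem_range, Finset.mem_filter]
    omega
  · funext ω
    simp only [Function.comp_apply, hZ, htc, htd]

theorem IsPoissonCounter.setOf_sub_eq_zero (hN : IsPoissonCounter P N r) {s t : ℝ≥0}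
    (hst : s ≤ t) : {ω | N t ω - N s ω = 0} = {ω | N t ω = N s ω} := by
  ext ω
  have := hN.mono ω hst
  simp only [mem_ofPred_eq] at this ⊢
  omega

theorem IsPoissonCounter.measure_eq (hN : IsPoissonCounter P N r) {s t : ℝ≥0} (hst : s ≤ t)
    (A : Set ℕ) : P {ω | N t ω - N s ω ∈ A} = poissonMeasure (r * (t - s)) A := by
  have hm : Measurable fun ω => N t ω - N s ω := (hN.measurable t).sub (hN.measurable s)
  rw [← (hN.increment_law s t hst).map_eq, Measure.map_apply hm MeasurableSet.of_discrete]
  rfl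

theorem IsPoissonCounter.measure_constant (hN : IsPoissonCounter P N r) (d x : ℝ≥0) :
    P {ω | N (d + x) ω = N d ω} = ENNReal.ofReal (Real.exp (-(r * x))) := by
  have h := hN.measure_eq (le_self_add : d ≤ d + x) {0}
  rw [poissonMeasure_singleton, add_tsub_cancel_left] at h
  simp only [mem_singleton_iff] at h
  rw [hN.setOf_sub_eq_zero le_self_add] at h
  rw [h]
  simp

theorem IsPoissonCounter.measure_inter_constant (hN : IsPoissonCounter P N r) (d x : ℝ≥0)
    {G : Set Ω}
    (hG : MeasurableSet[MeasurableSpace.comap (fun ω (s : Iic d) => N s ω) inferInstance] G) :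
    P (G ∩ {ω | N (d + x) ω = N d ω}) = P G * ENNReal.ofReal (Real.exp (-(r * x))) := by
  rw [← hN.measure_constant d x, ← hN.setOf_sub_eq_zero le_self_add]
  exact (IndepFun_iff _ _ _).1 (hN.indepFun_past d x) _ _ hG
    ⟨{0}, MeasurableSet.of_discrete, rfl⟩

theorem poissonMeasure_ne_zero_le (a : ℝ≥0) : poissonMeasure a {n | n ≠ 0} ≤ a := by
  have h : {n : ℕ | n ≠ 0} = {0}ᶜ := by ext; simp
  rw [h, prob_compl_eq_one_sub MeasurableSet.of_discrete, poissonMeasure_singleton]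
  simp only [pow_zero, mul_one, Nat.factorial_zero, Nat.cast_one, div_one]
  rw [← ENNReal.ofReal_one, ← ENNReal.ofReal_sub _ (Real.exp_pos _).le, ← ENNReal.ofReal_coe_nnreal]
  refine ENNReal.ofReal_le_ofReal ?_
  linarith [Real.add_one_le_exp (-(a : ℝ))]

/-- From exp(-a) ≥ 1 - a one gets 1 - (1 + a) exp(-a) ≤ 1 - (1 + a)(1 - a) = a². This quadratic
smallness is what excludes multiple jumps. -/
theorem poissonMeasure_two_le_le (a : ℝ≥0) : poissonMeasure a {n | 2 ≤ n} ≤ a * a := by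
  have h : {n : ℕ | 2 ≤ n} = {0, 1}ᶜ := by
    ext n; simp only [mem_ofPred_eq, mem_compl_iff, mem_insert_iff, mem_singleton_iff]; omega
  have h2 : ({0, 1} : Set ℕ) = {0} ∪ {1} := rfl
  rw [h, prob_compl_eq_one_sub MeasurableSet.of_discrete, h2,
    measure_union (by simp) MeasurableSet.of_discrete, poissonMeasure_singleton,
    poissonMeasure_singleton, ← ENNReal.ofReal_add (by positivity) (by positivity),
    ← ENNReal.ofReal_one, ← ENNReal.ofReal_sub _ (by positivity), ← ENNReal.ofReal_coe_nnreal,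
    ← ENNReal.ofReal_mul a.coe_nonneg]
  refine ENNReal.ofReal_le_ofReal ?_
  have h3 := Real.add_one_le_exp (-(a : ℝ))
  simp only [pow_zero, mul_one, Nat.factorial_zero, Nat.cast_one, div_one, pow_one,
    Nat.factorial_one]
  nlinarith [a.2, mul_le_mul_of_nonneg_right h3 (by positivity : (0 : ℝ) ≤ 1 + a)]

/-- If `f` grows by an event of probability `O(h²)` on intervals of length `h`, it never happens. -/
theorem measure_eq_zero_of_forall_interval {E : ℝ≥0 → ℝ≥0 → Set Ω} {K : ℝ≥0} {A : Set Ω}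
    (hE : ∀ s h, P (E s (s + h)) ≤ K * (h * h))
    (hA : ∀ ω ∈ A, ∃ u : ℝ≥0, 0 < u ∧ ∀ s t, s < u → u ≤ t → ω ∈ E s t) : P A = 0 := by
  have key : ∀ T : ℕ, P {ω | ∃ u : ℝ≥0, 0 < u ∧ u ≤ T ∧ ∀ s t, s < u → u ≤ t → ω ∈ E s t} = 0 := by
    intro T
    have hb : ∀ q : ℕ, P {ω | ∃ u : ℝ≥0, 0 < u ∧ u ≤ T ∧ ∀ s t, s < u → u ≤ t → ω ∈ E s t} ≤
        ENNReal.ofReal (K * T * (1 / ((q : ℝ) + 1))) := by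
      intro q
      -- A grid of mesh h on [0, T] has T/h cells, each contributing at most K h², for a total of K
      -- T h.
      set h : ℝ≥0 := 1 / (q + 1) with hh
      have hh0 : 0 < h := by positivity
      calc _ ≤ P (⋃ i ∈ Finset.range (T * (q + 1)), E (i * h) (i * h + h)) := by
            refine measure_mono fun ω => ?_
            rintro ⟨u, hu0, huT, hu⟩
            -- The cell containing `u` is open on the left and closed on the right, whence the
            -- ceiling minus one; `hu` needs its left end strictly below `u`.
            have hc0 : 0 < ⌈u / h⌉₊ := Nat.ceil_pos.2 (by positivity)
            have h1 : u / h ≤ ⌈u / h⌉₊ := Nat.le_ceil _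
            have h2 : ((⌈u / h⌉₊ - 1 : ℕ) : ℝ≥0) < u / h := Nat.lt_ceil.1 (by omega)
            simp only [mem_iUnion, Finset.mem_range]
            refine ⟨⌈u / h⌉₊ - 1, ?_, hu _ _ ?_ ?_⟩
            · have h3 : ⌈u / h⌉₊ ≤ T * (q + 1) := by
                rw [Nat.ceil_le]
                push_cast
                rw [hh, div_div_eq_mul_div, div_one]
                gcongr
              omega
            · rwa [lt_div_iff₀ hh0] at h2
            · rw [div_le_iff₀ hh0] at h1
              refine h1.trans (le_of_eq ?_)
              have : (⌈u / h⌉₊ : ℝ≥0) = ((⌈u / h⌉₊ - 1 : ℕ) : ℝ≥0) + 1 := by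
                exact_mod_cast (by omega : ⌈u / h⌉₊ = ⌈u / h⌉₊ - 1 + 1)
              rw [this]; ring
        _ ≤ ∑ i ∈ Finset.range (T * (q + 1)), P (E (i * h) (i * h + h)) :=
            measure_biUnion_finset_le _ _
        _ ≤ ∑ i ∈ Finset.range (T * (q + 1)), (K * (h * h) : ENNReal) :=
            Finset.sum_le_sum fun i _ => hE _ _
        _ = ENNReal.ofReal (K * T * (1 / ((q : ℝ) + 1))) := by
            rw [Finset.sum_const, Finset.card_range, nsmul_eq_mul]
            rw [← ENNReal.coe_mul, ← ENNReal.coe_mul, ← ENNReal.coe_natCast, ← ENNReal.coe_mul,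
              ← ENNReal.ofReal_coe_nnreal]
            congr 1
            rw [hh]
            push_cast
            field_simp
    have hlim : Tendsto (fun q : ℕ => ENNReal.ofReal (K * T * (1 / ((q : ℝ) + 1)))) atTop (𝓝 0) := by
      have := (tendsto_one_div_add_atTop_nhds_zero_nat (𝕜 := ℝ)).const_mul (K * T : ℝ)
      rw [mul_zero] at this
      simpa using ENNReal.tendsto_ofReal this
    exact le_antisymm (ge_of_tendsto' hlim hb) zero_le
  refine measure_mono_null (fun ω hω => ?_) (measure_iUnion_null key)
  obtain ⟨u, hu0, hu⟩ := hA ω hω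
  obtain ⟨T, hT⟩ := exists_nat_ge u
  exact mem_iUnion.2 ⟨T, u, hu0, hT, hu⟩

/-- A Poisson counter almost surely has unit jumps. -/
theorem IsPoissonCounter.ae_unit_jumps (hN : IsPoissonCounter P N r) :
    ∀ᵐ ω ∂P, ∀ u, 0 < u → ∃ s < u, N u ω ≤ N s ω + 1 := by
  rw [ae_iff]
  refine measure_eq_zero_of_forall_interval (E := fun s t => {ω | N t ω - N s ω ∈ {n | 2 ≤ n}})
    (K := r * r) (fun s h => ?_) fun ω hω => ?_
  · rw [hN.measure_eq le_self_add, add_tsub_cancel_left]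
    refine (poissonMeasure_two_le_le _).trans (le_of_eq ?_)
    push_cast; ring
  · simp only [mem_ofPred_eq, not_forall, not_exists, not_and, not_le] at hω
    obtain ⟨u, hu, h⟩ := hω
    refine ⟨u, hu, fun s t hs ht => ?_⟩
    have h1 := h s hs
    have h2 := hN.mono ω ht
    simp only [mem_ofPred_eq] at h2 ⊢
    omega

/-- Two independent Poisson counters almost surely have no common jumps. -/
theorem IsPoissonCounter.ae_no_common_jumps (hN : IsPoissonCounter P N r) {N' : ℝ≥0 → Ω → ℕ}
    {r' : ℝ≥0} (hN' : IsPoissonCounter P N' r')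
    (hind : IndepFun (fun ω t => N t ω) (fun ω t => N' t ω) P) :
    ∀ᵐ ω ∂P, ∀ u, IsActivation (fun t => N t ω) u → ¬ IsActivation (fun t => N' t ω) u := by
  rw [ae_iff]
  refine measure_eq_zero_of_forall_interval
    (E := fun s t => {ω | N t ω - N s ω ∈ {n | n ≠ 0}} ∩ {ω | N' t ω - N' s ω ∈ {n | n ≠ 0}})
    (K := r * r') (fun s h => ?_) fun ω hω => ?_
  · have hi : IndepFun (fun ω => N (s + h) ω - N s ω) (fun ω => N' (s + h) ω - N' s ω) P :=
      hind.comp (φ := fun f : ℝ≥0 → ℕ => f (s + h) - f s) (ψ := fun f : ℝ≥0 → ℕ => f (s + h) - f s)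
        (by fun_prop) (by fun_prop)
    refine (hi.measure_inter_preimage_eq_mul {n | n ≠ 0} {n | n ≠ 0} MeasurableSet.of_discrete
      MeasurableSet.of_discrete).le.trans ?_
    refine (mul_le_mul' (hN.measure_eq (le_self_add : s ≤ s + h) _).le
      (hN'.measure_eq (le_self_add : s ≤ s + h) _).le).trans ?_
    rw [add_tsub_cancel_left]
    refine (mul_le_mul' (poissonMeasure_ne_zero_le _) (poissonMeasure_ne_zero_le _)).trans
      (le_of_eq ?_)
    push_cast; ring
  · simp only [mem_ofPred_eq, not_forall, not_not] at hω
    obtain ⟨u, ⟨hu, h1⟩, -, h2⟩ := hω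
    refine ⟨u, hu, fun s t hs ht => ?_⟩
    have e1 := h1 s hs
    have e2 := hN.mono ω ht
    have e3 := h2 s hs
    have e4 := hN'.mono ω ht
    simp only [mem_inter_iff, mem_ofPred_eq] at e1 e2 e3 e4 ⊢
    omega

/-- A Poisson counter with positive rate is almost surely unbounded. -/
theorem IsPoissonCounter.ae_unbounded (hN : IsPoissonCounter P N r) (hr : 0 < r) :
    ∀ᵐ ω ∂P, ∀ b : ℕ, ∃ t, b < N t ω := by
  rw [ae_all_iff]
  intro b
  rw [ae_iff]
  -- A path bounded by `b` has at most `b` jumps by every time q, and the Poisson mass of {0, …, b}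
  -- with mean r q tends to 0.
  have hb : ∀ q : ℕ, P {ω | ¬ ∃ t, b < N t ω} ≤
      ∑ i ∈ Finset.range (b + 1), ENNReal.ofReal (Real.exp (-(r * q)) * (r * q) ^ i / i.factorial) := by
    intro q
    calc P {ω | ¬ ∃ t, b < N t ω} ≤ P {ω | N q ω - N 0 ω ∈ (Finset.range (b + 1) : Set ℕ)} := by
          refine measure_mono fun ω hω => ?_
          simp only [mem_ofPred_eq, not_exists, not_lt] at hω
          have := hω q
          simp only [Finset.coe_range, mem_ofPred_eq, mem_Iio]
          omega
      _ = _ := by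
          rw [hN.measure_eq zero_le, tsub_zero, ← sum_measure_singleton]
          refine Finset.sum_congr rfl fun i _ => ?_
          rw [poissonMeasure_singleton]
          push_cast
          rfl
  have hlim : Tendsto (fun q : ℕ => ∑ i ∈ Finset.range (b + 1),
      ENNReal.ofReal (Real.exp (-(r * q)) * (r * q) ^ i / i.factorial)) atTop (𝓝 0) := by
    rw [← Finset.sum_const_zero (s := Finset.range (b + 1))]
    refine tendsto_finsetSum _ fun i _ => ?_
    rw [← ENNReal.ofReal_zero]
    refine ENNReal.tendsto_ofReal ?_
    have h1 : Tendsto (fun q : ℕ => (r : ℝ) * q) atTop atTop :=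
      tendsto_natCast_atTop_atTop.const_mul_atTop (by exact_mod_cast hr)
    have h2 := ((Real.tendsto_pow_mul_exp_neg_atTop_nhds_zero i).comp h1).div_const (i.factorial : ℝ)
    rw [zero_div] at h2
    refine h2.congr fun q => ?_
    simp only [Function.comp_apply]
    ring
  exact le_antisymm (ge_of_tendsto' hlim hb) zero_le

end Poisson

/-! ### Waiting times of a single path. -/

section WaitingTime

/-- The time from `t` until the next jump of the counter path `f`. -/
noncomputable def waitingTime (f : ℝ≥0 → ℕ) (t : ℝ≥0) : ℝ≥0 := sInf {x | f t < f (t + x)}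

variable {f : ℝ≥0 → ℕ}

theorem exists_eq_of_continuousWithinAt {t : ℝ≥0} (hf : ContinuousWithinAt f (Ici t) t) :
    ∃ ε > 0, ∀ u, t ≤ u → u < t + ε → f u = f t := by
  have h := hf.eventually (f := f) (p := fun n => n = f t) (by simp [nhds_discrete])
  rw [eventually_nhdsWithin_iff, Metric.eventually_nhds_iff] at h
  obtain ⟨ε, hε, h⟩ := h
  refine ⟨⟨ε, hε.le⟩, hε, fun u htu hut => h ?_ htu⟩
  rw [NNReal.dist_eq, abs_of_nonneg (sub_nonneg.2 (by exact_mod_cast htu))]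
  have : (u : ℝ) < t + ε := by exact_mod_cast hut
  linarith

/-- Right-continuity of an integer-valued path makes the infimum of the jump set attained. The
second alternative is a path with no jump after `t`: the set is empty and its infimum in `ℝ≥0` is 0.
Testing integer shifts keeps the condition countable, which serves measurability. -/
theorem waitingTime_le_iff_or (hm : Monotone f) (hf : ∀ t, ContinuousWithinAt f (Ici t) t)
    {t x : ℝ≥0} : waitingTime f t ≤ x ↔ f t < f (t + x) ∨ ∀ n : ℕ, f (t + n) = f t := by
  constructor
  · intro h
    by_cases hne : {x | f t < f (t + x)}.Nonempty
    · left
      by_contra hx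
      have hx : f (t + x) = f t := le_antisymm (not_lt.1 hx) (hm le_self_add)
      obtain ⟨ε, hε, hu⟩ := exists_eq_of_continuousWithinAt (hf (t + x))
      obtain ⟨y, hy, hyx⟩ := exists_lt_of_csInf_lt hne (h.trans_lt (lt_add_of_pos_right x hε))
      rcases le_total y x with hyx' | hyx'
      · exact absurd (hm (add_le_add_right hyx' t)) (by rw [hx]; exact not_le.2 hy)
      · have := hu (t + y) (add_le_add_right hyx' t) (by
          rw [add_assoc]; exact (add_lt_add_iff_left t).2 hyx)
        rw [hx] at this
        exact absurd hy (by simp [this])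
    · right
      intro n
      rw [Set.not_nonempty_iff_eq_empty, Set.eq_empty_iff_forall_notMem] at hne
      exact le_antisymm (not_lt.1 (hne n)) (hm le_self_add)
  · rintro (h | h)
    · exact csInf_le' h
    · have : {x | f t < f (t + x)} = ∅ := by
        rw [Set.eq_empty_iff_forall_notMem]
        intro y hy
        obtain ⟨n, hn⟩ := exists_nat_ge y
        have := hm (add_le_add_right hn t)
        rw [h n] at this
        exact absurd this (not_le.2 hy)
      rw [waitingTime, this]
      simp

theorem waitingTime_le_iff (hm : Monotone f) (hf : ∀ t, ContinuousWithinAt f (Ici t) t)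
    (hub : ∀ b, ∃ t, b < f t) {t x : ℝ≥0} : waitingTime f t ≤ x ↔ f t < f (t + x) := by
  rw [waitingTime_le_iff_or hm hf, or_iff_left]
  intro h
  obtain ⟨s, hs⟩ := hub (f t)
  obtain ⟨n, hn⟩ := exists_nat_ge s
  exact absurd (hm (hn.trans (le_add_self : (n : ℝ≥0) ≤ t + n))) (by rw [h n]; exact not_le.2 hs)

theorem add_waitingTime_le_iff (hm : Monotone f) (hf : ∀ t, ContinuousWithinAt f (Ici t) t)
    (hub : ∀ b, ∃ t, b < f t) {t u : ℝ≥0} : t + waitingTime f t ≤ u ↔ t ≤ u ∧ f t < f u := by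
  constructor
  · intro h
    have htu : t ≤ u := le_self_add.trans h
    refine ⟨htu, ?_⟩
    obtain ⟨x, rfl⟩ := exists_add_of_le htu
    exact (waitingTime_le_iff hm hf hub).1 (by simpa using h)
  · rintro ⟨htu, h⟩
    obtain ⟨x, rfl⟩ := exists_add_of_le htu
    simpa using (waitingTime_le_iff hm hf hub).2 h

/-- For a random `t`, the value of the path at `t` is awkward to observe. By right-continuity it is
still taken at a slightly later rational time, so the event becomes a countable union of events
known at time `u`. -/
theorem lt_and_lt_iff_exists_rat (hm : Monotone f) (hf : ∀ t, ContinuousWithinAt f (Ici t) t)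
    {t u : ℝ≥0} : (t ≤ u ∧ f t < f u) ↔
      ∃ q : ℚ, Real.toNNReal q < u ∧ t ≤ Real.toNNReal q ∧ f (Real.toNNReal q) < f u := by
  constructor
  · rintro ⟨htu, h⟩
    have htu : t < u := lt_of_le_of_ne htu fun e => by simp [e] at h
    obtain ⟨ε, hε, hu⟩ := exists_eq_of_continuousWithinAt (hf t)
    obtain ⟨q, -, h1, h2⟩ := (NNReal.lt_iff_exists_rat_btwn t (min u (t + ε))).1
      (lt_min htu (lt_add_of_pos_right t hε))
    refine ⟨q, h2.trans_le (min_le_left _ _), h1.le, ?_⟩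
    rwa [hu _ h1.le (h2.trans_le (min_le_right _ _))]
  · rintro ⟨q, h1, h2, h3⟩
    exact ⟨h2.trans h1.le, (hm h2).trans_lt h3⟩

end WaitingTime

/-! ### σ-algebras completed by null sets, needed because hitting times behave well only on
unbounded paths. -/

section Completion

variable {Ω : Type*} {m0 : MeasurableSpace Ω}

/-- The measurable sets that agree almost surely with a set in `m`. -/
def completionOf (P : Measure Ω) (m : MeasurableSpace Ω) : MeasurableSpace Ω :=
  m0 ⊓ eventuallyMeasurableSpace m (ae P)

variable {P : Measure Ω} {m m' : MeasurableSpace Ω}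

theorem measurableSet_completionOf {G : Set Ω} : MeasurableSet[completionOf P m] G ↔
    MeasurableSet[m0] G ∧ ∃ G', MeasurableSet[m] G' ∧ G =ᵐ[P] G' :=
  MeasurableSpace.measurableSet_inf

theorem completionOf_le : completionOf P m ≤ m0 := inf_le_left

theorem completionOf_mono (h : m ≤ m') : completionOf P m ≤ completionOf P m' := by
  intro G hG
  rw [measurableSet_completionOf] at hG ⊢
  obtain ⟨h1, G', h2, h3⟩ := hG
  exact ⟨h1, G', h _ h2, h3⟩

theorem le_completionOf (h : m ≤ m0) : m ≤ completionOf P m := fun G hG =>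
  measurableSet_completionOf.2 ⟨h _ hG, G, hG, Filter.EventuallyEq.rfl⟩

theorem measurableSet_completionOf_congr {G G' : Set Ω} (hG : MeasurableSet[m0] G)
    (hG' : MeasurableSet[completionOf P m] G') (h : G =ᵐ[P] G') :
    MeasurableSet[completionOf P m] G := by
  rw [measurableSet_completionOf] at hG' ⊢
  obtain ⟨-, G'', h2, h3⟩ := hG'
  exact ⟨hG, G'', h2, h.trans h3⟩

theorem indep_completionOf_left (h : Indep m m' P) : Indep (completionOf P m) m' P := by
  rw [Indep_iff] at h ⊢
  intro G H hG hH
  obtain ⟨-, G', h2, h3⟩ := measurableSet_completionOf.1 hG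
  rw [measure_congr h3, measure_congr (h3.inter (ae_eq_refl H)), h G' H h2 hH]

end Completion

/-! ### The Markov property of the family of counters at a fixed time. -/

section Counters

variable {Ω : Type*} {m0 : MeasurableSpace Ω} {P : Measure Ω} {ι : Type*}
  {B : ι → ℝ≥0 → Ω → ℕ} {r : ι → ℝ≥0}

/-- The events that depend on the paths of the counters `B` up to time `d`. -/
def historyAt (B : ι → ℝ≥0 → Ω → ℕ) (d : ℝ≥0) : MeasurableSpace Ω :=
  ⨆ c, MeasurableSpace.comap (fun ω (s : Iic d) => B c s ω) inferInstance

/-- The events that depend on the paths of the counters `B`. -/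
def history (B : ι → ℝ≥0 → Ω → ℕ) : MeasurableSpace Ω :=
  MeasurableSpace.comap (fun ω c t => B c t ω) inferInstance

theorem measurable_history (c : ι) (t : ℝ≥0) : Measurable[history B] (B c t) := by
  have h1 : Measurable[history B] fun ω c t => B c t ω := comap_measurable _
  exact (measurable_pi_apply t).comp ((measurable_pi_apply c).comp h1)

theorem measurable_historyAt (c : ι) {d t : ℝ≥0} (ht : t ≤ d) :
    Measurable[historyAt B d] (B c t) := by
  have h1 : Measurable[historyAt B d] fun ω (s : Iic d) => B c s ω :=
    Measurable.of_comap_le (le_iSup (fun c => MeasurableSpace.comap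
      (fun ω (s : Iic d) => B c s ω) inferInstance) c)
  exact (measurable_pi_apply (⟨t, ht⟩ : Iic d)).comp h1

theorem historyAt_le {m : MeasurableSpace Ω} {d : ℝ≥0}
    (h : ∀ c, ∀ t ≤ d, Measurable[m] (B c t)) : historyAt B d ≤ m :=
  iSup_le fun c => Measurable.comap_le (measurable_pi_lambda _ fun s => h c s s.2)

theorem historyAt_mono {d d' : ℝ≥0} (h : d ≤ d') : historyAt B d ≤ historyAt B d' :=
  historyAt_le fun c _ ht => measurable_historyAt c (ht.trans h)

theorem historyAt_le_history (d : ℝ≥0) : historyAt B d ≤ history B :=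
  historyAt_le fun c t _ => measurable_history c t

theorem history_le (hB : ∀ c t, Measurable (B c t)) : history B ≤ m0 :=
  Measurable.comap_le (measurable_pi_lambda _ fun c => measurable_pi_lambda _ fun t => hB c t)

variable [IsProbabilityMeasure P] [Fintype ι]

/-- After a fixed time, the times until the next jumps of independent Poisson counters are independent
exponential variables, independent of the past. -/
theorem measure_inter_constant (hB : ∀ c, IsPoissonCounter P (B c) (r c))
    (hind : iIndepFun (fun c ω t => B c t ω) P) (d : ℝ≥0) (x : ι → ℝ≥0) {G : Set Ω}
    (hG : MeasurableSet[completionOf P (historyAt B d)] G) :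
    P (G ∩ {ω | ∀ c, B c (d + x c) ω = B c d ω}) =
      P G * ∏ c, ENNReal.ofReal (Real.exp (-(r c * x c))) := by
  set E : ι → Set Ω := fun c => {ω | B c (d + x c) ω = B c d ω} with hE
  have hEU : {ω | ∀ c, B c (d + x c) ω = B c d ω} = ⋂ c, E c := by ext; simp [hE]
  have hEm : ∀ c, MeasurableSet[MeasurableSpace.comap (fun ω t => B c t ω) inferInstance] (E c) :=
    fun c => ⟨{f | f (d + x c) = f d}, measurableSet_eq_fun (measurable_pi_apply _)
      (measurable_pi_apply _), rfl⟩
  have hpast : ∀ c, MeasurableSpace.comap (fun ω (s : Iic d) => B c s ω) inferInstance ≤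
      MeasurableSpace.comap (fun ω t => B c t ω) inferInstance := by
    intro c
    rw [← measurable_iff_comap_le]
    have h : Measurable fun (f : ℝ≥0 → ℕ) (s : Iic d) => f s :=
      measurable_pi_lambda _ fun s => measurable_pi_apply (s : ℝ≥0)
    exact h.comp (comap_measurable (fun ω t => B c t ω))
  have hBm : ∀ c, MeasurableSpace.comap (fun ω t => B c t ω) inferInstance ≤ m0 :=
    fun c => Measurable.comap_le (measurable_pi_lambda _ fun t => (hB c).measurable t)
  have hPE : P (⋂ c, E c) = ∏ c, ENNReal.ofReal (Real.exp (-(r c * x c))) := by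
    rw [hind.meas_iInter hEm]
    exact Finset.prod_congr rfl fun c _ => (hB c).measure_constant d (x c)
  have hI : Indep (historyAt B d) (MeasurableSpace.generateFrom {⋂ c, E c}) P := by
    have hgen := generateFrom_piiUnionInter_measurableSet
      (fun c => MeasurableSpace.comap (fun ω (s : Iic d) => B c s ω) inferInstance) univ
    simp only [mem_univ, iSup_pos] at hgen
    rw [historyAt, ← hgen]
    -- A finite intersection is padded with `univ` to one factor per counter, so that the
    -- independence of the counters applies to the past and the future factor by factor.
    have hrep : ∀ s ∈ piiUnionInter (fun c => {s | MeasurableSet[MeasurableSpace.comap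
        (fun ω (s : Iic d) => B c s ω) inferInstance] s}) univ, ∃ g : ι → Set Ω,
        (∀ c, MeasurableSet[MeasurableSpace.comap (fun ω (s : Iic d) => B c s ω) inferInstance]
          (g c)) ∧ s = ⋂ c, g c := by
      classical
      rintro s ⟨t, -, g, hg, rfl⟩
      refine ⟨fun c => if c ∈ t then g c else univ, fun c => ?_, ?_⟩
      · by_cases h : c ∈ t
        · simp only [h, if_true]; exact hg c h
        · simp only [h, if_false, MeasurableSet.univ]
      · ext ω
        simp only [mem_iInter]
        refine forall_congr' fun c => ?_
        by_cases h : c ∈ t <;> simp [h]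
    refine IndepSets.indep' ?_ ?_ (isPiSystem_piiUnionInter _
      (fun c => @MeasurableSpace.isPiSystem_measurableSet Ω (MeasurableSpace.comap
        (fun ω (s : Iic d) => B c s ω) inferInstance)) _) (IsPiSystem.singleton _) ?_
    · intro s hs
      obtain ⟨g, hg, rfl⟩ := hrep s hs
      exact MeasurableSet.iInter fun c => hBm c _ (hpast c _ (hg c))
    · rintro s rfl
      exact MeasurableSet.iInter fun c => hBm c _ (hEm c)
    · rw [IndepSets_iff]
      rintro s t hs rfl
      obtain ⟨g, hg, rfl⟩ := hrep s hs
      rw [← iInter_inter_distrib, hPE, hind.meas_iInter fun c => (hpast c _ (hg c)).inter (hEm c),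
        hind.meas_iInter fun c => hpast c _ (hg c), ← Finset.prod_mul_distrib]
      exact Finset.prod_congr rfl fun c _ => (hB c).measure_inter_constant d (x c) (hg c)
  rw [hEU, ← hPE]
  exact (Indep_iff _ _ _).1 (indep_completionOf_left hI) _ _ hG
    (MeasurableSpace.measurableSet_generateFrom rfl)

end Counters

/-! ### Discretization of random times from above. -/

section RoundUp

/-- The least multiple of `1 / (q + 1)` that is greater than `t`. -/
noncomputable def roundUp (q : ℕ) (t : ℝ≥0) : ℝ≥0 := (⌊t * (q + 1)⌋₊ + 1) / (q + 1)

theorem lt_roundUp (q : ℕ) (t : ℝ≥0) : t < roundUp q t := by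
  rw [roundUp, lt_div_iff₀ (by positivity)]
  exact Nat.lt_floor_add_one _

theorem roundUp_le (q : ℕ) (t : ℝ≥0) : roundUp q t ≤ t + 1 / (q + 1) := by
  rw [roundUp, add_div]
  gcongr
  rw [div_le_iff₀ (by positivity)]
  exact Nat.floor_le zero_le

theorem tendsto_roundUp (t : ℝ≥0) : Tendsto (fun q => roundUp q t) atTop (𝓝 t) := by
  refine tendsto_of_tendsto_of_tendsto_of_le_of_le tendsto_const_nhds ?_
    (fun q => (lt_roundUp q t).le) fun q => roundUp_le q t
  have h : Tendsto (fun q : ℕ => 1 / ((q : ℝ≥0) + 1)) atTop (𝓝 0) :=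
    tendsto_one_div_add_atTop_nhds_zero_nat
  simpa using h.const_add t

theorem tendsto_comp_roundUp_add {f : ℝ≥0 → ℕ} {t x : ℝ≥0}
    (hf : ContinuousWithinAt f (Ici (t + x)) (t + x)) :
    Tendsto (fun q => f (roundUp q t + x)) atTop (𝓝 (f (t + x))) := by
  refine hf.tendsto.comp (tendsto_nhdsWithin_iff.2
    ⟨(tendsto_roundUp t).add_const x, Eventually.of_forall fun q => ?_⟩)
  exact add_le_add_left (lt_roundUp q t).le x

/-- The rounded times take countably many values and decrease to σ from the right, so
right-continuity gives the evaluation at σ as a limit of measurable functions. -/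
theorem measurable_comp_add {Ω : Type*} {m : MeasurableSpace Ω} {N : ℝ≥0 → Ω → ℕ}
    (hN : ∀ t, Measurable (N t)) (hc : ∀ ω t, ContinuousWithinAt (fun u => N u ω) (Ici t) t)
    {σ : Ω → ℝ≥0} (hσ : Measurable σ) (x : ℝ≥0) : Measurable fun ω => N (σ ω + x) ω := by
  refine measurable_of_tendsto_metrizable (f := fun q ω => N (roundUp q (σ ω) + x) ω) (fun q => ?_)
    (tendsto_pi_nhds.2 fun ω => tendsto_comp_roundUp_add (hc ω _))
  have h1 : Measurable fun ω => (⌊σ ω * (q + 1)⌋₊, ω) :=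
    (Nat.measurable_floor.comp (hσ.mul_const _)).prodMk measurable_id
  have h2 : ∀ g : ℕ → ℝ≥0, Measurable fun ω => N (g ⌊σ ω * (q + 1)⌋₊) ω := fun g =>
    Measurable.comp (g := fun p : ℕ × Ω => N (g p.1) p.2)
      (measurable_from_prod_countable_right fun i => hN (g i)) h1
  exact h2 fun i => ((i : ℝ≥0) + 1) / (q + 1) + x

theorem measurable_waitingTime {Ω : Type*} {m : MeasurableSpace Ω} {N : ℝ≥0 → Ω → ℕ}
    (hN : ∀ t, Measurable (N t)) (hm : ∀ ω, Monotone fun t => N t ω)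
    (hc : ∀ ω t, ContinuousWithinAt (fun u => N u ω) (Ici t) t)
    {σ : Ω → ℝ≥0} (hσ : Measurable σ) : Measurable fun ω => waitingTime (fun t => N t ω) (σ ω) := by
  have h0 : Measurable fun ω => N (σ ω) ω := by simpa using measurable_comp_add hN hc hσ 0
  refine measurable_of_Iic fun x => ?_
  have : (fun ω => waitingTime (fun t => N t ω) (σ ω)) ⁻¹' Iic x =
      {ω | N (σ ω) ω < N (σ ω + x) ω} ∪ ⋂ n : ℕ, {ω | N (σ ω + n) ω = N (σ ω) ω} := by
    ext ω
    simp only [mem_preimage, mem_Iic, waitingTime_le_iff_or (hm ω) (hc ω), mem_union, mem_iInter,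
      mem_ofPred_eq]
  rw [this]
  exact (measurableSet_lt h0 (measurable_comp_add hN hc hσ x)).union
    (MeasurableSet.iInter fun n => measurableSet_eq_fun (measurable_comp_add hN hc hσ n) h0)

end RoundUp

theorem expMeasure_Ioi {a : ℝ≥0} (ha : 0 < a) (x : ℝ) :
    expMeasure a (Ioi x) = ENNReal.ofReal (Real.exp (-(a * x.toNNReal))) := by
  have hp := isProbabilityMeasure_expMeasure (r := a) (by exact_mod_cast ha)
  rw [← compl_Iic, prob_compl_eq_one_sub measurableSet_Iic, ← ofReal_cdf,
    cdf_expMeasure_eq (by exact_mod_cast ha), ← ENNReal.ofReal_one, ← ENNReal.ofReal_sub]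
  · congr 1
    split_ifs with h
    · rw [Real.coe_toNNReal _ h]; ring
    · rw [Real.toNNReal_of_nonpos (not_le.1 h).le]; simp
  · split_ifs with h
    · have : 0 ≤ a * x := by positivity
      simpa using this
    · exact le_rfl

/-! ### Stopping times and the strong Markov property. -/

section StopTime

variable {Ω : Type*} {m0 : MeasurableSpace Ω} {P : Measure Ω} {ι : Type*}
  {B : ι → ℝ≥0 → Ω → ℕ} {r : ι → ℝ≥0} {σ σ' : Ω → ℝ≥0}

/-- `σ` is a finite stopping time of the completed filtration generated by the counters `B`. -/
def IsStopTime (P : Measure Ω) (B : ι → ℝ≥0 → Ω → ℕ) (σ : Ω → ℝ≥0) : Prop :=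
  ∀ d, MeasurableSet[completionOf P (historyAt B d)] {ω | σ ω ≤ d}

/-- The events that depend on the paths of the counters `B` up to the stopping time `σ`. -/
def pastOf (h : IsStopTime P B σ) : MeasurableSpace Ω where
  MeasurableSet' G := MeasurableSet[completionOf P (history B)] G ∧
    ∀ d, MeasurableSet[completionOf P (historyAt B d)] (G ∩ {ω | σ ω ≤ d})
  measurableSet_empty := ⟨@MeasurableSet.empty _ (_), fun d => by
    rw [empty_inter]; exact @MeasurableSet.empty _ (_)⟩
  measurableSet_compl G hG := ⟨hG.1.compl, fun d => by
    have : Gᶜ ∩ {ω | σ ω ≤ d} = {ω | σ ω ≤ d} \ (G ∩ {ω | σ ω ≤ d}) := by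
      ext ω; simp only [mem_inter_iff, mem_compl_iff, mem_ofPred_eq, Set.mem_sdiff]; tauto
    rw [this]
    exact (h d).diff (hG.2 d)⟩
  measurableSet_iUnion G hG := ⟨MeasurableSet.iUnion fun i => (hG i).1, fun d => by
    rw [iUnion_inter]
    exact MeasurableSet.iUnion fun i => (hG i).2 d⟩

theorem completionOf_historyAt_mono {d d' : ℝ≥0} (h : d ≤ d') :
    completionOf P (historyAt B d) ≤ completionOf P (historyAt B d') :=
  completionOf_mono (historyAt_mono h)

theorem pastOf_le_history (h : IsStopTime P B σ) : pastOf h ≤ completionOf P (history B) :=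
  fun _ hG => hG.1

theorem pastOf_le (h : IsStopTime P B σ) : pastOf h ≤ m0 :=
  (pastOf_le_history h).trans completionOf_le

theorem pastOf_mono (h : IsStopTime P B σ) (h' : IsStopTime P B σ') (hle : ∀ ω, σ ω ≤ σ' ω) :
    pastOf h ≤ pastOf h' := by
  intro G hG
  refine ⟨hG.1, fun d => ?_⟩
  have : G ∩ {ω | σ' ω ≤ d} = (G ∩ {ω | σ ω ≤ d}) ∩ {ω | σ' ω ≤ d} := by
    ext ω
    have := hle ω
    simp only [mem_inter_iff, mem_ofPred_eq]
    exact ⟨fun h => ⟨⟨h.1, this.trans h.2⟩, h.2⟩, fun h => ⟨h.1.1, h.2⟩⟩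
  rw [this]
  exact (hG.2 d).inter (h' d)

theorem IsStopTime.measurable_history (h : IsStopTime P B σ) :
    Measurable[completionOf P (history B)] σ :=
  measurable_of_Iic fun d => completionOf_mono (historyAt_le_history d) _ (h d)

/-- At time σ it is known whether σ' has occurred, and when if so. Thus the minimum is known at σ
even though σ' may not be; this is how a delay truncated by the end of a cycle is observed. -/
theorem IsStopTime.measurable_min (h : IsStopTime P B σ) (h' : IsStopTime P B σ') :
    Measurable[pastOf h] fun ω => min (σ' ω) (σ ω) := by
  refine measurable_of_Iic fun x => ⟨?_, fun d => ?_⟩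
  · exact (h'.measurable_history.min h.measurable_history) measurableSet_Iic
  · have : (fun ω => min (σ' ω) (σ ω)) ⁻¹' Iic x ∩ {ω | σ ω ≤ d} =
        ({ω | σ' ω ≤ min x d} ∪ {ω | σ ω ≤ min x d}) ∩ {ω | σ ω ≤ d} ∪
          (if d ≤ x then {ω | σ ω ≤ d} else ∅) := by
      ext ω
      by_cases hdx : d ≤ x
      · simp only [mem_inter_iff, mem_preimage, mem_Iic, min_le_iff, mem_ofPred_eq, hdx, if_true,
          mem_union, min_eq_right]
        constructor
        · exact fun h => Or.inr h.2
        · rintro (h | h)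
          · exact ⟨Or.inr (h.2.trans hdx), h.2⟩
          · exact ⟨Or.inr (h.trans hdx), h⟩
      · have hxd := (not_le.1 hdx).le
        simp [hdx, hxd]
    rw [this]
    have h1 := completionOf_historyAt_mono (P := P) (B := B) (min_le_right x d)
    refine (((h1 _ (h' _)).union (h1 _ (h _))).inter (h d)).union ?_
    split_ifs
    · exact h d
    · exact @MeasurableSet.empty _ (_)

theorem IsStopTime.measurable_pastOf (h : IsStopTime P B σ) : Measurable[pastOf h] σ := by
  simpa using h.measurable_min h

theorem measurableSet_inter_lt (h : IsStopTime P B σ) {G : Set Ω} (hG : MeasurableSet[pastOf h] G)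
    (d : ℝ≥0) : MeasurableSet[completionOf P (historyAt B d)] (G ∩ {ω | σ ω < d}) := by
  have : G ∩ {ω | σ ω < d} = ⋃ q : ℚ, if Real.toNNReal q < d then
      G ∩ {ω | σ ω ≤ Real.toNNReal q} else ∅ := by
    ext ω
    simp only [mem_inter_iff, mem_ofPred_eq, mem_iUnion]
    constructor
    · rintro ⟨h1, h2⟩
      obtain ⟨q, -, h3, h4⟩ := (NNReal.lt_iff_exists_rat_btwn _ _).1 h2
      exact ⟨q, by rw [if_pos h4]; exact ⟨h1, h3.le⟩⟩
    · rintro ⟨q, hq⟩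
      split_ifs at hq with h1
      · exact ⟨hq.1, lt_of_le_of_lt hq.2 h1⟩
      · exact hq.elim
  rw [this]
  refine MeasurableSet.iUnion fun q => ?_
  split_ifs with hq
  · exact completionOf_historyAt_mono hq.le _ (hG.2 _)
  · exact @MeasurableSet.empty _ (_)

theorem measurable_waitingTime_stopTime (hB : ∀ c, IsPoissonCounter P (B c) (r c))
    (h : IsStopTime P B σ) (c : ι) :
    Measurable[completionOf P (history B)] fun ω => waitingTime (fun t => B c t ω) (σ ω) :=
  measurable_waitingTime (fun t => (_root_.measurable_history c t).mono
    (le_completionOf (history_le fun c t => (hB c).measurable t)) le_rfl)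
    (hB c).mono (hB c).rightContinuous h.measurable_history

/-- The time of the next jump after a stopping time is a stopping time. -/
theorem IsStopTime.add_waitingTime (hB : ∀ c, IsPoissonCounter P (B c) (r c)) (hr : ∀ c, 0 < r c)
    (h : IsStopTime P B σ) (c : ι) :
    IsStopTime P B fun ω => σ ω + waitingTime (fun t => B c t ω) (σ ω) := by
  intro d
  have hB' : ∀ c t, Measurable (B c t) := fun c t => (hB c).measurable t
  -- The jump happens by time `d` when some rational q < d has σ ≤ q and a jump falls between q and
  -- d. Agreement is only almost sure, because the waiting time is 0 by default when no jump
  -- follows.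
  refine measurableSet_completionOf_congr (G' := ⋃ q : ℚ, if Real.toNNReal q < d then
      {ω | σ ω ≤ Real.toNNReal q} ∩ {ω | B c (Real.toNNReal q) ω < B c d ω} else ∅) ?_ ?_ ?_
  · exact completionOf_le _ ((h.measurable_history.add
      (measurable_waitingTime_stopTime hB h c)) measurableSet_Iic)
  · refine MeasurableSet.iUnion fun q => ?_
    split_ifs with hq
    · refine (completionOf_historyAt_mono hq.le _ (h _)).inter ?_
      refine le_completionOf (historyAt_le fun c t _ => hB' c t) _ ?_
      exact measurableSet_lt (measurable_historyAt c hq.le) (measurable_historyAt c le_rfl)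
    · exact @MeasurableSet.empty _ (_)
  · refine eventuallyEq_set.2 ?_
    filter_upwards [(hB c).ae_unbounded (hr c)] with ω hω
    rw [add_waitingTime_le_iff ((hB c).mono ω) ((hB c).rightContinuous ω) hω,
      lt_and_lt_iff_exists_rat ((hB c).mono ω) ((hB c).rightContinuous ω), mem_iUnion]
    refine exists_congr fun q => ?_
    split_ifs with hq
    · simp [hq]
    · simp [hq]

/-- The times until the next jumps of the counters `B` after the time `σ`. -/
noncomputable def waitingTimes (B : ι → ℝ≥0 → Ω → ℕ) (σ : Ω → ℝ≥0) (ω : Ω) (c : ι) : ℝ :=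
  waitingTime (fun t => B c t ω) (σ ω)

theorem measurable_waitingTimes (hB : ∀ c, IsPoissonCounter P (B c) (r c))
    (h : IsStopTime P B σ) : Measurable[completionOf P (history B)] (waitingTimes B σ) :=
  @measurable_pi_lambda _ _ _ (_) _ _ fun c => (measurable_waitingTime_stopTime hB h c).coe_nnreal_real

variable [IsProbabilityMeasure P] [Fintype ι]

/-- The **strong Markov property** of independent Poisson counters. -/
theorem measure_inter_constant_stopTime (hB : ∀ c, IsPoissonCounter P (B c) (r c))
    (hind : iIndepFun (fun c ω t => B c t ω) P) (h : IsStopTime P B σ) (x : ι → ℝ≥0) {G : Set Ω}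
    (hG : MeasurableSet[pastOf h] G) :
    P (G ∩ {ω | ∀ c, B c (σ ω + x c) ω = B c (σ ω) ω}) =
      P G * ∏ c, ENNReal.ofReal (Real.exp (-(r c * x c))) := by
  have hBm : ∀ c t, Measurable (B c t) := fun c t => (hB c).measurable t
  have hσm : Measurable σ := h.measurable_history.mono completionOf_le le_rfl
  have hGm : MeasurableSet G := pastOf_le h _ hG
  have hroundm : ∀ q, Measurable fun ω => roundUp q (σ ω) := fun q =>
    ((measurable_from_nat (f := fun i : ℕ => (i : ℝ≥0))).comp
      (Nat.measurable_floor.comp (hσm.mul_const _))).add_const 1 |>.div_const _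
  have hE : ∀ q, MeasurableSet {ω | ∀ c, B c (roundUp q (σ ω) + x c) ω = B c (roundUp q (σ ω)) ω} := by
    intro q
    have : {ω | ∀ c, B c (roundUp q (σ ω) + x c) ω = B c (roundUp q (σ ω)) ω} =
        ⋂ c, {ω | B c (roundUp q (σ ω) + x c) ω = B c (roundUp q (σ ω) + 0) ω} := by ext; simp
    rw [this]
    exact MeasurableSet.iInter fun c => measurableSet_eq_fun
      (measurable_comp_add (hBm c) (hB c).rightContinuous (hroundm q) _)
      (measurable_comp_add (hBm c) (hB c).rightContinuous (hroundm q) _)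
  have hq : ∀ q : ℕ, P (G ∩ {ω | ∀ c, B c (roundUp q (σ ω) + x c) ω = B c (roundUp q (σ ω)) ω}) =
      P G * ∏ c, ENNReal.ofReal (Real.exp (-(r c * x c))) := by
    intro q
    -- On `A i` the rounded time is the constant (i + 1)/(q + 1), so the fixed-time Markov property
    -- applies cell by cell.
    set A : ℕ → Set Ω := fun i => {ω | ⌊σ ω * (q + 1)⌋₊ = i} with hA
    have hAm : ∀ i, MeasurableSet (A i) := fun i =>
      (Nat.measurable_floor.comp (hσm.mul_const _)) (measurableSet_singleton i)
    have hAU : ⋃ i, A i = univ := by ext; simp [hA]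
    have hAd : Pairwise (Function.onFun Disjoint A) := by
      intro i i' hii
      rw [Function.onFun, Set.disjoint_left]
      intro ω h1 h2
      exact hii (h1.symm.trans h2)
    have hdec : ∀ s : Set Ω, MeasurableSet s → P s = ∑' i, P (s ∩ A i) := by
      intro s hs
      rw [← measure_iUnion (fun i i' hii => (hAd hii).mono inter_subset_right inter_subset_right)
        fun i => hs.inter (hAm i), ← inter_iUnion, hAU, inter_univ]
    rw [hdec _ (hGm.inter (hE q)), hdec _ hGm, ← ENNReal.tsum_mul_right]
    refine tsum_congr fun i => ?_
    -- `A i` is the event i/(q + 1) ≤ σ < (i + 1)/(q + 1), decided by the time to which σ is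
    -- rounded.
    have hGA : MeasurableSet[completionOf P (historyAt B (((i : ℝ≥0) + 1) / (q + 1)))] (G ∩ A i) := by
      have : G ∩ A i = (G ∩ {ω | σ ω < ((i : ℝ≥0) + 1) / (q + 1)}) \
          (univ ∩ {ω | σ ω < (i : ℝ≥0) / (q + 1)}) := by
        ext ω
        have hq0 : (0 : ℝ≥0) < q + 1 := by positivity
        simp only [hA, mem_inter_iff, mem_ofPred_eq, Set.mem_sdiff, mem_univ, true_and, not_lt,
          lt_div_iff₀ hq0, Nat.floor_eq_iff (zero_le : 0 ≤ σ ω * (q + 1))]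
        tauto
      rw [this]
      refine (measurableSet_inter_lt h hG _).diff (completionOf_historyAt_mono ?_ _
        (measurableSet_inter_lt h MeasurableSet.univ _))
      gcongr
      exact le_self_add
    rw [← measure_inter_constant hB hind _ x hGA]
    congr 1
    ext ω
    simp only [mem_inter_iff, mem_ofPred_eq, hA, roundUp]
    constructor
    · rintro ⟨⟨h1, h2⟩, rfl⟩; exact ⟨⟨h1, rfl⟩, h2⟩
    · rintro ⟨⟨h1, rfl⟩, h2⟩; exact ⟨⟨h1, h2⟩, rfl⟩
  -- Paths are integer-valued and right-continuous, so their values at the rounded times are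
  -- eventually equal to those at the true times, and the indicators converge pointwise.
  refine tendsto_nhds_unique (tendsto_measure_of_tendsto_indicator_of_isFiniteMeasure atTop P
    (fun q => hGm.inter (hE q)) fun ω => ?_)
    ((tendsto_const_nhds (x := P G * ∏ c, ENNReal.ofReal (Real.exp (-(r c * x c))))).congr
      fun q => (hq q).symm)
  have h1 : ∀ c, ∀ᶠ q in atTop, B c (roundUp q (σ ω) + x c) ω = B c (σ ω + x c) ω := fun c =>
    (tendsto_comp_roundUp_add ((hB c).rightContinuous ω _)).eventually
      (p := fun n => n = B c (σ ω + x c) ω) (by simp [nhds_discrete])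
  have h2 : ∀ c, ∀ᶠ q in atTop, B c (roundUp q (σ ω)) ω = B c (σ ω) ω := fun c => by
    have := (tendsto_comp_roundUp_add (x := 0) ((hB c).rightContinuous ω (σ ω + 0))).eventually
      (p := fun n => n = B c (σ ω + 0) ω) (by simp [nhds_discrete])
    simpa using this
  filter_upwards [eventually_all.2 h1, eventually_all.2 h2] with q h3 h4
  simp only [mem_inter_iff, mem_ofPred_eq, h3, h4]

/-- After a stopping time, the times until the next jumps of independent Poisson counters are
independent exponential variables, independent of the past. -/
theorem measure_inter_waitingTimes (hB : ∀ c, IsPoissonCounter P (B c) (r c)) (hr : ∀ c, 0 < r c)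
    (hind : iIndepFun (fun c ω t => B c t ω) P) (h : IsStopTime P B σ) {G : Set Ω}
    (hG : MeasurableSet[pastOf h] G) {A : Set (ι → ℝ)} (hA : MeasurableSet A) :
    P (G ∩ waitingTimes B σ ⁻¹' A) = P G * Measure.pi (fun c => expMeasure (r c)) A := by
  have hXm : Measurable (waitingTimes B σ) :=
    (measurable_waitingTimes hB h).mono completionOf_le le_rfl
  have hGm : MeasurableSet G := pastOf_le h _ hG
  by_cases hG0 : P G = 0
  · rw [measure_mono_null inter_subset_left hG0, hG0, zero_mul]
  have hp : ∀ c, IsProbabilityMeasure (expMeasure (r c)) := fun c =>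
    isProbabilityMeasure_expMeasure (by exact_mod_cast hr c)
  -- Dividing by P(G) turns the claim into an identity for the conditional law given G, and products
  -- of half-lines form a π-system that determines this law.
  have key : Measure.pi (fun c => expMeasure (r c)) =
      (P G)⁻¹ • (P.restrict G).map (waitingTimes B σ) := by
    refine Measure.pi_eq_generateFrom (C := fun _ => range Ioi)
      (fun c => (borel_eq_generateFrom_Ioi ℝ).symm.trans (BorelSpace.measurable_eq).symm)
      (fun c => isPiSystem_Ioi)
      (fun c => ⟨fun n => Ioi (-(n : ℝ)), fun n => ⟨_, rfl⟩, fun n => measure_lt_top _ _, ?_⟩) ?_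
    · rw [eq_univ_iff_forall]
      intro x
      obtain ⟨n, hn⟩ := exists_nat_gt (-x)
      exact mem_iUnion.2 ⟨n, by rw [mem_Ioi]; linarith⟩
    · intro s hs
      choose x hx using hs
      obtain rfl : (fun c => Ioi (x c)) = s := funext hx
      have hsm : MeasurableSet (univ.pi fun c => Ioi (x c)) :=
        MeasurableSet.univ_pi fun c => measurableSet_Ioi
      rw [Measure.smul_apply, Measure.map_apply hXm hsm, Measure.restrict_apply (hXm hsm),
        smul_eq_mul, inter_comm]
      -- A waiting time exceeds x exactly when the counter is constant up to σ + x. For negative x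
      -- both conditions hold almost surely: waiting times are positive and `toNNReal` sends x to 0.
      have hev : (G ∩ waitingTimes B σ ⁻¹' univ.pi fun c => Ioi (x c) : Set Ω) =ᵐ[P]
          (G ∩ {ω | ∀ c, B c (σ ω + (x c).toNNReal) ω = B c (σ ω) ω} : Set Ω) := by
        refine (ae_eq_refl G).inter ?_
        have hub : ∀ᵐ ω ∂P, ∀ c, ∀ b : ℕ, ∃ t, b < B c t ω :=
          ae_all_iff.2 fun c => (hB c).ae_unbounded (hr c)
        refine eventuallyEq_set.2 ?_
        filter_upwards [hub] with ω hω
        simp only [mem_preimage, mem_univ_pi, mem_Ioi]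
        refine forall_congr' fun c => ?_
        have h1 := waitingTime_le_iff ((hB c).mono ω) ((hB c).rightContinuous ω) (hω c)
          (t := σ ω) (x := (x c).toNNReal)
        have h2 := waitingTime_le_iff ((hB c).mono ω) ((hB c).rightContinuous ω) (hω c)
          (t := σ ω) (x := 0)
        have h3 := (hB c).mono ω (le_self_add : σ ω ≤ σ ω + (x c).toNNReal)
        simp only [add_zero, lt_self_iff_false, iff_false, not_le] at h2
        rw [← not_iff_not, waitingTimes, not_lt]
        simp only at h1 h3
        trans waitingTime (fun t => B c t ω) (σ ω) ≤ (x c).toNNReal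
        · rcases le_total 0 (x c) with hx0 | hx0
          · rw [← NNReal.coe_le_coe, Real.coe_toNNReal _ hx0]
          · rw [Real.toNNReal_of_nonpos hx0]
            have h4 : (0 : ℝ) < waitingTime (fun t => B c t ω) (σ ω) := by exact_mod_cast h2
            exact ⟨fun h => absurd (h.trans hx0) (not_le.2 h4), fun h => absurd h (not_le.2 h2)⟩
        · rw [h1]; omega
      rw [measure_congr hev, measure_inter_constant_stopTime hB hind h _ hG, ← mul_assoc,
        ENNReal.inv_mul_cancel hG0 (measure_ne_top _ _), one_mul]
      exact Finset.prod_congr rfl fun c _ => (expMeasure_Ioi (hr c) (x c)).symm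
  rw [key, Measure.smul_apply, Measure.map_apply hXm hA, Measure.restrict_apply (hXm hA),
    smul_eq_mul, ← mul_assoc, ENNReal.mul_inv_cancel hG0 (measure_ne_top _ _), one_mul, inter_comm]

end StopTime

/-! ### Order statistics indexed by finite sets. -/

section OrderStat

variable {E : Type*} {A : Finset E} {k : ℕ} {x : E → ℝ} {t : ℝ}

/-- The `k`-th smallest of the values `x i` with `i ∈ A`. -/
noncomputable def orderStatOn (A : Finset E) (k : ℕ) (x : E → ℝ) : ℝ :=
  sInf {t : ℝ | k ≤ (A.filter fun i => x i ≤ t).card}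

theorem le_card_filter_iff : k ≤ (A.filter fun i => x i ≤ t).card ↔
    ∃ T ∈ A.powersetCard k, ∀ i ∈ T, x i ≤ t := by
  rw [Finset.le_card_iff_exists_subset_card]
  refine exists_congr fun T => ?_
  rw [Finset.mem_powersetCard]
  exact ⟨fun ⟨h, hc⟩ => ⟨⟨fun i hi => (Finset.mem_filter.1 (h hi)).1, hc⟩,
    fun i hi => (Finset.mem_filter.1 (h hi)).2⟩,
    fun ⟨⟨h, hc⟩, hx⟩ => ⟨fun i hi => Finset.mem_filter.2 ⟨h hi, hx i hi⟩, hc⟩⟩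

/-- The set of admissible levels is a finite union of closed half-lines, so its infimum is attained.
The condition `1 ≤ k` bounds the set below and `k ≤ A.card` makes it nonempty. -/
theorem orderStatOn_le_iff (hk : 1 ≤ k) (hkA : k ≤ A.card) :
    orderStatOn A k x ≤ t ↔ k ≤ (A.filter fun i => x i ≤ t).card := by
  have hne : {t : ℝ | k ≤ (A.filter fun i => x i ≤ t).card}.Nonempty := by
    obtain ⟨b, hb⟩ := (A.finite_toSet.image x).bddAbove
    refine ⟨b, ?_⟩
    rw [mem_ofPred_eq, Finset.filter_true_of_mem fun i hi => hb ⟨i, hi, rfl⟩]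
    exact hkA
  have hbd : BddBelow {t : ℝ | k ≤ (A.filter fun i => x i ≤ t).card} := by
    obtain ⟨b, hb⟩ := (A.finite_toSet.image x).bddBelow
    refine ⟨b, fun s hs => ?_⟩
    obtain ⟨i, hi⟩ := Finset.card_pos.1 (lt_of_lt_of_le hk hs)
    rw [Finset.mem_filter] at hi
    exact (hb ⟨i, hi.1, rfl⟩).trans hi.2
  have hcl : IsClosed {t : ℝ | k ≤ (A.filter fun i => x i ≤ t).card} := by
    have : {t : ℝ | k ≤ (A.filter fun i => x i ≤ t).card} =
        ⋃ T ∈ A.powersetCard k, ⋂ i ∈ T, Ici (x i) := by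
      ext t
      simp only [mem_ofPred_eq, le_card_filter_iff, mem_iUnion, mem_iInter, mem_Ici, exists_prop]
    rw [this]
    exact (A.powersetCard k).finite_toSet.isClosed_biUnion fun T _ =>
      isClosed_biInter fun i _ => isClosed_Ici
  refine ⟨fun h => ?_, fun h => csInf_le hbd h⟩
  refine (hcl.csInf_mem hne hbd).trans (Finset.card_le_card fun i hi => ?_)
  rw [Finset.mem_filter] at hi ⊢
  exact ⟨hi.1, hi.2.trans h⟩

theorem orderStatOn_of_card_lt (hkA : A.card < k) : orderStatOn A k x = 0 := by
  have : {t : ℝ | k ≤ (A.filter fun i => x i ≤ t).card} = ∅ := by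
    rw [Set.eq_empty_iff_forall_notMem]
    intro t ht
    exact absurd (ht.trans (Finset.card_filter_le _ _)) (not_le.2 hkA)
  rw [orderStatOn, this, Real.sInf_empty]

theorem orderStatOn_nonneg (hk : 1 ≤ k) (hx : ∀ i, 0 ≤ x i) : 0 ≤ orderStatOn A k x := by
  refine Real.sInf_nonneg fun t ht => ?_
  obtain ⟨i, hi⟩ := Finset.card_pos.1 (lt_of_lt_of_le hk ht)
  exact (hx i).trans (Finset.mem_filter.1 hi).2

theorem measurable_orderStatOn (hk : 1 ≤ k) : Measurable fun x : E → ℝ => orderStatOn A k x := by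
  rcases lt_or_ge A.card k with h | h
  · simp only [orderStatOn_of_card_lt h]
    exact measurable_const
  · refine measurable_of_Iic fun t => ?_
    have : (fun x : E → ℝ => orderStatOn A k x) ⁻¹' Iic t =
        ⋃ T ∈ A.powersetCard k, ⋂ i ∈ T, {x | x i ≤ t} := by
      ext x
      simp only [mem_preimage, mem_Iic, orderStatOn_le_iff hk h, le_card_filter_iff, mem_iUnion,
        mem_iInter, mem_ofPred_eq, exists_prop]
    rw [this]
    exact Finset.measurableSet_biUnion _ fun T _ => Finset.measurableSet_biInter _ fun i _ =>
      measurableSet_le (measurable_pi_apply i) measurable_const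

theorem orderStat_comp_eq_orderStatOn {N : ℕ} (e : Fin N ↪ E) (he : Finset.univ.map e = A) :
    orderStat k (fun a => x (e a)) = orderStatOn A k x := by
  rw [orderStat, orderStatOn]
  congr 1
  ext t
  rw [mem_ofPred_eq, mem_ofPred_eq, ← he, Finset.filter_map, Finset.card_map, Set.ncard_eq_toFinset_card']
  simp

end OrderStat

/-! ### Cycles of the source and what is known at their ends. -/

section Cycles

/-- The `l`-th jump time of a counter path with unit jumps. -/
noncomputable def jumpTime (f : ℝ≥0 → ℕ) : ℕ → ℝ≥0
  | 0 => 0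
  | l + 1 => jumpTime f l + waitingTime f (jumpTime f l)

variable {Ω : Type*} {m0 : MeasurableSpace Ω} {P : Measure Ω} {E : Type*}
  {B : Option E → ℝ≥0 → Ω → ℕ} {r : Option E → ℝ≥0}

/-- The start of the `l`-th cycle, that is, the `l`-th jump time of the source. -/
noncomputable def cycleStart (B : Option E → ℝ≥0 → Ω → ℕ) (l : ℕ) (ω : Ω) : ℝ≥0 :=
  jumpTime (fun t => B none t ω) l

theorem cycleStart_succ (l : ℕ) (ω : Ω) :
    (cycleStart B (l + 1) ω : ℝ) = cycleStart B l ω + waitingTimes B (cycleStart B l) ω none := by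
  simp [cycleStart, jumpTime, waitingTimes]

theorem isStopTime_cycleStart (hB : ∀ c, IsPoissonCounter P (B c) (r c)) (hr : ∀ c, 0 < r c)
    (l : ℕ) : IsStopTime P B (cycleStart B l) := by
  induction l with
  | zero =>
    intro d
    have : {ω | cycleStart B 0 ω ≤ d} = univ := by ext; simp [cycleStart, jumpTime]
    rw [this]
    exact @MeasurableSet.univ _ (_)
  | succ l ih => exact ih.add_waitingTime hB hr none

/-- The time from the beginning of a cycle until the `k`-th activation of an edge in `A`, where `x`
lists the waiting times. -/
noncomputable def delay (A : Finset E) (k : ℕ) (x : Option E → ℝ) : ℝ :=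
  orderStatOn A k fun i => x (some i)

theorem measurable_delay {A : Finset E} {k : ℕ} (hk : 1 ≤ k) :
    Measurable fun x : Option E → ℝ => delay A k x :=
  (measurable_orderStatOn hk).comp (measurable_pi_lambda _ fun i => measurable_pi_apply (some i))

theorem waitingTimes_nonneg (σ : Ω → ℝ≥0) (ω : Ω) (c : Option E) : 0 ≤ waitingTimes B σ ω c :=
  NNReal.coe_nonneg _

theorem delay_waitingTimes_nonneg {A : Finset E} {k : ℕ} (hk : 1 ≤ k) (σ : Ω → ℝ≥0) (ω : Ω) :
    0 ≤ delay A k (waitingTimes B σ ω) :=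
  orderStatOn_nonneg hk fun _ => NNReal.coe_nonneg _

/-- The k-th activation has occurred by time d exactly when some k edges have all been activated by
d, which is a finite combination of stopping time events. With too few edges the delay is 0 by
default. -/
theorem IsStopTime.add_delay (hB : ∀ c, IsPoissonCounter P (B c) (r c)) (hr : ∀ c, 0 < r c)
    {σ : Ω → ℝ≥0} (hσ : IsStopTime P B σ) (A : Finset E) {k : ℕ} (hk : 1 ≤ k) :
    IsStopTime P B fun ω => σ ω + (delay A k (waitingTimes B σ ω)).toNNReal := by
  rcases lt_or_ge A.card k with h | h
  · simpa only [delay, orderStatOn_of_card_lt h, Real.toNNReal_zero, add_zero] using hσ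
  · intro d
    have : {ω | σ ω + (delay A k (waitingTimes B σ ω)).toNNReal ≤ d} =
        ⋃ T ∈ A.powersetCard k, ⋂ i ∈ T,
          {ω | σ ω + waitingTime (fun t => B (some i) t ω) (σ ω) ≤ d} := by
      ext ω
      have h1 : σ ω + (delay A k (waitingTimes B σ ω)).toNNReal ≤ d ↔
          delay A k (waitingTimes B σ ω) ≤ (d : ℝ) - σ ω := by
        rw [← NNReal.coe_le_coe, NNReal.coe_add,
          Real.coe_toNNReal _ (delay_waitingTimes_nonneg hk σ ω), add_comm, le_sub_iff_add_le]
      simp only [mem_iUnion, mem_iInter, mem_ofPred_eq, exists_prop]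
      rw [h1, delay, orderStatOn_le_iff hk h, le_card_filter_iff]
      refine exists_congr fun T => and_congr_right fun _ => forall₂_congr fun i _ => ?_
      rw [waitingTimes, ← NNReal.coe_le_coe, NNReal.coe_add, le_sub_iff_add_le, add_comm]
    rw [this]
    exact Finset.measurableSet_biUnion _ fun T _ => Finset.measurableSet_biInter _ fun i _ =>
      hσ.add_waitingTime hB hr (some i) d

/-- The part of a cycle before the decryption, where `x` lists the waiting times. -/
noncomputable def timeBefore (A : Finset E) (k : ℕ) (x : Option E → ℝ) : ℝ :=
  min (delay A k x) (x none)

theorem measurable_timeBefore {A : Finset E} {k : ℕ} (hk : 1 ≤ k) :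
    Measurable fun x : Option E → ℝ => timeBefore A k x :=
  (measurable_delay hk).min (measurable_pi_apply none)

theorem measurable_waitingTimes_none_past (hB : ∀ c, IsPoissonCounter P (B c) (r c))
    (hr : ∀ c, 0 < r c) (l : ℕ) :
    Measurable[pastOf (isStopTime_cycleStart hB hr (l + 1))]
      fun ω => waitingTimes B (cycleStart B l) ω none := by
  have h1 := (isStopTime_cycleStart hB hr (l + 1)).measurable_pastOf
  have h2 := (isStopTime_cycleStart hB hr l).measurable_pastOf.mono
    (pastOf_mono _ (isStopTime_cycleStart hB hr (l + 1)) fun ω => le_self_add) le_rfl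
  have h3 := h1.coe_nnreal_real.sub h2.coe_nnreal_real
  convert h3 using 1
  funext ω
  rw [Pi.sub_apply, cycleStart_succ]
  ring

/-- The delay itself may run past the end of the cycle, where it is not yet known. Its truncation is
the minimum of two stopping times minus the start of the cycle. -/
theorem measurable_timeBefore_past (hB : ∀ c, IsPoissonCounter P (B c) (r c)) (hr : ∀ c, 0 < r c)
    (l : ℕ) (A : Finset E) {k : ℕ} (hk : 1 ≤ k) :
    Measurable[pastOf (isStopTime_cycleStart hB hr (l + 1))]
      fun ω => timeBefore A k (waitingTimes B (cycleStart B l) ω) := by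
  have h1 := (isStopTime_cycleStart hB hr (l + 1)).measurable_min
    ((isStopTime_cycleStart hB hr l).add_delay hB hr A hk)
  have h2 := (isStopTime_cycleStart hB hr l).measurable_pastOf.mono
    (pastOf_mono _ (isStopTime_cycleStart hB hr (l + 1)) fun ω => le_self_add) le_rfl
  have h3 := h1.coe_nnreal_real.sub h2.coe_nnreal_real
  convert h3 using 1
  funext ω
  rw [Pi.sub_apply, NNReal.coe_min, cycleStart_succ, NNReal.coe_add,
    Real.coe_toNNReal _ (delay_waitingTimes_nonneg hk _ ω), min_add_add_left, timeBefore]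
  ring

/-- The delay is less than the length of the cycle exactly when the truncated delay is, and both
truncated delay and length are known at the end. -/
theorem measurableSet_delay_lt_past (hB : ∀ c, IsPoissonCounter P (B c) (r c)) (hr : ∀ c, 0 < r c)
    (l : ℕ) (A : Finset E) {k : ℕ} (hk : 1 ≤ k) :
    MeasurableSet[pastOf (isStopTime_cycleStart hB hr (l + 1))]
      {ω | delay A k (waitingTimes B (cycleStart B l) ω) <
        waitingTimes B (cycleStart B l) ω none} := by
  have h := @measurableSet_lt _ _ _ _ _ (_) _ _ _ _ _ (measurable_timeBefore_past hB hr l A hk)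
    (measurable_waitingTimes_none_past hB hr l)
  convert h using 1
  ext ω
  simp [timeBefore]

end Cycles

/-! ### Joining independent σ-algebras. -/

section IndepSup

theorem generateFrom_image2_inter {Ω : Type*} (a c : MeasurableSpace Ω) :
    MeasurableSpace.generateFrom
      (image2 (· ∩ ·) {s | MeasurableSet[a] s} {s | MeasurableSet[c] s}) = a ⊔ c := by
  refine le_antisymm (MeasurableSpace.generateFrom_le ?_) (sup_le ?_ ?_)
  · rintro _ ⟨s, hs, t, ht, rfl⟩
    exact MeasurableSet.inter (le_sup_left (a := a) (b := c) _ hs)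
      (le_sup_right (a := a) (b := c) _ ht)
  · intro s hs
    exact MeasurableSpace.measurableSet_generateFrom
      ⟨s, hs, univ, @MeasurableSet.univ _ c, inter_univ s⟩
  · intro s hs
    exact MeasurableSpace.measurableSet_generateFrom
      ⟨univ, @MeasurableSet.univ _ a, s, hs, univ_inter s⟩

theorem isPiSystem_image2_inter {Ω : Type*} (a c : MeasurableSpace Ω) :
    IsPiSystem (image2 (· ∩ ·) {s | MeasurableSet[a] s} {s | MeasurableSet[c] s}) := by
  rintro _ ⟨s, hs, t, ht, rfl⟩ _ ⟨s', hs', t', ht', rfl⟩ -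
  exact ⟨s ∩ s', @MeasurableSet.inter _ a _ _ hs hs', t ∩ t', @MeasurableSet.inter _ c _ _ ht ht',
    inter_inter_inter_comm _ _ _ _⟩

/-- Independence of joins, for pairs of independent σ-algebras that are independent of each other. -/
theorem Indep.sup_sup {Ω : Type*} {m0 : MeasurableSpace Ω} {P : Measure Ω} [IsProbabilityMeasure P]
    {a b c d : MeasurableSpace Ω} (ha : a ≤ m0) (hb : b ≤ m0) (hc : c ≤ m0) (hd : d ≤ m0)
    (hab : Indep a b P) (hcd : Indep c d P) (h : Indep (a ⊔ b) (c ⊔ d) P) :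
    Indep (a ⊔ c) (b ⊔ d) P := by
  refine IndepSets.indep (sup_le ha hc) (sup_le hb hd) (isPiSystem_image2_inter a c)
    (isPiSystem_image2_inter b d) (generateFrom_image2_inter a c).symm
    (generateFrom_image2_inter b d).symm ?_
  rw [IndepSets_iff]
  rw [Indep_iff] at hab hcd h
  rintro _ _ ⟨A, hA, C, hC, rfl⟩ ⟨B, hB, D, hD, rfl⟩
  have hA' := le_sup_left (a := a) (b := b) _ hA
  have hB' := le_sup_right (a := a) (b := b) _ hB
  have hC' := le_sup_left (a := c) (b := d) _ hC
  have hD' := le_sup_right (a := c) (b := d) _ hD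
  rw [inter_inter_inter_comm, h _ _ (@MeasurableSet.inter _ (_) _ _ hA' hB')
    (@MeasurableSet.inter _ (_) _ _ hC' hD'), hab _ _ hA hB, hcd _ _ hC hD, h _ _ hA' hC',
    h _ _ hB' hD']
  ring

end IndepSup

theorem integrable_sq_expMeasure {a : ℝ} (ha : 0 < a) :
    Integrable (fun x : ℝ => x ^ 2) (expMeasure a) := by
  have hm : Measurable (exponentialPDF a) := (measurable_exponentialPDFReal a).ennreal_ofReal
  have h : expMeasure a = volume.withDensity (exponentialPDF a) := rfl
  rw [h, integrable_withDensity_iff hm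
    (Eventually.of_forall fun x => ENNReal.ofReal_lt_top)]
  have h1 : (fun x : ℝ => x ^ 2 * (exponentialPDF a x).toReal) =
      (Ici 0).indicator fun x => a * (x ^ (2 : ℝ) * Real.exp (-a * x)) := by
    funext x
    by_cases hx : 0 ≤ x
    · rw [exponentialPDF_of_nonneg hx, ENNReal.toReal_ofReal (by positivity),
        indicator_of_mem (mem_Ici.2 hx), Real.rpow_two]
      rw [neg_mul]; ring
    · rw [exponentialPDF_of_neg (not_le.1 hx), indicator_of_notMem (by simpa using hx)]
      simp
  rw [h1, integrable_indicator_iff measurableSet_Ici, integrableOn_Ici_iff_integrableOn_Ioi]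
  have h2 := integrableOn_rpow_mul_exp_neg_mul_rpow (p := 1) (s := 2) (b := a) (by norm_num)
    one_pos ha
  simp only [Real.rpow_one] at h2
  exact Integrable.const_mul h2 a

theorem measurable_uncurry_of_forall {α β γ : Type*} [MeasurableSpace α] [MeasurableSpace β]
    [MeasurableSpace γ] [Countable α] [MeasurableSingletonClass α] {g : α → β → γ}
    (h : ∀ a, Measurable (g a)) : Measurable fun p : α × β => g p.1 p.2 :=
  measurable_from_prod_countable_right h

/-! ### Identically distributed cycles independent of the past. -/

section CycleLaw

variable {Ω : Type*} {m0 : MeasurableSpace Ω} {P : Measure Ω} [IsProbabilityMeasure P] {E : Type*}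
  {B : Option E → ℝ≥0 → Ω → ℕ} {r : Option E → ℝ≥0}
  {𝓜 : Type*} [MeasurableSpace 𝓜] {M : ℕ → Ω → 𝓜}

/-- The filtration of the cycles: the paths of the counters up to the beginning of a cycle, and the
selections made before. -/
noncomputable def cyclePast (hB : ∀ c, IsPoissonCounter P (B c) (r c)) (hr : ∀ c, 0 < r c)
    (hM : ∀ l, Measurable (M l)) : Filtration ℕ m0 where
  seq l := pastOf (isStopTime_cycleStart hB hr l) ⊔
    ⨆ i ∈ Iio l, MeasurableSpace.comap (M i) inferInstance
  mono' l l' hl := by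
    refine sup_le_sup (pastOf_mono _ _ fun ω => ?_) (biSup_mono fun i hi => lt_of_lt_of_le hi hl)
    exact monotone_nat_of_le_succ (f := fun l => cycleStart B l ω) (fun l => le_self_add) hl
  le' l := sup_le (pastOf_le _) (iSup₂_le fun i _ => (hM i).comap_le)

/-- The source's selection and the waiting times of a cycle. -/
noncomputable def cycleData (B : Option E → ℝ≥0 → Ω → ℕ) (M : ℕ → Ω → 𝓜) (l : ℕ) (ω : Ω) :
    𝓜 × (Option E → ℝ) :=
  (M l ω, waitingTimes B (cycleStart B l) ω)

omit [IsProbabilityMeasure P] in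
theorem measurable_cycleData (hB : ∀ c, IsPoissonCounter P (B c) (r c)) (hr : ∀ c, 0 < r c)
    (hM : ∀ l, Measurable (M l)) (l : ℕ) : Measurable (cycleData B M l) :=
  (hM l).prodMk ((measurable_waitingTimes hB (isStopTime_cycleStart hB hr l)).mono
    completionOf_le le_rfl)

omit [IsProbabilityMeasure P] in
theorem indep_history_selection (hMB : IndepFun (fun ω l => M l ω) (fun ω c t => B c t ω) P) :
    Indep (completionOf P (history B))
      (MeasurableSpace.comap (fun ω l => M l ω) inferInstance) P :=
  indep_completionOf_left hMB.symm

theorem comap_selection_le (l : ℕ) : MeasurableSpace.comap (M l) inferInstance ≤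
    MeasurableSpace.comap (fun ω l => M l ω) inferInstance := by
  rw [← measurable_iff_comap_le]
  exact (measurable_pi_apply l).comp (comap_measurable (fun ω l => M l ω))

variable [Fintype E]

theorem indep_waitingTimes_past (hB : ∀ c, IsPoissonCounter P (B c) (r c)) (hr : ∀ c, 0 < r c)
    (hind : iIndepFun (fun c ω t => B c t ω) P) (l : ℕ) :
    Indep (MeasurableSpace.comap (waitingTimes B (cycleStart B l)) inferInstance)
      (pastOf (isStopTime_cycleStart hB hr l)) P := by
  have hp : ∀ c, IsProbabilityMeasure (expMeasure (r c)) := fun c =>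
    isProbabilityMeasure_expMeasure (by exact_mod_cast hr c)
  rw [Indep_iff]
  rintro _ G ⟨A, hA, rfl⟩ hG
  have h1 := measure_inter_waitingTimes hB hr hind (isStopTime_cycleStart hB hr l)
    (@MeasurableSet.univ _ (_)) hA
  rw [univ_inter, measure_univ, one_mul] at h1
  rw [inter_comm, measure_inter_waitingTimes hB hr hind _ hG hA, h1, mul_comm]

theorem map_waitingTimes (hB : ∀ c, IsPoissonCounter P (B c) (r c)) (hr : ∀ c, 0 < r c)
    (hind : iIndepFun (fun c ω t => B c t ω) P) (l : ℕ) :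
    P.map (waitingTimes B (cycleStart B l)) = Measure.pi fun c => expMeasure (r c) := by
  ext A hA
  have h1 := measure_inter_waitingTimes hB hr hind (isStopTime_cycleStart hB hr l)
    (@MeasurableSet.univ _ (_)) hA
  rw [univ_inter, measure_univ, one_mul] at h1
  rw [Measure.map_apply ((measurable_waitingTimes hB (isStopTime_cycleStart hB hr l)).mono
    completionOf_le le_rfl) hA, h1]

/-- There are two separate independences, of waiting times from the past of the counters and of the
selection from earlier selections. Since all selections together are independent of the counters,
`Indep.sup_sup` regroups them into new data versus past. -/
theorem indep_cycleData_past (hB : ∀ c, IsPoissonCounter P (B c) (r c)) (hr : ∀ c, 0 < r c)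
    (hind : iIndepFun (fun c ω t => B c t ω) P) (hM : ∀ l, Measurable (M l))
    (hMind : iIndepFun M P) (hMB : IndepFun (fun ω l => M l ω) (fun ω c t => B c t ω) P) (l : ℕ) :
    Indep (MeasurableSpace.comap (cycleData B M l) inferInstance) (cyclePast hB hr hM l) P := by
  have hX := measurable_waitingTimes hB (isStopTime_cycleStart hB hr l)
  have h1 : MeasurableSpace.comap (cycleData B M l) inferInstance =
      MeasurableSpace.comap (waitingTimes B (cycleStart B l)) inferInstance ⊔
        MeasurableSpace.comap (M l) inferInstance := by
    rw [sup_comm]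
    exact MeasurableSpace.comap_prodMk _ _
  rw [h1]
  refine Indep.sup_sup (hX.comap_le.trans completionOf_le) (pastOf_le _) (hM l).comap_le
    (iSup₂_le fun i _ => (hM i).comap_le) (indep_waitingTimes_past hB hr hind l) ?_ ?_
  · have := indep_iSup_of_disjoint (fun i => (hM i).comap_le) hMind
      (S := {l}) (T := Iio l) (by simp)
    simpa using this
  · refine indep_of_indep_of_le_left (indep_of_indep_of_le_right
      (indep_history_selection hMB) ?_) ?_
    · exact sup_le (comap_selection_le l) (iSup₂_le fun i _ => comap_selection_le i)
    · exact sup_le hX.comap_le (pastOf_le_history _)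

theorem map_cycleData (hB : ∀ c, IsPoissonCounter P (B c) (r c)) (hr : ∀ c, 0 < r c)
    (hind : iIndepFun (fun c ω t => B c t ω) P) (hM : ∀ l, Measurable (M l))
    (hMB : IndepFun (fun ω l => M l ω) (fun ω c t => B c t ω) P) (l : ℕ) :
    P.map (cycleData B M l) = (P.map (M l)).prod (Measure.pi fun c => expMeasure (r c)) := by
  have hX := measurable_waitingTimes hB (isStopTime_cycleStart hB hr l)
  rw [← map_waitingTimes hB hr hind l]
  refine (indepFun_iff_map_prod_eq_prod_map_map (hM l).aemeasurable
    (hX.mono completionOf_le le_rfl).aemeasurable).1 ?_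
  exact (indep_of_indep_of_le_left (indep_of_indep_of_le_right (indep_history_selection hMB)
    (comap_selection_le l)) hX.comap_le).symm

variable [Countable 𝓜] [MeasurableSingletonClass 𝓜] {A : 𝓜 → Finset E} {k : 𝓜 → ℕ}

/-- The outcomes of a cycle with decryption. -/
def decryptSet (A : 𝓜 → Finset E) (k : 𝓜 → ℕ) : Set (𝓜 × (Option E → ℝ)) :=
  {p | delay (A p.1) (k p.1) p.2 < p.2 none}

omit [Fintype E] in
theorem measurableSet_decryptSet (hk : ∀ a, 1 ≤ k a) : MeasurableSet (decryptSet A k) :=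
  measurableSet_lt (measurable_uncurry_of_forall (g := fun a x => delay (A a) (k a) x)
    fun a => measurable_delay (hk a))
    ((measurable_pi_apply none).comp measurable_snd)

omit [Fintype E] in
theorem measurable_timeBefore_prod (hk : ∀ a, 1 ≤ k a) :
    Measurable fun p : 𝓜 × (Option E → ℝ) => timeBefore (A p.1) (k p.1) p.2 :=
  measurable_uncurry_of_forall (g := fun a x => timeBefore (A a) (k a) x)
    fun a => measurable_timeBefore (hk a)

omit [IsProbabilityMeasure P] [Fintype E] in
theorem measurable_cyclePast_of_forall (hB : ∀ c, IsPoissonCounter P (B c) (r c))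
    (hr : ∀ c, 0 < r c) (hM : ∀ l, Measurable (M l)) (l : ℕ) {f : 𝓜 → Ω → ℝ}
    (hf : ∀ a, Measurable[pastOf (isStopTime_cycleStart hB hr (l + 1))] (f a)) :
    Measurable[cyclePast hB hr hM (l + 1)] fun ω => f (M l ω) ω := by
  have h1 : Measurable[cyclePast hB hr hM (l + 1)] (M l) :=
    Measurable.of_comap_le (le_sup_of_le_right
      (le_iSup₂_of_le (f := fun i (_ : i ∈ Iio (l + 1)) => MeasurableSpace.comap (M i) inferInstance)
        l (Nat.lt_succ_self l) le_rfl))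
  have h2 : ∀ a, Measurable[cyclePast hB hr hM (l + 1)] (f a) := fun a =>
    (hf a).mono le_sup_left le_rfl
  exact (@measurable_uncurry_of_forall _ _ _ _ (cyclePast hB hr hM (l + 1)) _ _ _ f h2).comp (h1.prodMk (@measurable_id _ (_)))

/-- The averages over the cycles of the lengths of the cycles, and of the times before decryption
weighted with the number of cycles since the last decryption. -/
theorem ae_tendsto_cycle_averages (hB : ∀ c, IsPoissonCounter P (B c) (r c)) (hr : ∀ c, 0 < r c)
    (hind : iIndepFun (fun c ω t => B c t ω) P) (hM : ∀ l, Measurable (M l))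
    (hMind : iIndepFun M P) (hMB : IndepFun (fun ω l => M l ω) (fun ω c t => B c t ω) P)
    (hk : ∀ a, 1 ≤ k a) {ν : Measure 𝓜} (hν : ∀ l, P.map (M l) = ν)
    (hp : 0 < (ν.prod (Measure.pi fun c => expMeasure (r c))).real (decryptSet A k)) :
    ∀ᵐ ω ∂P,
      Tendsto (fun L : ℕ => (L : ℝ)⁻¹ * ∑ l ∈ Finset.range L,
        runLength (fun l => cycleData B M l ⁻¹' decryptSet A k) l ω *
          timeBefore (A (M l ω)) (k (M l ω)) (waitingTimes B (cycleStart B l) ω)) atTop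
        (𝓝 ((∫ p, timeBefore (A p.1) (k p.1) p.2 ∂ν.prod (Measure.pi fun c => expMeasure (r c))) /
          (ν.prod (Measure.pi fun c => expMeasure (r c))).real (decryptSet A k))) ∧
      Tendsto (fun L : ℕ => (L : ℝ)⁻¹ * ∑ l ∈ Finset.range L,
        waitingTimes B (cycleStart B l) ω none) atTop (𝓝 (∫ x, x ∂expMeasure (r none))) := by
  have hpr : ∀ c, IsProbabilityMeasure (expMeasure (r c)) := fun c =>
    isProbabilityMeasure_expMeasure (by exact_mod_cast hr c)
  set μ := Measure.pi fun c => expMeasure (r c) with hμ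
  have hdata : ∀ l, P.map (cycleData B M l) = ν.prod μ := fun l => by
    rw [map_cycleData hB hr hind hM hMB l, hν]
  have hdm := measurable_cycleData (M := M) hB hr hM
  have hdind := indep_cycleData_past hB hr hind hM hMind hMB
  have hUlaw : ∀ l, P.map (fun ω => waitingTimes B (cycleStart B l) ω none) =
      expMeasure (r none) := by
    intro l
    have h1 : (fun ω => waitingTimes B (cycleStart B l) ω none) =
        Function.eval none ∘ waitingTimes B (cycleStart B l) := rfl
    rw [h1, ← Measure.map_map (measurable_pi_apply none)
      (f := waitingTimes B (cycleStart B l)) (measurable_snd.comp (hdm l)), map_waitingTimes hB hr hind l]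
    exact (measurePreserving_eval (fun c => expMeasure (r c)) none).map_eq
  have hUpast := measurable_waitingTimes_none_past hB hr
  have hUm : ∀ l, Measurable fun ω => waitingTimes B (cycleStart B l) ω none := fun l =>
    (hUpast l).mono (pastOf_le _) le_rfl
  have hUsq : ∀ l, Integrable (fun ω => waitingTimes B (cycleStart B l) ω none ^ 2) P := by
    intro l
    have h1 := integrable_sq_expMeasure (a := r none) (by exact_mod_cast hr none)
    rw [← hUlaw l] at h1
    exact h1.comp_measurable (hUm l)
  have hU2 : ∀ l, MemLp (fun ω => waitingTimes B (cycleStart B l) ω none) 2 P := fun l =>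
    (memLp_two_iff_integrable_sq (hUm l).aestronglyMeasurable).2 (hUsq l)
  have hUsqi : ∀ l, ∫ ω, waitingTimes B (cycleStart B l) ω none ^ 2 ∂P =
      ∫ x, x ^ 2 ∂expMeasure (r none) := by
    intro l
    rw [← hUlaw l, integral_map (hUm l).aemeasurable (by fun_prop)]
  have hWm := measurable_timeBefore_prod (A := A) hk
  have hWm' : ∀ l, Measurable fun ω =>
      timeBefore (A (M l ω)) (k (M l ω)) (waitingTimes B (cycleStart B l) ω) := fun l =>
    hWm.comp (hdm l)
  have hWU : ∀ l ω, |timeBefore (A (M l ω)) (k (M l ω)) (waitingTimes B (cycleStart B l) ω)| ≤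
      waitingTimes B (cycleStart B l) ω none := by
    intro l ω
    rw [timeBefore, abs_of_nonneg (le_min (delay_waitingTimes_nonneg (hk _) _ _) (waitingTimes_nonneg _ _ _))]
    exact min_le_right _ _
  have hW2 : ∀ l, MemLp (fun ω =>
      timeBefore (A (M l ω)) (k (M l ω)) (waitingTimes B (cycleStart B l) ω)) 2 P := fun l =>
    (hU2 l).mono (hWm' l).aestronglyMeasurable (Eventually.of_forall fun ω => by
      rw [Real.norm_eq_abs, Real.norm_eq_abs]
      exact (hWU l ω).trans (le_abs_self _))
  have hle : ∀ (l : ℕ) {f : 𝓜 × (Option E → ℝ) → ℝ}, Measurable f →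
      Indep (MeasurableSpace.comap (fun ω => f (cycleData B M l ω)) inferInstance)
        (cyclePast hB hr hM l) P := fun l f hf => by
    refine indep_of_indep_of_le_left (hdind l) ?_
    rw [← measurable_iff_comap_le]
    exact hf.comp (comap_measurable _)
  have hDm := measurableSet_decryptSet (A := A) hk
  have hDpast : ∀ l, MeasurableSet[cyclePast hB hr hM (l + 1)]
      (cycleData B M l ⁻¹' decryptSet A k) := by
    intro l
    -- The selection takes countably many values; with it frozen at `a`, the event concerns the
    -- counters alone and is known at the end of the cycle. It is then read off as the set where an
    -- indicator equals 1.
    have h1 := measurable_cyclePast_of_forall hB hr hM l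
      (f := fun a => ({ω | delay (A a) (k a) (waitingTimes B (cycleStart B l) ω) <
        waitingTimes B (cycleStart B l) ω none} : Set Ω).indicator 1) fun a =>
      measurable_indicator_one_of_measurableSet
        (measurableSet_delay_lt_past hB hr l (A a) (hk a))
    have h2 := h1 (measurableSet_singleton (1 : ℝ))
    convert h2 using 1
    ext ω
    simp [decryptSet, cycleData, indicator_apply]
  have e1 := ae_tendsto_average_runLength_mul (cyclePast hB hr hM) hDpast
    (fun l => by
      have := hle l (f := (decryptSet A k).indicator 1)
        (measurable_indicator_one_of_measurableSet hDm)
      exact this) hp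
    (fun l => by rw [← hdata l, map_measureReal_apply (hdm l) hDm])
    (W := fun l ω => timeBefore (A (M l ω)) (k (M l ω)) (waitingTimes B (cycleStart B l) ω))
    (w := ∫ p, timeBefore (A p.1) (k p.1) p.2 ∂ν.prod μ)
    (b := ∫ x, x ^ 2 ∂expMeasure (r none))
    (fun l => measurable_cyclePast_of_forall hB hr hM l
      (f := fun a ω => timeBefore (A a) (k a) (waitingTimes B (cycleStart B l) ω)) fun a =>
      measurable_timeBefore_past hB hr l (A a) (hk a))
    (fun l => hle l hWm) hW2
    (fun l => by
      rw [← hdata l, integral_map (hdm l).aemeasurable hWm.aestronglyMeasurable]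
      rfl)
    (fun l => by
      rw [← hUsqi l]
      refine integral_mono (hW2 l).integrable_sq (hUsq l) fun ω => ?_
      exact sq_le_sq' (neg_le_of_abs_le (hWU l ω)) (le_of_abs_le (hWU l ω)))
  have e2 := ae_tendsto_average_of_indep_past (cyclePast hB hr hM)
    (Z := fun l ω => waitingTimes B (cycleStart B l) ω none)
    (z := ∫ x, x ∂expMeasure (r none)) (b := ∫ x, x ^ 2 ∂expMeasure (r none))
    (fun l => (hUpast l).mono le_sup_left le_rfl)
    (fun l => hle l (f := fun p => p.2 none) ((measurable_pi_apply none).comp measurable_snd)) hU2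
    (fun l => by
      rw [← hUlaw l, integral_map (hUm l).aemeasurable (by fun_prop)])
    (fun l => (hUsqi l).le)
    -- Constant weights reduce the weighted law to the ordinary strong law for the cycle lengths.
    (H := fun _ _ => 1) (a := 1) (fun l => measurable_const) (fun l => memLp_const 1)
    (fun l => by simp)
  filter_upwards [e1, e2] with ω h1 h2
  refine ⟨h1, ?_⟩
  have h3 := h2.add_const (∫ x, x ∂expMeasure (r none))
  rw [zero_add] at h3
  refine h3.congr' ?_
  filter_upwards [eventually_gt_atTop 0] with L hL
  have hL' : (L : ℝ) ≠ 0 := by positivity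
  simp only [one_mul, Finset.sum_sub_distrib, Finset.sum_const, Finset.card_range, nsmul_eq_mul]
  field_simp
  ring

end CycleLaw

/-! ### Expectations and probabilities for one cycle with a fixed selection. -/

theorem map_pi_comp_injective {ι κ : Type*} [Fintype ι] [Fintype κ] (μ : ι → Measure ℝ)
    [∀ i, IsProbabilityMeasure (μ i)] {g : κ → ι} (hg : Function.Injective g) :
    (Measure.pi μ).map (fun x a => x (g a)) = Measure.pi fun a => μ (g a) := by
  have h := (iIndepFun_pi (μ := μ) (X := fun _ x => x) fun i => aemeasurable_id).precomp hg
  rw [iIndepFun_iff_map_fun_eq_pi_map fun a => (measurable_pi_apply (g a)).aemeasurable] at h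
  rw [h]
  congr 1
  funext a
  exact (measurePreserving_eval μ (g a)).map_eq

theorem expMeasure_singleton (a x : ℝ) : expMeasure a {x} = 0 :=
  withDensity_absolutelyContinuous volume (gammaPDF 1 a) (measure_singleton x)

theorem integrable_id_expMeasure {a : ℝ} (ha : 0 < a) : Integrable id (expMeasure a) := by
  have h1 := isProbabilityMeasure_expMeasure ha
  have h2 : MemLp id 2 (expMeasure a) :=
    (memLp_two_iff_integrable_sq measurable_id.aestronglyMeasurable).2 (integrable_sq_expMeasure ha)
  exact h2.integrable one_le_two

theorem ae_nonneg_expMeasure (a : ℝ) : ∀ᵐ y ∂expMeasure a, 0 ≤ y := by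
  have h1 : expMeasure a = volume.withDensity (exponentialPDF a) := rfl
  have h2 : {y : ℝ | ¬ 0 ≤ y} = Iio 0 := by ext; simp
  rw [ae_iff, h1, withDensity_apply _ (by measurability), h2,
    lintegral_exponentialPDF_of_nonpos le_rfl]

theorem meanCycle_pos {b : ℝ≥0} (hb : 0 < b) : 0 < meanCycle b := by
  have hb' : (0 : ℝ) < b := by exact_mod_cast hb
  have h1 := isProbabilityMeasure_expMeasure hb'
  refine (integral_pos_iff_support_of_nonneg_ae (ae_nonneg_expMeasure _)
    (integrable_id_expMeasure hb')).2 ?_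
  have h2 : Function.support (fun u : ℝ => u) = {0}ᶜ := by ext; simp
  rw [h2, prob_compl_eq_one_sub (measurableSet_singleton _), expMeasure_singleton]
  simp

section Expectation

variable {E : Type*} [Fintype E] {a b : ℝ≥0}

/-- The rates of the source (`none`) and of the edges (`some i`). -/
noncomputable def cycleRate (a b : ℝ≥0) : Option E → ℝ≥0
  | none => b
  | some _ => a

/-- The law of the waiting times for the source (`none`) and for the edges (`some i`). -/
noncomputable def cycleLaw (E : Type*) [Fintype E] (a b : ℝ≥0) : Measure (Option E → ℝ) :=
  Measure.pi fun c => expMeasure (cycleRate a b c)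

omit [Fintype E] in
theorem isProbabilityMeasure_expMeasure_cycleRate (ha : 0 < a) (hb : 0 < b) (c : Option E) :
    IsProbabilityMeasure (expMeasure (cycleRate a b c)) := by
  cases c
  · exact isProbabilityMeasure_expMeasure (by exact_mod_cast hb)
  · exact isProbabilityMeasure_expMeasure (by exact_mod_cast ha)

theorem isProbabilityMeasure_cycleLaw (ha : 0 < a) (hb : 0 < b) :
    IsProbabilityMeasure (cycleLaw E a b) := by
  have := isProbabilityMeasure_expMeasure_cycleRate (E := E) ha hb
  rw [cycleLaw]
  infer_instance

theorem map_cycleLaw (ha : 0 < a) (hb : 0 < b) {N : ℕ} (e : Fin N ↪ E) :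
    (cycleLaw E a b).map (fun x => (fun i => x (some (e i)), x none)) = expLaw N a b := by
  have h1 := isProbabilityMeasure_expMeasure_cycleRate (E := E) ha hb
  have h2 := isProbabilityMeasure_expMeasure_cycleRate (E := Fin N) ha hb
  have hg : Function.Injective (Option.map e) := Option.map_injective e.injective
  have h3 := map_pi_comp_injective (fun c : Option E => expMeasure (cycleRate a b c)) hg
  have h4 : (fun c : Option (Fin N) => expMeasure (cycleRate a b (Option.map e c))) =
      fun c => expMeasure (cycleRate a b c) := by
    funext c; cases c <;> rfl
  have h5 : (fun x : Option E → ℝ => ((fun i => x (some (e i)), x none) : (Fin N → ℝ) × ℝ)) =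
      (MeasurableEquiv.piOptionEquivProd fun _ : Option (Fin N) => ℝ) ∘
        fun x c => x (Option.map e c) := rfl
  have h6 := Measure.pi_map_piOptionEquivProd fun c : Option (Fin N) => expMeasure (cycleRate a b c)
  have h7 : (cycleLaw E a b).map ((MeasurableEquiv.piOptionEquivProd fun _ : Option (Fin N) => ℝ) ∘
        fun x c => x (Option.map e c)) =
      ((cycleLaw E a b).map fun x c => x (Option.map e c)).map
        (MeasurableEquiv.piOptionEquivProd fun _ : Option (Fin N) => ℝ) :=
    (Measure.map_map (MeasurableEquiv.measurable _)
      (measurable_pi_lambda _ fun c => measurable_pi_apply _)).symm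
  rw [h5, h7, cycleLaw, h3, h4]
  have h8 := (MeasurableEquiv.map_apply_eq_iff_map_symm_apply_eq _).2 h6.symm
  exact h8

variable {A : Finset E} {k : ℕ}

omit [Fintype E] in
theorem exists_embedding_map_eq (A : Finset E) :
    ∃ e : Fin A.card ↪ E, Finset.univ.map e = A := by
  refine ⟨A.equivFin.symm.toEmbedding.trans (Function.Embedding.subtype _), ?_⟩
  ext i
  simp only [Finset.mem_map, Finset.mem_univ, true_and]
  constructor
  · rintro ⟨a, rfl⟩
    exact (A.equivFin.symm a).2
  · intro hi
    exact ⟨A.equivFin ⟨i, hi⟩, by simp⟩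

theorem measurable_orderStat {N : ℕ} (hk : 1 ≤ k) :
    Measurable fun y : Fin N → ℝ => orderStat k y := by
  have h : (fun y : Fin N → ℝ => orderStat k y) = fun y => orderStatOn Finset.univ k y := by
    funext y
    exact orderStat_comp_eq_orderStatOn (Function.Embedding.refl _) Finset.map_refl
  rw [h]
  exact measurable_orderStatOn hk

theorem integral_timeBefore (ha : 0 < a) (hb : 0 < b) (hk : 1 ≤ k) :
    ∫ x, timeBefore A k x ∂cycleLaw E a b = expectedMin k A.card a b := by
  obtain ⟨e, he⟩ := exists_embedding_map_eq A
  rw [expectedMin, ← map_cycleLaw ha hb e, integral_map (by fun_prop)]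
  · congr 1
    funext x
    rw [timeBefore, delay, ← orderStat_comp_eq_orderStatOn e he]
  · exact (((measurable_orderStat hk).comp measurable_fst).min
      measurable_snd).aestronglyMeasurable

theorem measureReal_delay_lt (ha : 0 < a) (hb : 0 < b) (hk : 1 ≤ k) :
    (cycleLaw E a b).real {x | delay A k x < x none} = probDecrypt k A.card a b := by
  have hp := isProbabilityMeasure_expMeasure (r := a) (by exact_mod_cast ha)
  have hp' := isProbabilityMeasure_expMeasure (r := b) (by exact_mod_cast hb)
  obtain ⟨e, he⟩ := exists_embedding_map_eq A
  have hO : Measurable fun y : (Fin A.card → ℝ) × ℝ => orderStat k y.1 :=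
    (measurable_orderStat hk).comp measurable_fst
  -- The cycle analysis produces a strict inequality, whereas `probDecrypt` has a weak one. Ties are
  -- null, because U has no atoms and is independent of the order statistic.
  have h0 : expLaw A.card a b {p | orderStat k p.1 = p.2} = 0 := by
    rw [expLaw, Measure.measure_prod_null (measurableSet_eq_fun hO measurable_snd)]
    refine Eventually.of_forall fun y => ?_
    have : Prod.mk y ⁻¹' {p : (Fin A.card → ℝ) × ℝ | orderStat k p.1 = p.2} = {orderStat k y} := by
      ext u; simp [eq_comm]
    change expMeasure (b : ℝ) (Prod.mk y ⁻¹' {p | orderStat k p.1 = p.2}) = 0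
    rw [this]
    exact expMeasure_singleton _ _
  have h1 : expLaw A.card a b {p | orderStat k p.1 ≤ p.2} =
      expLaw A.card a b {p | orderStat k p.1 < p.2} := by
    refine le_antisymm ?_ (measure_mono fun p (hp : orderStat k p.1 < p.2) => hp.le)
    calc _ ≤ expLaw A.card a b ({p | orderStat k p.1 < p.2} ∪ {p | orderStat k p.1 = p.2}) :=
          measure_mono fun p (hp : orderStat k p.1 ≤ p.2) => lt_or_eq_of_le hp
      _ ≤ _ := (measure_union_le _ _).trans (by rw [h0, add_zero])
  rw [probDecrypt, measureReal_def, measureReal_def, h1, ← map_cycleLaw ha hb e,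
    Measure.map_apply (by fun_prop) (measurableSet_lt hO measurable_snd)]
  congr 2
  ext x
  rw [mem_preimage, mem_ofPred_eq, mem_ofPred_eq, delay, ← orderStat_comp_eq_orderStatOn e he]

theorem integrable_none_cycleLaw (ha : 0 < a) (hb : 0 < b) :
    Integrable (fun x => x none) (cycleLaw E a b) := by
  have h1 := isProbabilityMeasure_expMeasure_cycleRate (E := E) ha hb
  have h2 : Integrable id (expMeasure (cycleRate a b (none : Option E))) :=
    integrable_id_expMeasure (by exact_mod_cast hb)
  exact (measurePreserving_eval (fun c : Option E => expMeasure (cycleRate a b c))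
    none).integrable_comp_of_integrable h2

theorem ae_nonneg_cycleLaw (ha : 0 < a) (hb : 0 < b) : ∀ᵐ x ∂cycleLaw E a b, ∀ c, 0 ≤ x c := by
  have h1 := isProbabilityMeasure_expMeasure_cycleRate (E := E) ha hb
  rw [ae_all_iff]
  intro c
  exact (measurePreserving_eval (fun c : Option E => expMeasure (cycleRate a b c))
    c).quasiMeasurePreserving.ae (ae_nonneg_expMeasure _)

/-- The event contains the box where every edge is activated by time 1 and the source updates after
time 1, and each side of this box has positive mass. -/
theorem measure_delay_lt_ne_zero (ha : 0 < a) (hb : 0 < b) (hk : 1 ≤ k) (hkA : k ≤ A.card) :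
    cycleLaw E a b {x | delay A k x < x none} ≠ 0 := by
  have h1 := isProbabilityMeasure_expMeasure_cycleRate (E := E) ha hb
  set s : Option E → Set ℝ := fun c => c.elim (Ioi 1) fun _ => Iic 1 with hs
  have h2 : univ.pi s ⊆ {x | delay A k x < x none} := by
    intro x hx
    have h3 : (1 : ℝ) < x none := hx none (mem_univ _)
    refine lt_of_le_of_lt ((orderStatOn_le_iff hk hkA).2 ?_) h3
    have h4 : ∀ i ∈ A, x (some i) ≤ 1 := fun i _ => hx (some i) (mem_univ _)
    rw [Finset.filter_true_of_mem h4]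
    exact hkA
  refine fun h => absurd (measure_mono_null h2 h) ?_
  rw [cycleLaw, Measure.pi_pi]
  refine Finset.prod_ne_zero_iff.2 ?_
  rintro (_ | i) -
  · change expMeasure (b : ℝ) (Ioi 1) ≠ 0
    rw [expMeasure_Ioi hb]
    simpa using Real.exp_pos _
  · change expMeasure (a : ℝ) (Iic 1) ≠ 0
    have hp := isProbabilityMeasure_expMeasure (r := a) (by exact_mod_cast ha)
    rw [← compl_Ioi, prob_compl_eq_one_sub measurableSet_Ioi, expMeasure_Ioi ha]
    have : (0 : ℝ) < a := by exact_mod_cast ha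
    simpa [tsub_eq_zero_iff_le] using this

end Expectation

/-! ### Averaging over the random selection. -/

section Mixture

variable {E : Type*} [Fintype E] {a b : ℝ≥0} {𝓜 : Type*} [MeasurableSpace 𝓜] [Countable 𝓜]
  [MeasurableSingletonClass 𝓜] {A : 𝓜 → Finset E} {k : 𝓜 → ℕ} {ν : Measure 𝓜}
  [IsProbabilityMeasure ν]

theorem integral_timeBefore_prod (ha : 0 < a) (hb : 0 < b) (hk : ∀ K, 1 ≤ k K) :
    ∫ p, timeBefore (A p.1) (k p.1) p.2 ∂ν.prod (cycleLaw E a b) =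
      ∫ K, expectedMin (k K) (A K).card a b ∂ν := by
  have hp := isProbabilityMeasure_cycleLaw (E := E) ha hb
  rw [integral_prod]
  · simp only [integral_timeBefore ha hb (hk _)]
  · have h1 : Integrable (fun p : 𝓜 × (Option E → ℝ) => p.2 none) (ν.prod (cycleLaw E a b)) :=
      (integrable_none_cycleLaw ha hb).comp_snd ν
    refine h1.mono (measurable_timeBefore_prod hk).aestronglyMeasurable ?_
    have h2 : ∀ᵐ p ∂ν.prod (cycleLaw E a b), ∀ c, 0 ≤ p.2 c :=
      (Measure.quasiMeasurePreserving_snd).ae (ae_nonneg_cycleLaw ha hb)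
    filter_upwards [h2] with p hp
    rw [Real.norm_eq_abs, Real.norm_eq_abs, abs_of_nonneg (hp none), timeBefore, delay,
      abs_of_nonneg (le_min (orderStatOn_nonneg (hk _) fun i => hp (some i)) (hp none))]
    exact min_le_right _ _

theorem measureReal_decryptSet (ha : 0 < a) (hb : 0 < b) (hk : ∀ K, 1 ≤ k K) :
    (ν.prod (cycleLaw E a b)).real (decryptSet A k) =
      ∫ K, probDecrypt (k K) (A K).card a b ∂ν := by
  have hp := isProbabilityMeasure_cycleLaw (E := E) ha hb
  have hD := measurableSet_decryptSet (A := A) hk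
  have hi : Integrable ((decryptSet A k).indicator (1 : 𝓜 × (Option E → ℝ) → ℝ))
    (ν.prod (cycleLaw E a b)) := (integrable_const (1 : ℝ)).indicator hD
  rw [← integral_indicator_one hD, integral_prod _ hi]
  congr 1
  funext K
  rw [← measureReal_delay_lt ha hb (hk K), ← integral_indicator_one
    (measurableSet_lt (measurable_delay (hk K)) (measurable_pi_apply none))]
  rfl

theorem measureReal_decryptSet_pos (ha : 0 < a) (hb : 0 < b) (hk : ∀ K, 1 ≤ k K)
    (hkA : ∀ᵐ K ∂ν, k K ≤ (A K).card) :
    0 < (ν.prod (cycleLaw E a b)).real (decryptSet A k) := by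
  have hp := isProbabilityMeasure_cycleLaw (E := E) ha hb
  rw [measureReal_def, ENNReal.toReal_pos_iff]
  refine ⟨pos_iff_ne_zero.2 fun h => ?_, measure_lt_top _ _⟩
  rw [Measure.measure_prod_null (measurableSet_decryptSet hk)] at h
  obtain ⟨K, h1, h2⟩ := (h.and hkA).exists
  exact measure_delay_lt_ne_zero ha hb (hk K) h2 h1

end Mixture

/-! ### Membership probability for a uniform subset. -/

section Selection

/-- The subsets that miss `j` are the q-subsets of `T` without `j`. With t + 1 elements in `T`,
their proportion is C(t, q)/C(t + 1, q) = (t + 1 - q)/(t + 1). -/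
theorem measureReal_uniformOn_mem {α : Type*} [Fintype α] [DecidableEq α] {T : Finset α} {q : ℕ}
    (hq : q ≤ T.card) {j : α} (hj : j ∈ T) :
    (uniformOn (↑(Finset.powersetCard q T) : Set (Finset α))).real {K | j ∈ K} =
      (q : ℝ) / T.card := by
  have hne : (Finset.powersetCard q T).Nonempty := Finset.powersetCard_nonempty.2 hq
  have hpr : IsProbabilityMeasure (uniformOn (↑(Finset.powersetCard q T) : Set (Finset α))) :=
    isProbabilityMeasure_uniformOn (Finset.finite_toSet _) (by simpa using hne)
  have h1 : {K : Finset α | j ∈ K} = (↑(Finset.univ.filter fun K : Finset α => j ∉ K) :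
      Set (Finset α))ᶜ := by ext; simp
  have h2 : Finset.powersetCard q T ∩ Finset.univ.filter (fun K : Finset α => j ∉ K) =
      Finset.powersetCard q (T.erase j) := by
    ext K
    simp only [Finset.mem_inter, Finset.mem_powersetCard, Finset.mem_filter, Finset.mem_univ,
      true_and, Finset.subset_erase]
    tauto
  rw [h1, probReal_compl_eq_one_sub MeasurableSet.of_discrete, measureReal_def,
    uniformOn_apply_finset, h2, Finset.card_powersetCard, Finset.card_powersetCard,
    Finset.card_erase_of_mem hj, ENNReal.toReal_div, ENNReal.toReal_natCast, ENNReal.toReal_natCast]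
  have hT : 0 < T.card := Finset.card_pos.2 ⟨j, hj⟩
  obtain ⟨t, ht⟩ : ∃ t, T.card = t + 1 := ⟨T.card - 1, by omega⟩
  rw [ht, Nat.add_sub_cancel]
  have h3 := Nat.choose_mul_succ_eq t q
  have h4 : (t.choose q : ℝ) * (t + 1) = (t + 1).choose q * (t + 1 - q) := by
    have : ((t + 1 - q : ℕ) : ℝ) = t + 1 - q := by rw [Nat.cast_sub (ht ▸ hq)]; push_cast; ring
    rw [← this]
    exact_mod_cast h3
  have h5 : ((t + 1).choose q : ℝ) ≠ 0 := by
    exact_mod_cast (Nat.choose_pos (ht ▸ hq)).ne'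
  push_cast
  have h6 : (t : ℝ) + 1 ≠ 0 := by positivity
  field_simp
  linarith

end Selection

/-! ### Deterministic analysis of paths. -/

section OrderStatOn

variable {E : Type*} {A : Finset E} {k : ℕ} {x : E → ℝ} {t u : ℝ}

/-- An edge brings its key when it is activated both by the current time and strictly before the
next update. Taking the largest value among the counted indices, which is attained, preserves the
strict bound. -/
theorem le_card_filter_le_and_lt_iff (hk : 1 ≤ k) (hkA : k ≤ A.card) :
    k ≤ (A.filter fun i => x i ≤ t ∧ x i < u).card ↔
      orderStatOn A k x ≤ t ∧ orderStatOn A k x < u := by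
  constructor
  · intro h
    obtain ⟨i, hi, hmax⟩ := Finset.exists_max_image _ x (Finset.card_pos.1 (hk.trans h))
    have hle : orderStatOn A k x ≤ x i := by
      rw [orderStatOn_le_iff hk hkA]
      refine h.trans (Finset.card_le_card fun e he => ?_)
      exact Finset.mem_filter.2 ⟨(Finset.mem_filter.1 he).1, hmax e he⟩
    obtain ⟨-, h1, h2⟩ := Finset.mem_filter.1 hi
    exact ⟨hle.trans h1, hle.trans_lt h2⟩
  · rintro ⟨h1, h2⟩
    refine ((orderStatOn_le_iff (x := x) hk hkA).1 le_rfl).trans (Finset.card_le_card fun e he => ?_)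
    obtain ⟨h3, h4⟩ := Finset.mem_filter.1 he
    exact Finset.mem_filter.2 ⟨h3, h4.trans h1, h4.trans_lt h2⟩

end OrderStatOn

/-- An unbounded path of a counter. -/
structure IsCounterPath (f : ℝ≥0 → ℕ) : Prop where
  zero : f 0 = 0
  mono : Monotone f
  rightContinuous : ∀ t, ContinuousWithinAt f (Ici t) t
  unbounded : ∀ b, ∃ t, b < f t

/-- The jumps of the path `f` have size `1`. -/
def HasUnitJumps (f : ℝ≥0 → ℕ) : Prop := ∀ u, 0 < u → ∃ s < u, f u ≤ f s + 1

namespace IsCounterPath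

variable {f g : ℝ≥0 → ℕ} {l : ℕ} {t : ℝ≥0}

theorem add_waitingTime_le_iff (hf : IsCounterPath f) {t u : ℝ≥0} :
    t + waitingTime f t ≤ u ↔ t ≤ u ∧ f t < f u :=
  _root_.add_waitingTime_le_iff hf.mono hf.rightContinuous hf.unbounded

theorem map_lt_map_add_waitingTime (hf : IsCounterPath f) (t : ℝ≥0) :
    f t < f (t + waitingTime f t) :=
  (hf.add_waitingTime_le_iff.1 le_rfl).2

theorem map_eq_of_lt_add_waitingTime (hf : IsCounterPath f) {v : ℝ≥0}
    (hv : v < t + waitingTime f t) : f v ≤ f t := by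
  rcases le_total v t with h | h
  · exact hf.mono h
  · by_contra hlt
    exact absurd (hf.add_waitingTime_le_iff.2 ⟨h, not_le.1 hlt⟩) (not_le.2 hv)

theorem isActivation_add_waitingTime (hf : IsCounterPath f) (t : ℝ≥0) :
    IsActivation f (t + waitingTime f t) := by
  have h := hf.map_lt_map_add_waitingTime t
  refine ⟨pos_iff_ne_zero.2 fun h0 => ?_, fun v hv => ?_⟩
  · rw [h0, hf.zero] at h
    exact absurd h (Nat.not_lt_zero _)
  · exact (hf.map_eq_of_lt_add_waitingTime hv).trans_lt h

theorem map_add_waitingTime (hf : IsCounterPath f) (hu : HasUnitJumps f) (t : ℝ≥0) :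
    f (t + waitingTime f t) = f t + 1 := by
  obtain ⟨s, hs, h⟩ := hu _ (hf.isActivation_add_waitingTime t).1
  have h1 := hf.map_eq_of_lt_add_waitingTime hs
  have h2 := hf.map_lt_map_add_waitingTime t
  omega

theorem map_jumpTime (hf : IsCounterPath f) (hu : HasUnitJumps f) (l : ℕ) :
    f (jumpTime f l) = l := by
  induction l with
  | zero => exact hf.zero
  | succ l ih => rw [jumpTime, hf.map_add_waitingTime hu, ih]

theorem jumpTime_le_iff (hf : IsCounterPath f) (hu : HasUnitJumps f) :
    jumpTime f l ≤ t ↔ l ≤ f t := by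
  induction l with
  | zero => simp [jumpTime]
  | succ l ih =>
    rw [jumpTime, hf.add_waitingTime_le_iff, ih, hf.map_jumpTime hu]
    omega

theorem jumpTime_le_and_lt_iff (hf : IsCounterPath f) (hu : HasUnitJumps f) :
    (jumpTime f l ≤ t ∧ t < jumpTime f (l + 1)) ↔ f t = l := by
  rw [← not_le, hf.jumpTime_le_iff hu, hf.jumpTime_le_iff hu]
  omega

theorem isActivation_jumpTime (hf : IsCounterPath f) (hl : l ≠ 0) :
    IsActivation f (jumpTime f l) := by
  obtain ⟨l, rfl⟩ := Nat.exists_eq_succ_of_ne_zero hl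
  exact hf.isActivation_add_waitingTime _

/-- A counter `g` without common jumps with `f` is activated while `f = l` if and only if its first
jump after the `l`-th jump of `f` precedes the next jump of `f`. -/
theorem exists_isActivation_iff (hf : IsCounterPath f) (hu : HasUnitJumps f)
    (hg : IsCounterPath g) (hfg : ∀ u, IsActivation f u → ¬ IsActivation g u) :
    (∃ u ≤ t, IsActivation g u ∧ f u = l) ↔
      jumpTime f l + waitingTime g (jumpTime f l) ≤ t ∧
        waitingTime g (jumpTime f l) < waitingTime f (jumpTime f l) := by
  constructor
  · rintro ⟨u, hut, hgu, hfu⟩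
    obtain ⟨h1, h2⟩ := (hf.jumpTime_le_and_lt_iff hu).2 hfu
    -- An activation exactly at the start of the cycle would not be seen by the waiting time. It is
    -- impossible: at l = 0 because activations are at positive times, otherwise because there are
    -- no common jumps.
    have hne : jumpTime f l ≠ u := by
      rintro rfl
      rcases eq_or_ne l 0 with rfl | hl
      · exact absurd hgu.1 (by simp [jumpTime])
      · exact hfg _ (hf.isActivation_jumpTime hl) hgu
    have h3 : jumpTime f l + waitingTime g (jumpTime f l) ≤ u :=
      hg.add_waitingTime_le_iff.2 ⟨h1, hgu.2 _ (lt_of_le_of_ne h1 hne)⟩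
    refine ⟨h3.trans hut, ?_⟩
    have h4 := h3.trans_lt h2
    rw [jumpTime] at h4
    exact (add_lt_add_iff_left _).1 h4
  · rintro ⟨h1, h2⟩
    refine ⟨_, h1, hg.isActivation_add_waitingTime _, ?_⟩
    rw [← hf.jumpTime_le_and_lt_iff hu, jumpTime]
    exact ⟨le_self_add, (add_lt_add_iff_left _).2 h2⟩

end IsCounterPath

section RunLength

/-- This identifies the recursion with the lag behind the last success. Version 0 counts as known in
any case, and the outcome of cycle 0 is immaterial because the count there is 0, so it becomes 1
either way. -/
theorem exists_runLength_eq {Ω : Type*} (D : ℕ → Set Ω) (l : ℕ) (ω : Ω) :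
    ∃ a : ℕ, runLength D l ω = l - a ∧ IsGreatest {i | i = 0 ∨ (i < l ∧ ω ∈ D i)} a := by
  induction l with
  | zero => exact ⟨0, by simp [runLength], by simp [IsGreatest, upperBounds]⟩
  | succ l ih =>
    by_cases hD : ω ∈ D l
    · refine ⟨l, by simp [runLength, hD], Or.inr ⟨Nat.lt_succ_self l, hD⟩, ?_⟩
      rintro i (rfl | ⟨hi, -⟩) <;> omega
    · obtain ⟨a, ha, hg⟩ := ih
      refine ⟨a, by simp [runLength, hD, ha]; ring, ?_⟩
      convert hg using 4 with i
      refine and_congr_left fun hi => ⟨fun h => ?_, fun h => h.trans (Nat.lt_succ_self l)⟩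
      rcases Nat.lt_succ_iff_lt_or_eq.1 h with h | rfl
      · exact h
      · exact absurd hi hD

end RunLength

/-! ### Decryption and age at one node, cycle by cycle. -/

section Network

variable {m : ℕ}

/-- The source counter and the counters of the edges into the node `j`. -/
def counterInto (j : Fin m) : Option {i : Fin m // i ≠ j} → Counter m
  | none => .source
  | some e => .edge e.1 j e.2

theorem counterInto_injective (j : Fin m) : Function.Injective (counterInto j) := by
  rintro (_ | a) (_ | b) h
  · rfl
  · simp [counterInto] at h
  · simp [counterInto] at h
  · simpa [counterInto, Subtype.ext_iff] using h

/-- The edges into `j` from the nodes in `K`. -/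
def edgesFrom (j : Fin m) (K : Finset (Fin m)) : Finset {i : Fin m // i ≠ j} :=
  Finset.univ.filter fun e => e.1 ∈ K

/-- The number of keys that `j` has to obtain from other nodes in order to decrypt. -/
def keysNeeded (j : Fin m) (k : ℕ) (K : Finset (Fin m)) : ℕ := if j ∈ K then k else k + 1

theorem card_edgesFrom (j : Fin m) (K : Finset (Fin m)) :
    (edgesFrom j K).card = if j ∈ K then K.card - 1 else K.card := by
  have h : (edgesFrom j K).map (Function.Embedding.subtype _) = K.erase j := by
    ext i
    simp only [edgesFrom, Finset.mem_map, Finset.mem_filter, Finset.mem_univ, true_and,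
      Function.Embedding.subtype_apply, Subtype.exists, Finset.mem_erase]
    exact ⟨fun ⟨a, ha, hK, e⟩ => e ▸ ⟨ha, hK⟩, fun ⟨ha, hK⟩ => ⟨i, ha, hK, rfl⟩⟩
  rw [← Finset.card_map, h, Finset.card_erase_eq_ite]

theorem one_le_keysNeeded {j : Fin m} {k : ℕ} (hk : 1 ≤ k) (K : Finset (Fin m)) :
    1 ≤ keysNeeded j k K := by
  rw [keysNeeded]; split_ifs <;> omega

theorem keysNeeded_le_card_edgesFrom {j : Fin m} {k : ℕ} {K : Finset (Fin m)}
    (hK : k + 1 ≤ K.card) : keysNeeded j k K ≤ (edgesFrom j K).card := by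
  rw [keysNeeded, card_edgesFrom]; split_ifs <;> omega

/-- The waiting times, from the generation of version `l`, for the next activation of the counters
that concern node `j`. -/
noncomputable def waitingInto (c : Counter m → ℝ≥0 → ℕ) (j : Fin m) (l : ℕ)
    (o : Option {i : Fin m // i ≠ j}) : ℝ :=
  waitingTime (c (counterInto j o)) (jumpTime (c .source) l)

/-- The time that `j` needs to decrypt version `l`, provided that version `l + 1` comes later. -/
noncomputable def decryptDelay (k : ℕ) (c : Counter m → ℝ≥0 → ℕ) (K : ℕ → Finset (Fin m)) (j : Fin m)
    (l : ℕ) : ℝ :=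
  delay (edgesFrom j (K l)) (keysNeeded j k (K l)) (waitingInto c j l)

/-- The conditions on the counter paths under which the evolution at `j` is described by cycles. -/
structure IsRegularInto (c : Counter m → ℝ≥0 → ℕ) (j : Fin m) : Prop where
  path : ∀ o, IsCounterPath (c (counterInto j o))
  unitJumps : HasUnitJumps (c .source)
  noCommonJumps : ∀ e u, IsActivation (c .source) u → ¬ IsActivation (c (counterInto j (some e))) u

variable {c : Counter m → ℝ≥0 → ℕ} {K : ℕ → Finset (Fin m)} {j : Fin m} {k l : ℕ} {t : ℝ≥0}

/-- The keys split into the own key, if any, and those from edges whose first activation after the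
generation of version `l` comes by `t` and before the next update. The own key lowers the required
count of edges by one, and that count is compared with the order statistic. -/
theorem le_ncard_keysObtained_iff (hc : IsRegularInto c j) (hk : 1 ≤ k) (hK : k + 1 ≤ (K l).card)
    (hl : l ≤ c .source t) :
    k + 1 ≤ (keysObtained c K j l t).ncard ↔
      decryptDelay k c K j l ≤ t - jumpTime (c .source) l ∧
        decryptDelay k c K j l < waitingInto c j l none := by
  have hs : IsCounterPath (c .source) := hc.path none
  have h1 : keysObtained c K j l t = ↑((K l).filter (· = j) ∪
      ((edgesFrom j (K l)).filter fun e =>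
        waitingInto c j l (some e) ≤ t - jumpTime (c .source) l ∧
          waitingInto c j l (some e) < waitingInto c j l none).map
        (Function.Embedding.subtype _)) := by
    ext i
    rw [Finset.coe_union, mem_union, Finset.mem_coe, Finset.mem_coe, Finset.mem_filter,
      Finset.mem_map]
    simp only [Finset.mem_filter, edgesFrom, Finset.mem_univ, true_and,
      Function.Embedding.subtype_apply, Subtype.exists, keysObtained, mem_ofPred_eq]
    have h2 (h : i ≠ j) := hs.exists_isActivation_iff hc.unitJumps (hc.path (some ⟨i, h⟩))
      (hc.noCommonJumps ⟨i, h⟩) (t := t) (l := l)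
    constructor
    · rintro ⟨hi, ⟨rfl, -⟩ | ⟨h, hu⟩⟩
      · exact Or.inl ⟨hi, rfl⟩
      · obtain ⟨h3, h4⟩ := (h2 h).1 hu
        refine Or.inr ⟨i, h, ⟨hi, ?_, NNReal.coe_lt_coe.2 h4⟩, rfl⟩
        have : (_ : ℝ) ≤ t := NNReal.coe_le_coe.2 h3
        rw [NNReal.coe_add] at this
        rw [waitingInto]
        linarith
    · rintro (⟨hi, rfl⟩ | ⟨_, h, ⟨hi, h3, h4⟩, rfl⟩)
      · exact ⟨hi, Or.inl ⟨rfl, hl⟩⟩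
      · refine ⟨hi, Or.inr ⟨h, (h2 h).2 ⟨?_, NNReal.coe_lt_coe.1 h4⟩⟩⟩
        rw [waitingInto] at h3
        rw [← NNReal.coe_le_coe, NNReal.coe_add]
        linarith
  rw [h1, Set.ncard_coe_finset, Finset.card_union_of_disjoint, Finset.card_map,
    decryptDelay, delay, ← le_card_filter_le_and_lt_iff (one_le_keysNeeded hk _)
      (keysNeeded_le_card_edgesFrom hK)]
  · rw [keysNeeded, Finset.filter_eq']
    split_ifs
    · rw [Finset.card_singleton]; omega
    · rw [Finset.card_empty]; omega
  · rw [Finset.disjoint_left]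
    intro i hi hi'
    obtain ⟨e, -, rfl⟩ := Finset.mem_map.1 hi'
    exact e.2 (Finset.mem_filter.1 hi).2

theorem decryptDelay_nonneg (hk : 1 ≤ k) : 0 ≤ decryptDelay k c K j l :=
  orderStatOn_nonneg (one_le_keysNeeded hk _) fun _ => NNReal.coe_nonneg _

/-- Within cycle `l`, only version `l` can become decryptable; the status of every older version was
settled when its cycle ended. So either `l` is decrypted and the age is 0, or the latest version is
the last earlier success. -/
theorem versionAge_eq {Ω : Type*} {D : ℕ → Set Ω} {ω : Ω} (hc : IsRegularInto c j) (hk : 1 ≤ k)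
    (hK : ∀ l, k + 1 ≤ (K l).card)
    (hD : ∀ l, ω ∈ D l ↔ decryptDelay k c K j l < waitingInto c j l none)
    (h1 : jumpTime (c .source) l ≤ t) (h2 : t < jumpTime (c .source) (l + 1)) :
    versionAge k c K j t =
      if jumpTime (c .source) l + decryptDelay k c K j l ≤ t then 0 else runLength D l ω := by
  have hs : IsCounterPath (c .source) := hc.path none
  have hl : c .source t = l := (hs.jumpTime_le_and_lt_iff hc.unitJumps).1 ⟨h1, h2⟩
  have hsucc (i : ℕ) : (jumpTime (c .source) (i + 1) : ℝ) =
      jumpTime (c .source) i + waitingInto c j i none := by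
    rw [jumpTime, NNReal.coe_add]; rfl
  have hlast {a : ℕ} (ha : IsGreatest
      {i | i ≤ c .source t ∧ (i = 0 ∨ k + 1 ≤ (keysObtained c K j i t).ncard)} a) :
      latestDecrypted k c K j t = a := ha.csSup_eq
  split_ifs with h
  · rw [versionAge, hlast (a := l), hl, sub_self]
    refine ⟨⟨hl.ge, Or.inr ((le_ncard_keysObtained_iff hc hk (hK l) hl.ge).2 ⟨by linarith, ?_⟩)⟩,
      fun i hi => hl ▸ hi.1⟩
    have := NNReal.coe_lt_coe.2 h2
    rw [hsucc] at this
    linarith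
  · obtain ⟨a, ha, hg⟩ := exists_runLength_eq D l ω
    rw [versionAge, hlast (a := a), hl, ha]
    convert hg using 3 with i
    constructor
    · rintro ⟨hi, rfl | h3⟩
      · exact Or.inl rfl
      · obtain ⟨h4, h5⟩ := (le_ncard_keysObtained_iff hc hk (hK i) hi).1 h3
        refine Or.inr ⟨lt_of_le_of_ne (hl ▸ hi) ?_, (hD i).2 h5⟩
        rintro rfl
        exact h (by linarith)
    · rintro (rfl | ⟨hi, h3⟩)
      · exact ⟨Nat.zero_le _, Or.inl rfl⟩
      · refine ⟨hl ▸ hi.le, Or.inr ((le_ncard_keysObtained_iff hc hk (hK i) (hl ▸ hi.le)).2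
          ⟨?_, (hD i).1 h3⟩)⟩
        -- For an older version the whole cycle is over by `t`, so success in that cycle already
        -- implies the time condition.
        have h4 : (jumpTime (c .source) (i + 1) : ℝ) ≤ t := by
          rw [NNReal.coe_le_coe, hs.jumpTime_le_iff hc.unitJumps, hl]
          exact hi
        rw [hsucc] at h4
        linarith [(hD i).1 h3]

end Network

/-! ### From averages over cycles to time averages. -/

section Renewal

variable {τ : ℕ → ℝ} {ν : ℝ → ℕ} {F : ℝ → ℝ} {a b : ℝ}

/-- A monotone function that grows linearly along the cycle starts grows linearly. -/
theorem tendsto_div_of_tendsto_div_cycles (hF : MonotoneOn F (Ici 0)) (hF0 : ∀ t, 0 ≤ t → 0 ≤ F t)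
    (hτ : ∀ l, 0 ≤ τ l) (hν : ∀ t, 0 ≤ t → τ (ν t) ≤ t ∧ t < τ (ν t + 1))
    (hνtop : Tendsto ν atTop atTop) (hb : 0 < b)
    (h1 : Tendsto (fun L : ℕ => (L : ℝ)⁻¹ * F (τ L)) atTop (𝓝 a))
    (h2 : Tendsto (fun L : ℕ => (L : ℝ)⁻¹ * τ L) atTop (𝓝 b)) :
    Tendsto (fun t => 1 / t * F t) atTop (𝓝 (a / b)) := by
  have h3 : Tendsto (fun L : ℕ => (L : ℝ)⁻¹ * ((L + 1 : ℕ) : ℝ)) atTop (𝓝 1) := by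
    have h : Tendsto (fun L : ℕ => 1 + (L : ℝ)⁻¹) atTop (𝓝 (1 + 0)) :=
      tendsto_const_nhds.add tendsto_inv_atTop_nhds_zero_nat
    rw [add_zero] at h
    refine h.congr' ?_
    filter_upwards [eventually_gt_atTop 0] with L hL
    have : (L : ℝ) ≠ 0 := by positivity
    push_cast
    field_simp
  have shift {u : ℕ → ℝ} {c : ℝ} (hu : Tendsto (fun L : ℕ => (L : ℝ)⁻¹ * u L) atTop (𝓝 c)) :
      Tendsto (fun L : ℕ => (L : ℝ)⁻¹ * u (L + 1)) atTop (𝓝 c) := by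
    have h := h3.mul (hu.comp (tendsto_add_atTop_nat 1))
    rw [one_mul] at h
    refine h.congr fun L => ?_
    have : ((L + 1 : ℕ) : ℝ) ≠ 0 := by positivity
    simp only [Function.comp_apply]
    field_simp
  have hlow : Tendsto (fun L : ℕ => F (τ L) / τ (L + 1)) atTop (𝓝 (a / b)) := by
    refine (h1.div (shift h2) hb.ne').congr' ?_
    filter_upwards [eventually_gt_atTop 0] with L hL
    have : (L : ℝ) ≠ 0 := by positivity
    exact mul_div_mul_left _ _ (inv_ne_zero this)
  have hupp : Tendsto (fun L : ℕ => F (τ (L + 1)) / τ L) atTop (𝓝 (a / b)) := by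
    refine ((shift (u := fun L => F (τ L)) h1).div h2 hb.ne').congr' ?_
    filter_upwards [eventually_gt_atTop 0] with L hL
    have : (L : ℝ) ≠ 0 := by positivity
    exact mul_div_mul_left _ _ (inv_ne_zero this)
  have hpos : ∀ᶠ L : ℕ in atTop, 0 < τ L := by
    filter_upwards [h2.eventually (lt_mem_nhds hb)] with L hL
    refine lt_of_le_of_ne (hτ L) fun h => ?_
    rw [← h, mul_zero] at hL
    exact lt_irrefl _ hL
  -- For t in cycle L, monotonicity places F(t)/t between F(τ_L)/τ_{L+1} and F(τ_{L+1})/τ_L, and the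
  -- index shift does not affect either limit.
  refine tendsto_of_tendsto_of_tendsto_of_le_of_le' (hlow.comp hνtop) (hupp.comp hνtop) ?_ ?_
  · filter_upwards [eventually_gt_atTop 0] with t ht
    obtain ⟨h4, h5⟩ := hν t ht.le
    rw [Function.comp_apply, one_div_mul_eq_div]
    exact div_le_div₀ (hF0 t ht.le) (hF (hτ _) ht.le h4) ht h5.le
  · filter_upwards [eventually_gt_atTop 0, hνtop.eventually hpos] with t ht h6
    obtain ⟨h4, h5⟩ := hν t ht.le
    rw [Function.comp_apply, one_div_mul_eq_div]
    exact div_le_div₀ (hF0 _ (hτ _)) (hF ht.le (hτ _) h5.le) h6 h4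

end Renewal

section Cycle

variable {g : ℝ → ℝ} {s d u R : ℝ}

/-- The function is `R` up to the truncated delay and 0 afterwards, which also covers cycles without
decryption. Working on open intervals makes the endpoint values irrelevant. -/
theorem intervalIntegrable_and_integral_cycle (hd : 0 ≤ d) (hu : 0 ≤ u)
    (hg : ∀ t, s ≤ t → t < s + u → g t = if s + d ≤ t then 0 else R) :
    IntervalIntegrable g volume s (s + u) ∧ ∫ t in s..s + u, g t = R * min d u := by
  have h1 : s ≤ s + min d u := le_add_of_nonneg_right (le_min hd hu)
  have h2 : s + min d u ≤ s + u := by gcongr; exact min_le_right _ _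
  have e1 : EqOn (fun _ => R) g (Ioo s (s + min d u)) := fun t ht => by
    rw [hg t ht.1.le (ht.2.trans_le h2), if_neg]
    have := ht.2.trans_le (add_le_add_right (min_le_left d u) s)
    exact not_le.2 this
  have e2 : EqOn (fun _ => 0) g (Ioo (s + min d u) (s + u)) := fun t ht => by
    rw [hg t (h1.trans ht.1.le) ht.2, if_pos]
    rcases min_choice d u with h | h
    · rw [← h]; exact ht.1.le
    · rw [h] at ht; exact absurd ht.1 (not_lt.2 ht.2.le)
  have i1 : IntervalIntegrable g volume s (s + min d u) :=
    intervalIntegrable_const.congr_uIoo (by rwa [uIoo_of_le h1])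
  have i2 : IntervalIntegrable g volume (s + min d u) (s + u) :=
    intervalIntegrable_const.congr_uIoo (by rwa [uIoo_of_le h2])
  refine ⟨i1.trans i2, ?_⟩
  rw [← intervalIntegral.integral_add_adjacent_intervals i1 i2,
    ← intervalIntegral.integral_congr_Ioo_of_le h1 e1,
    ← intervalIntegral.integral_congr_Ioo_of_le h2 e2]
  simp [mul_comm]

end Cycle

theorem IsCounterPath.tendsto {f : ℝ≥0 → ℕ} (hf : IsCounterPath f) :
    Tendsto (fun t : ℝ => f t.toNNReal) atTop atTop := by
  refine tendsto_atTop.2 fun b => ?_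
  obtain ⟨t, ht⟩ := hf.unbounded b
  filter_upwards [eventually_ge_atTop (t : ℝ)] with x hx
  exact ht.le.trans (hf.mono ((Real.le_toNNReal_iff_coe_le (t.2.trans hx)).2 hx))

section Network

variable {m : ℕ} {c : Counter m → ℝ≥0 → ℕ} {K : ℕ → Finset (Fin m)} {j : Fin m} {k : ℕ}

/-- The area under the age over one cycle is the run length times the truncated delay, so the
integral up to a cycle start is the sum in `h1`. Since the age is nonnegative, its integral is
monotone and can be interpolated between cycle starts. -/
theorem hasTimeAverage_versionAge {Ω : Type*} {D : ℕ → Set Ω} {ω : Ω} {a b : ℝ}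
    (hc : IsRegularInto c j) (hk : 1 ≤ k) (hK : ∀ l, k + 1 ≤ (K l).card)
    (hD : ∀ l, ω ∈ D l ↔ decryptDelay k c K j l < waitingInto c j l none) (hb : 0 < b)
    (h1 : Tendsto (fun L : ℕ => (L : ℝ)⁻¹ * ∑ l ∈ Finset.range L,
      runLength D l ω * min (decryptDelay k c K j l) (waitingInto c j l none)) atTop (𝓝 a))
    (h2 : Tendsto (fun L : ℕ => (L : ℝ)⁻¹ * ∑ l ∈ Finset.range L, waitingInto c j l none)
      atTop (𝓝 b)) :
    HasTimeAverage (versionAge k c K j) (a / b) := by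
  have hs : IsCounterPath (c .source) := hc.path none
  set g : ℝ → ℝ := fun t => versionAge k c K j t.toNNReal with hg
  set τ : ℕ → ℝ := fun l => jumpTime (c .source) l with hτ
  have hsucc (l : ℕ) : τ (l + 1) = τ l + waitingInto c j l none := by
    simp only [hτ]; rw [jumpTime, NNReal.coe_add]; rfl
  have hτ0 (l : ℕ) : 0 ≤ τ l := NNReal.coe_nonneg _
  have hcyc (t : ℝ) (ht : 0 ≤ t) :
      τ (c .source t.toNNReal) ≤ t ∧ t < τ (c .source t.toNNReal + 1) := by
    obtain ⟨h3, h4⟩ := (hs.jumpTime_le_and_lt_iff hc.unitJumps (t := t.toNNReal)).2 rfl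
    have h3 := NNReal.coe_le_coe.2 h3
    have h4 := NNReal.coe_lt_coe.2 h4
    rw [Real.coe_toNNReal t ht] at h3 h4
    exact ⟨h3, h4⟩
  have hage (l : ℕ) (t : ℝ) (h3 : τ l ≤ t) (h4 : t < τ l + waitingInto c j l none) :
      g t = if τ l + decryptDelay k c K j l ≤ t then 0 else runLength D l ω := by
    rw [← hsucc] at h4
    have ht := (hτ0 l).trans h3
    have h5 := versionAge_eq (t := t.toNNReal) hc hk hK hD
      ((Real.le_toNNReal_iff_coe_le ht).2 h3) ((Real.toNNReal_lt_iff_lt_coe ht).2 h4)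
    rwa [Real.coe_toNNReal t ht] at h5
  have hcycle (l : ℕ) := intervalIntegrable_and_integral_cycle (decryptDelay_nonneg hk)
    (NNReal.coe_nonneg _) (hage l)
  have hg0 (t : ℝ) : 0 ≤ g t := by
    rcases le_total 0 t with ht | ht
    · obtain ⟨h3, h4⟩ := hcyc t ht
      rw [hage _ t h3 (by rwa [hsucc] at h4)]
      split_ifs
      · exact le_rfl
      · exact runLength_nonneg _ _
    · have h3 : g t = g 0 := by simp only [hg, Real.toNNReal_of_nonpos ht, Real.toNNReal_zero]
      obtain ⟨h4, h5⟩ := hcyc 0 le_rfl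
      rw [h3, hage _ 0 h4 (by rwa [hsucc] at h5)]
      split_ifs
      · exact le_rfl
      · exact runLength_nonneg _ _
  have hint (L : ℕ) : IntervalIntegrable g volume 0 (τ L) :=
    IntervalIntegrable.trans_iterate (a := τ) fun l _ => by rw [hsucc]; exact (hcycle l).1
  have hintT (T : ℝ) (hT : 0 ≤ T) : IntervalIntegrable g volume 0 T := by
    refine (hint (c .source T.toNNReal + 1)).mono_set ?_
    rw [uIcc_of_le hT, uIcc_of_le (hτ0 _)]
    exact Icc_subset_Icc_right (hcyc T hT).2.le
  have hF (L : ℕ) : ∫ t in (0 : ℝ)..τ L, g t = ∑ l ∈ Finset.range L,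
      runLength D l ω * min (decryptDelay k c K j l) (waitingInto c j l none) := by
    rw [show (0 : ℝ) = τ 0 from rfl, ← intervalIntegral.sum_integral_adjacent_intervals
      fun l _ => by rw [hsucc]; exact (hcycle l).1]
    refine Finset.sum_congr rfl fun l _ => ?_
    rw [hsucc]
    exact (hcycle l).2
  have hτsum (L : ℕ) : τ L = ∑ l ∈ Finset.range L, waitingInto c j l none := by
    induction L with
    | zero => simp [hτ, jumpTime]
    | succ L ih => rw [hsucc, ih, Finset.sum_range_succ]
  refine ⟨fun T => ?_, ?_⟩
  · rcases le_total 0 T with hT | hT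
    · exact hintT T hT
    -- For negative `T`, `toNNReal` is 0 on the interval and the integrand is constant.
    · have h3 : EqOn (fun _ => g 0) g (uIoo 0 T) := fun t ht => by
        rw [uIoo_of_ge hT] at ht
        simp only [hg, Real.toNNReal_of_nonpos ht.2.le, Real.toNNReal_zero]
      exact intervalIntegrable_const.congr_uIoo h3
  · refine tendsto_div_of_tendsto_div_cycles (F := fun T => ∫ t in (0 : ℝ)..T, g t) (τ := τ)
      (ν := fun t => c .source t.toNNReal) ?_ ?_ hτ0 hcyc hs.tendsto hb ?_ ?_
    · intro x hx y hy hxy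
      exact intervalIntegral.integral_mono_interval le_rfl hx hxy
        (ae_of_all _ hg0) (hintT y hy)
    · intro t ht
      exact intervalIntegral.integral_nonneg ht fun x _ => hg0 x
    · simpa only [hF] using h1
    · simpa only [hτsum] using h2

end Network

/-! ### Mixture weights for subscribers and nonsubscribers. -/

section Selection

variable {m n k : ℕ} {S : Finset (Fin m)} {j : Fin m}

theorem ae_uniformOn_mem {α : Type*} [Fintype α] [DecidableEq α] (T : Finset α) (q : ℕ) :
    ∀ᵐ K ∂uniformOn (↑(Finset.powersetCard q T) : Set (Finset α)), K ⊆ T ∧ K.card = q := by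
  filter_upwards [ae_cond_mem (Finset.measurableSet _)] with K hK
  exact Finset.mem_powersetCard.1 hK

theorem card_union_of_mem_powersetCard_compl (hS : S.card ≤ n) {K : Finset (Fin m)} (h1 : K ⊆ Sᶜ)
    (h2 : K.card = n - S.card) : (S ∪ K).card = n := by
  rw [Finset.card_union_of_disjoint (Finset.disjoint_left.2 fun i hi hK =>
    Finset.mem_compl.1 (h1 hK) hi), h2]
  omega

theorem isProbabilityMeasure_selection (hnm : n ≤ m) :
    IsProbabilityMeasure (uniformOn (↑(Finset.powersetCard (n - S.card) Sᶜ) :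
      Set (Finset (Fin m)))) := by
  refine isProbabilityMeasure_uniformOn (Finset.finite_toSet _) ?_
  rw [Finset.coe_nonempty, Finset.powersetCard_nonempty, Finset.card_compl, Fintype.card_fin]
  omega

/-- The mean, over the random selection, of a quantity that depends on the number of edges that bring
keys to `j` and on the number of keys needed. -/
theorem integral_selection (hS : S.card ≤ n) (hnm : n ≤ m) (φ : ℕ → ℕ → ℝ) :
    (j ∉ S → ∫ K, φ (keysNeeded j k (S ∪ K)) (edgesFrom j (S ∪ K)).card
        ∂uniformOn (↑(Finset.powersetCard (n - S.card) Sᶜ) : Set (Finset (Fin m))) =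
      ((n : ℝ) - S.card) / ((m : ℝ) - S.card) * φ k (n - 1) +
        (1 - ((n : ℝ) - S.card) / ((m : ℝ) - S.card)) * φ (k + 1) n) ∧
    (j ∈ S → ∫ K, φ (keysNeeded j k (S ∪ K)) (edgesFrom j (S ∪ K)).card
        ∂uniformOn (↑(Finset.powersetCard (n - S.card) Sᶜ) : Set (Finset (Fin m))) =
      φ k (n - 1)) := by
  have hpr := isProbabilityMeasure_selection (S := S) hnm
  set ν := uniformOn (↑(Finset.powersetCard (n - S.card) Sᶜ) : Set (Finset (Fin m))) with hν
  have h1 : ∀ᵐ K ∂ν, φ (keysNeeded j k (S ∪ K)) (edgesFrom j (S ∪ K)).card =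
      if j ∈ S ∪ K then φ k (n - 1) else φ (k + 1) n := by
    filter_upwards [ae_uniformOn_mem Sᶜ (n - S.card)] with K hK
    rw [card_edgesFrom, card_union_of_mem_powersetCard_compl hS hK.1 hK.2, keysNeeded]
    split_ifs <;> rfl
  rw [integral_congr_ae h1]
  constructor
  · intro hj
    have hc : (Sᶜ).card = m - S.card := by rw [Finset.card_compl, Fintype.card_fin]
    have hle : S.card ≤ m := hS.trans hnm
    have h2 := measureReal_uniformOn_mem (T := Sᶜ) (q := n - S.card) (by omega)
      (Finset.mem_compl.2 hj)
    rw [hc, Nat.cast_sub hS, Nat.cast_sub hle, ← hν] at h2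
    -- For a nonsubscriber only the random part of the selection matters, so the integrand is affine
    -- in the indicator of `j ∈ K`, whose mean is (n - s)/(m - s).
    have h3 (K : Finset (Fin m)) : (if j ∈ S ∪ K then φ k (n - 1) else φ (k + 1) n) =
        {K | j ∈ K}.indicator (fun _ => φ k (n - 1) - φ (k + 1) n) K + φ (k + 1) n := by
      by_cases hK : j ∈ K <;> simp [hj, hK]
    have h4 : MeasurableSet {K : Finset (Fin m) | j ∈ K} := (Set.toFinite _).measurableSet
    simp only [h3]
    rw [integral_add ((integrable_const _).indicator h4) (integrable_const _),
      integral_indicator_const _ h4, h2, integral_const, probReal_univ, smul_eq_mul, one_smul]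
    ring
  · intro hj
    simp [hj]

end Selection

/-! ### Assembly of the theorem. -/

section Network

variable {Ω : Type*} [MeasurableSpace Ω] {P : Measure Ω} [IsProbabilityMeasure P] {k n m : ℕ}
  {lamS lamE : ℝ≥0} {S : Finset (Fin m)} {C : Counter m → ℝ≥0 → Ω → ℕ}
  {M : ℕ → Ω → Finset (Fin m)}

theorem counterRate_counterInto (j : Fin m) (o : Option {i : Fin m // i ≠ j}) :
    counterRate lamS lamE (counterInto j o) = cycleRate (edgeRate m lamE) lamS o := by
  cases o <;> rfl

omit [IsProbabilityMeasure P] in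
theorem IsHomogeneousNetwork.ae_isRegularInto (hnet : IsHomogeneousNetwork P n lamS lamE S C M)
    (hrate : ∀ c : Counter m, 0 < counterRate lamS lamE c) (j : Fin m) :
    ∀ᵐ ω ∂P, IsRegularInto (fun c t => C c t ω) j := by
  have h1 : ∀ᵐ ω ∂P, ∀ o, ∀ b : ℕ, ∃ t, b < C (counterInto j o) t ω :=
    ae_all_iff.2 fun o => (hnet.poisson _).ae_unbounded (hrate _)
  have h2 : ∀ᵐ ω ∂P, ∀ e, ∀ u, IsActivation (fun t => C .source t ω) u →
      ¬ IsActivation (fun t => C (counterInto j (some e)) t ω) u :=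
    ae_all_iff.2 fun e => (hnet.poisson .source).ae_no_common_jumps (hnet.poisson _)
      (hnet.counters_indep.indepFun (by simp [counterInto]))
  filter_upwards [h1, h2, (hnet.poisson .source).ae_unit_jumps] with ω h1 h2 h3
  exact ⟨fun o => ⟨(hnet.poisson _).zero ω, (hnet.poisson _).mono ω,
    (hnet.poisson _).rightContinuous ω, h1 o⟩, h3, h2⟩

/-- Without forwarding, the age of `j` depends only on the source, the edges into `j` and the
selections. The cycle averages are applied to this subfamily of counters, and the regularity of
paths is used on the almost sure event where it holds. -/
theorem IsHomogeneousNetwork.ae_hasTimeAverage (hnet : IsHomogeneousNetwork P n lamS lamE S C M)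
    (hk : 1 ≤ k) (hkn : k + 1 ≤ n) (hnm : n ≤ m) (hlamS : 0 < lamS) (hlamE : 0 < lamE)
    (hS : S.card ≤ n) (j : Fin m) :
    ∀ᵐ ω ∂P, HasTimeAverage (versionAge k (fun c t => C c t ω) (fun l => S ∪ M l ω) j)
      ((∫ K, expectedMin (keysNeeded j k (S ∪ K)) (edgesFrom j (S ∪ K)).card (edgeRate m lamE) lamS
          ∂uniformOn (↑(Finset.powersetCard (n - S.card) Sᶜ) : Set (Finset (Fin m)))) /
        (∫ K, probDecrypt (keysNeeded j k (S ∪ K)) (edgesFrom j (S ∪ K)).card (edgeRate m lamE) lamS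
          ∂uniformOn (↑(Finset.powersetCard (n - S.card) Sᶜ) : Set (Finset (Fin m)))) /
        meanCycle lamS) := by
  have hpr := isProbabilityMeasure_selection (S := S) hnm
  -- Positivity of m - 1 comes from m ≥ n ≥ k + 1 ≥ 2.
  have hedge : 0 < edgeRate m lamE :=
    div_pos hlamE (by exact_mod_cast (by omega : 0 < m - 1))
  have hrate : ∀ c : Counter m, 0 < counterRate lamS lamE c := by
    rintro (_ | _)
    · exact hlamS
    · exact hedge
  have hB (o : Option {i : Fin m // i ≠ j}) :
      IsPoissonCounter P (C (counterInto j o)) (cycleRate (edgeRate m lamE) lamS o) := by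
    rw [← counterRate_counterInto]
    exact hnet.poisson _
  have hr (o : Option {i : Fin m // i ≠ j}) : 0 < cycleRate (edgeRate m lamE) lamS o := by
    rw [← counterRate_counterInto]
    exact hrate _
  have hind : iIndepFun (fun (o : Option {i : Fin m // i ≠ j}) ω t => C (counterInto j o) t ω) P :=
    hnet.counters_indep.precomp (counterInto_injective j)
  have hMB : IndepFun (fun ω l => M l ω)
      (fun ω (o : Option {i : Fin m // i ≠ j}) t => C (counterInto j o) t ω) P :=
    hnet.selection_indep_counters.comp measurable_id
      (ψ := fun (x : Counter m → ℝ≥0 → ℕ) (o : Option {i : Fin m // i ≠ j}) => x (counterInto j o))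
      (measurable_pi_lambda _ fun o => measurable_pi_apply _)
  have hk' (K : Finset (Fin m)) : 1 ≤ keysNeeded j k (S ∪ K) := one_le_keysNeeded hk _
  have hkA : ∀ᵐ K ∂uniformOn (↑(Finset.powersetCard (n - S.card) Sᶜ) : Set (Finset (Fin m))),
      keysNeeded j k (S ∪ K) ≤ (edgesFrom j (S ∪ K)).card := by
    filter_upwards [ae_uniformOn_mem Sᶜ (n - S.card)] with K hK
    exact keysNeeded_le_card_edgesFrom
      (hkn.trans (card_union_of_mem_powersetCard_compl hS hK.1 hK.2).ge)
  have hcard : ∀ᵐ ω ∂P, ∀ l, k + 1 ≤ (S ∪ M l ω).card := by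
    refine ae_all_iff.2 fun l => ?_
    have h1 := ae_uniformOn_mem Sᶜ (n - S.card)
    rw [← (hnet.selection_law l).map_eq] at h1
    filter_upwards [ae_of_ae_map (hnet.selection_measurable l).aemeasurable h1] with ω hω
    exact hkn.trans (card_union_of_mem_powersetCard_compl hS hω.1 hω.2).ge
  have hmain := ae_tendsto_cycle_averages hB hr hind hnet.selection_measurable hnet.selection_indep
    hMB (A := fun K => edgesFrom j (S ∪ K)) hk' (fun l => (hnet.selection_law l).map_eq)
    (measureReal_decryptSet_pos hedge hlamS hk' hkA)
  filter_upwards [hmain, hcard, hnet.ae_isRegularInto hrate j] with ω h1 h2 h3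
  rw [← integral_timeBefore_prod hedge hlamS hk', ← measureReal_decryptSet hedge hlamS hk']
  exact hasTimeAverage_versionAge h3 hk h2 (fun l => Iff.rfl) (meanCycle_pos hlamS) h1.1 h1.2

end Network

theorem mainTheorem1 {Ω : Type*} [MeasurableSpace Ω] (P : Measure Ω) [IsProbabilityMeasure P]
    (k n m : ℕ) (hk : 1 ≤ k) (hkn : k + 1 ≤ n) (hnm : n ≤ m)
    (lamS lamE : ℝ≥0) (hlamS : 0 < lamS) (hlamE : 0 < lamE)
    (S : Finset (Fin m)) (hS : S.card ≤ n)
    (C : Counter m → ℝ≥0 → Ω → ℕ) (M : ℕ → Ω → Finset (Fin m))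
    (hnet : IsHomogeneousNetwork P n lamS lamE S C M) (j : Fin m) :
    (j ∉ S →
      ∀ α₀ α₁ : ℝ, α₀ = ((n : ℝ) - S.card) / ((m : ℝ) - S.card) → α₁ = 1 - α₀ →
      ∀ᵐ ω ∂P, HasTimeAverage
        (versionAge k (fun c t => C c t ω) (fun ℓ => S ∪ M ℓ ω) j)
        ((α₀ * expectedMin k (n - 1) (edgeRate m lamE) lamS
            + α₁ * expectedMin (k + 1) n (edgeRate m lamE) lamS) /
          (α₀ * probDecrypt k (n - 1) (edgeRate m lamE) lamS * meanCycle lamS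
            + α₁ * probDecrypt (k + 1) n (edgeRate m lamE) lamS * meanCycle lamS))) ∧
    (j ∈ S →
      ∀ᵐ ω ∂P, HasTimeAverage
        (versionAge k (fun c t => C c t ω) (fun ℓ => S ∪ M ℓ ω) j)
        (expectedMin k (n - 1) (edgeRate m lamE) lamS /
          (probDecrypt k (n - 1) (edgeRate m lamE) lamS * meanCycle lamS))) := by
  have h := hnet.ae_hasTimeAverage hk hkn hnm hlamS hlamE hS j
  have he := integral_selection (k := k) (j := j) hS hnm
    fun k N => expectedMin k N (edgeRate m lamE) lamS
  have hp := integral_selection (k := k) (j := j) hS hnm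
    fun k N => probDecrypt k N (edgeRate m lamE) lamS
  constructor
  · rintro hj α₀ α₁ rfl rfl
    -- The limit has the form (w / p) / E[U]; distributing E[U] over the two terms of p gives the
    -- stated denominator.
    rw [he.1 hj, hp.1 hj, div_div, add_mul] at h
    exact h
  · intro hj
    rw [he.2 hj, hp.2 hj, div_div] at h
    exact h
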